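/- **Setting.** Fix $1<r<R$. For an open set $U\subset\mathbb C$ let $H^\infty(U)$ be the Banach space of bounded holomorphic functions on $U$ with the supremum norm. For $\rho>1$ let $A_\rho=\{z\in\mathbb C:\rho^{-1}<|z|<\rho\}$ and $\mathbb T=\{|z|=1\}$. Consider either of the following two cases; $n$ runs through $\{1,2,\dots\}$. (E) *Elliptic domains.* Let $\gamma_+\ne\gamma_-$ be complex numbers, $\alpha(z)=\frac{\gamma_+-\gamma_-}2z+\frac{\gamma_++\gamma_-}2$, and $U_\rho=\alpha\left(\{\tfrac12(w+w^{-1}):w\in A_\rho\}\right)$. Let $(\Phi_i)_{i\in\mathcal I}$, $(W_i)_{i\in\mathcal I}$ be finite or countable families in $H^\infty(U_R)$ with $\Phi_i(U_R)\subseteq U_r$ for all $i$ and $\sup_{z\in U_R}\sum_i|W_i(z)|<\infty$. Let $\mathcal L f=\sum_iW_i\cdot(f\circ\Phi_i)$ for $f\in H^\infty(U_r)$, and let $P_nf$ be the polynomial of degree at most $n-1$ that agrees with $f$ at the points $\alpha\left(\cos\frac{(2k+1)\pi}{2n}\right)$, $0\le k\le n-1$. (C) *Annuli.* Let $U_\rho=A_\rho$.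 Let $\tau:\mathbb T\to\mathbb T$ be an analytic map with $\inf_{\mathbb T}|\tau'|>1$ such that $\tau$ and $1/\tau$ are holomorphic on $A_R$, $\tau(A_r)\supseteq\overline{A_R}$, and $\tau(\partial A_r)\cap\overline{A_R}=\emptyset$. Let $w\in H^\infty(A_R)$. For $f\in H^\infty(A_r)$ let $\mathcal L f$ be the element of $H^\infty(A_r)$ whose restriction to $\mathbb T$ is $$(\mathcal L f)(z)=\sum_{\zeta\in\mathbb T,\ \tau(\zeta)=z}\frac{w(\zeta)}{|\tau'(\zeta)|}f(\zeta)\qquad(z\in\mathbb T),$$ and let $P_nf$ be the Laurent polynomial in the span of $z^{-n},\dots,z^{n-1}$ that agrees with $f$ at the $2n$ points $\exp\left(\frac{2k+1}{2n}i\pi\right)$, $0\le k\le 2n-1$. **Corollary 3.8.** In both cases these conditions define exactly one bounded operator $\mathcal L:H^\infty(U_r)\to H^\infty(U_r)$. Put $\mathcal L_n=P_n\mathcal L$. Then: (i) If $\mu_n\in\operatorname{spec}(\mathcal L_n)$ for all $n$ and $\mu_n\to\mu$, then $\mu\in\operatorname{spec}(\mathcal L)$. (ii) For every $\mu\in\operatorname{spec}(\mathcal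 L)$ there are $\mu_n\in\operatorname{spec}(\mathcal L_n)$ with $\mu_n\to\mu$, and such that, if $\mu$ is an eigenvalue of $\mathcal L$ of ascent $\ell$ (the smallest integer with $\ker(\mu I-\mathcal L)^\ell=\ker(\mu I-\mathcal L)^{\ell+1}$), then $$|\mu-\mu_n|=O\left((r/R)^{n/\ell}\right)\qquad(n\to\infty).$$ If $\mu\neq0$ is an eigenvalue of ascent $\ell$, this rate holds for every sequence $\mu_n\in\operatorname{spec}(\mathcal L_n)$ with $\mu_n\to\mu$. (iii) Let $\mu\in\operatorname{spec}(\mathcal L)\setminus\{0\}$. Then $\mu$ is an isolated point of $\operatorname{spec}(\mathcal L)$; let $\mathcal P=\frac1{2\pi i}\oint_{|z-\mu|=\varepsilon}(zI-\mathcal L)^{-1}\,dz$ be the spectral projection of $\mathcal L$ at $\mu$, where $\varepsilon>0$ is such that $\mu$ is the only spectral point of $\mathcal L$ with distance at most $\varepsilon$ from $\mu$. If $\mu_n\in\operatorname{spec}(\mathcal L_n)$, $\mu_n\to\mu$, and $h_n\in\bigcup_{k}\ker(\mu_nI-\mathcal L_n)^k$ with $\|h_n\|_{H^\infty(U_r)}=1$,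 then $$\|\mathcal Ph_n-h_n\|_{H^\infty(U_r)}=O\left((r/R)^n\right)\qquad(n\to\infty).$$ -/

import Mathlib

open Filter Topology Asymptotics

universe u

noncomputable section

/-! ### The Hardy space of bounded holomorphic functions -/

/-- The extension by zero of a function defined on a subset of the plane. -/
def zeroExt {U : Set ℂ} (f : U → ℂ) : ℂ → ℂ :=
  Function.extend Subtype.val f 0

theorem zeroExt_apply {U : Set ℂ} (f : U → ℂ) (z : U) : zeroExt f z = f z :=
  Subtype.val_injective.extend_apply f 0 z

theorem differentiableOn_zeroExt {U : Set ℂ} {f : U → ℂ} {g : ℂ → ℂ}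
    (hg : DifferentiableOn ℂ g U) (h : ∀ z : U, f z = g z) :
    DifferentiableOn ℂ (zeroExt f) U :=
  hg.congr fun z hz => (zeroExt_apply f ⟨z, hz⟩).trans (h ⟨z, hz⟩)

/-- `Hinf U` is the space of bounded holomorphic functions on `U` (for `U` open), with the
supremum norm, which it inherits from the bounded continuous functions on `U`. -/
def Hinf (U : Set ℂ) : Submodule ℂ (BoundedContinuousFunction U ℂ) where
  carrier := {f | DifferentiableOn ℂ (zeroExt f) U}
  zero_mem' := differentiableOn_zeroExt (differentiableOn_const (0 : ℂ)) fun _ => rfl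
  add_mem' := fun {f g} hf hg => differentiableOn_zeroExt (DifferentiableOn.add hf hg) fun z => by
    simp [zeroExt_apply]
  smul_mem' := fun c f hf =>
    differentiableOn_zeroExt (DifferentiableOn.const_smul hf c) fun z => by
      simp [zeroExt_apply]

/-- The value of `f ∈ Hinf U` at `z`; it is the value of `f` for `z ∈ U`, and `0` off `U`. -/
def hinfVal {U : Set ℂ} (f : Hinf U) : ℂ → ℂ :=
  zeroExt (f : BoundedContinuousFunction U ℂ)

/-- A bounded holomorphic function on `U`, as an element of `Hinf U`. -/
def Hinf.mk {U : Set ℂ} (g : ℂ → ℂ) (hg : DifferentiableOn ℂ g U)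
    (hb : ∃ C : ℝ, ∀ z ∈ U, ‖g z‖ ≤ C) : Hinf U :=
  ⟨BoundedContinuousFunction.ofNormedAddCommGroup (fun z : U => g z)
      (continuousOn_iff_continuous_domRestrict.mp hg.continuousOn) hb.choose
      fun z => hb.choose_spec z z.2,
    differentiableOn_zeroExt hg fun _ => rfl⟩

/-- Evaluation at a point of `U`, as a bounded functional on `Hinf U`. -/
def Hinf.evalCLM {U : Set ℂ} (z : ℂ) (hz : z ∈ U) : Hinf U →L[ℂ] ℂ :=
  (BoundedContinuousFunction.evalCLM ℂ (⟨z, hz⟩ : U)).comp (Hinf U).subtypeL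

/-! ### Annuli and elliptic domains -/

/-- The open annulus `A_ρ = {z : ρ⁻¹ < |z| < ρ}`. -/
def annulus (ρ : ℝ) : Set ℂ := {z | ρ⁻¹ < ‖z‖ ∧ ‖z‖ < ρ}

/-- The Joukowski transform. -/
def joukowski (z : ℂ) : ℂ := (z + z⁻¹) / 2

/-- The affine map that takes `1` to `γp` and `-1` to `γm`. -/
def affineFoci (γp γm : ℂ) (z : ℂ) : ℂ := (γp - γm) / 2 * z + (γp + γm) / 2

/-- The elliptic domain with foci `γp`, `γm` and parameter `ρ`: the image of the standard elliptic
domain `joukowski '' annulus ρ` under the affine map `affineFoci γp γm`. -/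
def ellipse (γp γm : ℂ) (ρ : ℝ) : Set ℂ := affineFoci γp γm '' (joukowski '' annulus ρ)

theorem mem_annulus_of_norm_eq_one {ρ : ℝ} (hρ : 1 < ρ) {z : ℂ} (hz : ‖z‖ = 1) :
    z ∈ annulus ρ :=
  ⟨hz.symm ▸ inv_lt_one_of_one_lt₀ hρ, hz.symm ▸ hρ⟩

theorem isBounded_ellipse (γp γm : ℂ) {ρ : ℝ} (hρ : 1 < ρ) :
    Bornology.IsBounded (ellipse γp γm ρ) := by
  refine isBounded_iff_forall_norm_le.mpr ⟨‖(γp - γm) / 2‖ * ρ + ‖(γp + γm) / 2‖, ?_⟩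
  rintro _ ⟨_, ⟨w, hw, rfl⟩, rfl⟩
  have h2 : ‖w⁻¹‖ ≤ ρ := by
    rw [norm_inv]
    exact inv_le_of_inv_le₀ (by positivity) hw.1.le
  have h1 : ‖joukowski w‖ ≤ ρ := by
    have h3 := norm_add_le w w⁻¹
    have h4 := hw.2
    rw [joukowski, norm_div, Complex.norm_ofNat]
    linarith
  refine (norm_add_le _ _).trans ?_
  rw [norm_mul]
  gcongr

theorem exists_bound_of_continuous {U : Set ℂ} (hU : Bornology.IsBounded U) {g : ℂ → ℂ}
    (hg : Continuous g) : ∃ C : ℝ, ∀ z ∈ U, ‖g z‖ ≤ C := by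
  obtain ⟨C, hC⟩ := hU.isCompact_closure.exists_bound_of_continuousOn hg.continuousOn
  exact ⟨C, fun z hz => hC z (subset_closure hz)⟩

/-! ### Lagrange--Chebyshev interpolation -/

/-- The image, under the affine map `affineFoci γp γm`, of the `k`-th Chebyshev node
`cos ((2 k + 1) π / (2 n))` of order `n`. -/
def chebyshevNode (γp γm : ℂ) (n k : ℕ) : ℂ :=
  affineFoci γp γm ((Real.cos ((2 * k + 1) * Real.pi / (2 * n)) : ℝ) : ℂ)

theorem chebyshevNode_mem (γp γm : ℂ) {ρ : ℝ} (hρ : 1 < ρ) (n k : ℕ) :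
    chebyshevNode γp γm n k ∈ ellipse γp γm ρ := by
  refine ⟨_, ⟨Complex.exp (((2 * k + 1) * Real.pi / (2 * n) : ℝ) * Complex.I),
    mem_annulus_of_norm_eq_one hρ (Complex.norm_exp_ofReal_mul_I _), ?_⟩, rfl⟩
  rw [joukowski, ← Complex.exp_neg, Complex.ofReal_cos, Complex.cos, neg_mul]

/-- The `k`-th Lagrange basis polynomial (of degree `n - 1`) for the transported Chebyshev nodes
of order `n`. -/
def chebyshevLagrange (γp γm : ℂ) (n : ℕ) (k : Fin n) : Polynomial ℂ :=
  Lagrange.basis Finset.univ (fun j : Fin n => chebyshevNode γp γm n j) k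

/-- The Lagrange--Chebyshev projection on `Hinf (ellipse γp γm ρ)`: it takes `f` to the polynomial
of degree less than `n` that agrees with `f` at the transported Chebyshev nodes of order `n`. -/
def chebyshevProj (γp γm : ℂ) {ρ : ℝ} (hρ : 1 < ρ) (n : ℕ) :
    Hinf (ellipse γp γm ρ) →L[ℂ] Hinf (ellipse γp γm ρ) :=
  ∑ k : Fin n, (Hinf.evalCLM (chebyshevNode γp γm n k) (chebyshevNode_mem γp γm hρ n k)).smulRight
    (Hinf.mk (fun z => (chebyshevLagrange γp γm n k).eval z)
      (Polynomial.differentiable _).differentiableOn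
      (exists_bound_of_continuous (isBounded_ellipse γp γm hρ) (Polynomial.continuous _)))

/-! ### Equidistant interpolation on the unit circle -/

/-- The `k`-th of the `2 n` equidistant nodes on the unit circle, a root of `z ^ (2 n) = -1`. -/
def circleNode (n k : ℕ) : ℂ :=
  Complex.exp (((2 * k + 1) / (2 * n) * Real.pi : ℝ) * Complex.I)

theorem norm_circleNode (n k : ℕ) : ‖circleNode n k‖ = 1 := Complex.norm_exp_ofReal_mul_I _

/-- The `k`-th Lagrange Laurent polynomial `(2 n)⁻¹ ∑_{-n ≤ l ≤ n - 1} (z / z_k) ^ l` for the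
`2 n` equidistant nodes. -/
def circleLagrange (n k : ℕ) (z : ℂ) : ℂ :=
  (2 * n : ℂ)⁻¹ * ∑ l ∈ Finset.Ico (-(n : ℤ)) n, (z / circleNode n k) ^ l

theorem ne_zero_of_mem_annulus {ρ : ℝ} (hρ : 1 < ρ) {z : ℂ} (hz : z ∈ annulus ρ) : z ≠ 0 :=
  norm_pos_iff.mp (lt_trans (by positivity) hz.1)

theorem differentiableOn_circleLagrange {ρ : ℝ} (hρ : 1 < ρ) (n k : ℕ) :
    DifferentiableOn ℂ (circleLagrange n k) (annulus ρ) := by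
  refine DifferentiableOn.const_mul (DifferentiableOn.fun_sum fun l _ => ?_) _
  refine DifferentiableOn.zpow (differentiableOn_id.div_const _) (Or.inl fun z hz => ?_)
  exact div_ne_zero (ne_zero_of_mem_annulus hρ hz)
    (norm_pos_iff.mp (by rw [norm_circleNode]; exact one_pos))

theorem bounded_circleLagrange {ρ : ℝ} (hρ : 1 < ρ) (n k : ℕ) :
    ∃ C : ℝ, ∀ z ∈ annulus ρ, ‖circleLagrange n k z‖ ≤ C := by
  have hb : Bornology.IsBounded (annulus ρ) :=
    isBounded_iff_forall_norm_le.mpr ⟨ρ, fun z hz => hz.2.le⟩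
  have hsub : closure (annulus ρ) ⊆ annulus (ρ + 1) := by
    have hc : IsClosed {z : ℂ | ρ⁻¹ ≤ ‖z‖ ∧ ‖z‖ ≤ ρ} :=
      (isClosed_le continuous_const continuous_norm).inter
        (isClosed_le continuous_norm continuous_const)
    have hle : annulus ρ ⊆ {z : ℂ | ρ⁻¹ ≤ ‖z‖ ∧ ‖z‖ ≤ ρ} := fun z hz => ⟨hz.1.le, hz.2.le⟩
    refine (closure_minimal hle hc).trans fun z hz => ?_
    exact ⟨lt_of_lt_of_le (inv_strictAnti₀ (by positivity) (by linarith)) hz.1, by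
      have := hz.2
      linarith⟩
  obtain ⟨C, hC⟩ := hb.isCompact_closure.exists_bound_of_continuousOn
    ((differentiableOn_circleLagrange (ρ := ρ + 1) (by linarith) n k).continuousOn.mono hsub)
  exact ⟨C, fun z hz => hC z (subset_closure hz)⟩

/-- The equidistant interpolation projection on `Hinf (annulus ρ)`: it takes `f` to the Laurent
polynomial in the span of `z ^ (-n), …, z ^ (n - 1)` that agrees with `f` at the `2 n` equidistant
nodes. -/
def circleProj {ρ : ℝ} (hρ : 1 < ρ) (n : ℕ) : Hinf (annulus ρ) →L[ℂ] Hinf (annulus ρ) :=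
  ∑ k : Fin (2 * n),
    (Hinf.evalCLM (circleNode n k)
      (mem_annulus_of_norm_eq_one hρ (norm_circleNode n k))).smulRight
    (Hinf.mk (circleLagrange n k) (differentiableOn_circleLagrange hρ n k)
      (bounded_circleLagrange hρ n k))

/-! ### Transfer operators -/

/-- A holomorphic map-weight system on the elliptic domain with parameter `R`, contracting it into
the one with parameter `r`. (The maps and the weights are then bounded.) -/
structure IsMapWeightSystem (γp γm : ℂ) (r R : ℝ) {ι : Type*} (Φ W : ι → ℂ → ℂ) : Prop where
  holo_map : ∀ i, DifferentiableOn ℂ (Φ i) (ellipse γp γm R)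
  contracting : ∀ i, Set.MapsTo (Φ i) (ellipse γp γm R) (ellipse γp γm r)
  holo_weight : ∀ i, DifferentiableOn ℂ (W i) (ellipse γp γm R)
  bounded_weight : ∃ S : ℝ, ∀ z ∈ ellipse γp γm R,
    Summable (fun i => ‖W i z‖) ∧ ∑' i, ‖W i z‖ ≤ S

/-- `L` is the transfer operator `f ↦ ∑ i, W i • (f ∘ Φ i)` on the bounded holomorphic functions
on the elliptic domain with parameter `r`. -/
def IsMapWeightTransfer (γp γm : ℂ) (r : ℝ) {ι : Type*} (Φ W : ι → ℂ → ℂ)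
    (L : Hinf (ellipse γp γm r) →L[ℂ] Hinf (ellipse γp γm r)) : Prop :=
  ∀ f : Hinf (ellipse γp γm r), ∀ z ∈ ellipse γp γm r,
    HasSum (fun i => W i z * hinfVal f (Φ i z)) (hinfVal (L f) z)

/-- `τ` is (the holomorphic extension to `annulus R` of) an analytic expanding map of the unit
circle, without zeros on `annulus R`, such that `τ '' annulus r` covers the closure of `annulus R`
and the boundary of `annulus r` is mapped off the closure of `annulus R`. -/
structure IsExpandingCircleMap (r R : ℝ) (τ : ℂ → ℂ) : Prop where
  holo : DifferentiableOn ℂ τ (annulus R)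
  ne_zero : ∀ z ∈ annulus R, τ z ≠ 0
  maps_circle : ∀ z : ℂ, ‖z‖ = 1 → ‖τ z‖ = 1
  expanding : ∃ c : ℝ, 1 < c ∧ ∀ z : ℂ, ‖z‖ = 1 → c ≤ ‖deriv τ z‖
  covers : closure (annulus R) ⊆ τ '' annulus r
  boundary : ∀ z : ℂ, ‖z‖ = r ∨ ‖z‖ = r⁻¹ → τ z ∉ closure (annulus R)

/-- `L` is the operator on the bounded holomorphic functions on `annulus r` that is given on the
unit circle by the (generalised) transfer operator of `τ` with weight `w`: for `|z| = 1`,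
`(L f) z` is the finite sum of `w ζ / |τ' ζ| * f ζ` over the preimages `ζ` of `z` on the circle. -/
def IsCircleTransfer (r : ℝ) (τ w : ℂ → ℂ)
    (L : Hinf (annulus r) →L[ℂ] Hinf (annulus r)) : Prop :=
  ∀ f : Hinf (annulus r), ∀ z : ℂ, ‖z‖ = 1 →
    hinfVal (L f) z = ∑ᶠ ζ ∈ {ζ : ℂ | ‖ζ‖ = 1 ∧ τ ζ = z}, w ζ / (‖deriv τ ζ‖ : ℂ) * hinfVal f ζ

/-! ### Spectral data -/

section Spectral

variable {X : Type*} [NormedAddCommGroup X] [NormedSpace ℂ X]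

/-- `μ` is an eigenvalue of `T` with ascent `l`: the number `l` is the smallest one such that
`(μ - T) ^ l` and `(μ - T) ^ (l + 1)` have the same kernel. -/
def HasEigenvalueOfAscent (T : X →L[ℂ] X) (μ : ℂ) (l : ℕ) : Prop :=
  Module.End.HasEigenvalue (T : X →ₗ[ℂ] X) μ ∧
    IsLeast {j : ℕ | LinearMap.ker ((algebraMap ℂ (Module.End ℂ X) μ - (T : X →ₗ[ℂ] X)) ^ j) =
      LinearMap.ker ((algebraMap ℂ (Module.End ℂ X) μ - (T : X →ₗ[ℂ] X)) ^ (j + 1))} l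

/-- The closed disc of radius `ε > 0` about the spectral point `μ` of `T` contains no other
spectral point. -/
def IsolatesSpectralPoint (T : X →L[ℂ] X) (μ : ℂ) (ε : ℝ) : Prop :=
  0 < ε ∧ Metric.closedBall μ ε ∩ spectrum ℂ T = {μ}

/-- The Riesz integral `(2 π i)⁻¹ ∮ (z - T)⁻¹ dz` over the circle of radius `ε` about `μ`. If
`IsolatesSpectralPoint T μ ε`, this is the spectral projection of `T` at `μ`. -/
def rieszProj (T : X →L[ℂ] X) (μ : ℂ) (ε : ℝ) : X →L[ℂ] X :=
  (2 * Real.pi * Complex.I : ℂ)⁻¹ • ∮ z in C(μ, ε), resolvent T z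

/-- The spectral data of `Tn n` converge to those of `T`, at the exponential rate `q ^ n`. -/
structure SpectralDataConverge (T : X →L[ℂ] X) (Tn : ℕ → X →L[ℂ] X) (q : ℝ) : Prop where
  /-- Limits of spectral points are spectral points. -/
  limit_mem : ∀ (μs : ℕ → ℂ) (μ : ℂ), (∀ n, 1 ≤ n → μs n ∈ spectrum ℂ (Tn n)) →
    Tendsto μs atTop (𝓝 μ) → μ ∈ spectrum ℂ T
  /-- Every spectral point is such a limit, with a rate if it is an eigenvalue of finite ascent. -/
  exists_approx : ∀ μ ∈ spectrum ℂ T, ∃ μs : ℕ → ℂ, (∀ n, 1 ≤ n → μs n ∈ spectrum ℂ (Tn n)) ∧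
    Tendsto μs atTop (𝓝 μ) ∧
    ∀ l : ℕ, HasEigenvalueOfAscent T μ l →
      (fun n => ‖μ - μs n‖) =O[atTop] fun n : ℕ => q ^ ((n : ℝ) / (l : ℝ))
  /-- For nonzero eigenvalues, the rate holds for every sequence of spectral points. -/
  rate : ∀ (μ : ℂ) (l : ℕ), μ ≠ 0 → HasEigenvalueOfAscent T μ l →
    ∀ μs : ℕ → ℂ, (∀ n, 1 ≤ n → μs n ∈ spectrum ℂ (Tn n)) → Tendsto μs atTop (𝓝 μ) →
      (fun n => ‖μ - μs n‖) =O[atTop] fun n : ℕ => q ^ ((n : ℝ) / (l : ℝ))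
  /-- A nonzero spectral point is isolated, so that it has a spectral projection. -/
  isolated : ∀ μ ∈ spectrum ℂ T, μ ≠ 0 → ∃ ε : ℝ, IsolatesSpectralPoint T μ ε
  /-- Normalised generalised eigenvectors are almost fixed by the spectral projection. -/
  eigenvectors : ∀ μ ∈ spectrum ℂ T, μ ≠ 0 → ∀ ε : ℝ, IsolatesSpectralPoint T μ ε →
    ∀ μs : ℕ → ℂ, (∀ n, 1 ≤ n → μs n ∈ spectrum ℂ (Tn n)) → Tendsto μs atTop (𝓝 μ) →
    ∀ h : ℕ → X, (∀ n, 1 ≤ n →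
      h n ∈ Module.End.maxGenEigenspace (Tn n : X →ₗ[ℂ] X) (μs n) ∧ ‖h n‖ = 1) →
      (fun n => ‖rieszProj T μ ε (h n) - h n‖) =O[atTop] fun n : ℕ => q ^ n

end Spectral

end

/-! The operator `L` improves domains: every `L f` extends to a bounded holomorphic function on the
larger domain with parameter `R`, with norm at most a constant times `‖f‖`. Interpolation converges
on such functions at the rate `(r / R) ^ n`, uniformly on the smaller domain. Hence `‖P_n L - L‖ =
O((r / R) ^ n)` in operator norm, and the rest is perturbation theory for finite-rank
approximations, collected in `spectralDataConverge_of_norm_sub_le`.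

Perturbation theory. As a norm limit of finite-rank operators `L` is compact, so near a nonzero
spectral point `μ` of ascent `l` Riesz theory gives `‖(z - L)⁻¹‖ ≤ C |z - μ| ^ (-l)`. A point `μ_n`
in the spectrum of `L_n` cannot satisfy `‖(μ_n - L)⁻¹‖ ‖L_n - L‖ < 1`, and this is the rate `(r / R)
^ (n / l)`. Approximating spectral points exist by the maximum principle for the resolvent of `L_n`;
the point `0` lies in every spectrum because the space is infinite-dimensional. Generalised
eigenvectors of `L_n` are fixed by its Riesz integral, which is compared with that of `L` by the
second resolvent identity.

Interpolation. The `2 n` circle nodes are the zeros of `ω(z) = z ^ n + z ^ (-n)`. Interpolating the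
Cauchy kernel gives Hermite's formula: the error is the integral of `f(ζ) ω(z) / (ω(ζ) (ζ - z))`
over the boundary of an annulus (`circleInterp_sub_eq`). The Joukowski map turns Chebyshev
interpolation into circle interpolation (`hinfVal_chebyshevProj`).

Domain improvement. For map-weight systems the defining series already converges on the larger
domain. For circle maps the residue theorem gives `L f (z) = ± z (2 π i)⁻¹ ∮ w f / (ζ (τ ζ - z)) dζ`
over the boundary of an annulus slightly smaller than `annulus r`; since `τ` sends that boundary
away from `annulus R`, the right side is holomorphic in `z` there (`kernelTransfer_eq`,
`exists_kernel`). -/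

noncomputable section

/-! ### Riesz theory of compact operators -/

section Riesz

variable {X : Type*} [NormedAddCommGroup X] [NormedSpace ℂ X]

/-- If the kernels grew strictly forever, Riesz's lemma would give a bounded sequence, each vector
far from the previous kernel, whose images under `T` are `‖μ‖`-separated; compactness forbids this.
-/
theorem IsCompactOperator.exists_ker_pow_eq_ker_pow_succ {T : X →L[ℂ] X}
    (hT : IsCompactOperator T) {μ : ℂ} (hμ : μ ≠ 0) :
    ∃ l : ℕ, LinearMap.ker (((μ • (1 : X →L[ℂ] X) - T) ^ l : X →L[ℂ] X) : X →ₗ[ℂ] X) =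
      LinearMap.ker (((μ • (1 : X →L[ℂ] X) - T) ^ (l + 1) : X →L[ℂ] X) : X →ₗ[ℂ] X) := by
  set S : X →L[ℂ] X := μ • (1 : X →L[ℂ] X) - T with hS
  let N : ℕ → Submodule ℂ X := fun k => LinearMap.ker ((S ^ k : X →L[ℂ] X) : X →ₗ[ℂ] X)
  have hN : ∀ k x, x ∈ N k ↔ (S ^ k) x = 0 := fun k x => Iff.rfl
  have hmono : Monotone N := by
    refine monotone_nat_of_le_succ fun k x hx => ?_
    rw [hN] at hx ⊢
    rw [pow_succ', mul_apply_eq_comp, hx, map_zero]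
  have hdown : ∀ k x, x ∈ N (k + 1) → S x ∈ N k := fun k x hx => by
    rw [hN] at hx ⊢
    rwa [pow_succ, mul_apply_eq_comp] at hx
  by_contra! h
  obtain ⟨c, hc⟩ := NormedField.exists_one_lt_norm ℂ
  have key : ∀ k, ∃ x ∈ N (k + 1), ‖x‖ ≤ ‖c‖ + 1 ∧ ∀ y ∈ N k, 1 ≤ ‖x - y‖ := by
    intro k
    have hcl : IsClosed (((N k).comap (N (k + 1)).subtype : Submodule ℂ (N (k + 1))) :
        Set (N (k + 1))) := by
      have : IsClosed ((N k : Submodule ℂ X) : Set X) := (S ^ k).isClosed_ker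
      exact this.preimage continuous_subtype_val
    have hne : ∃ x : N (k + 1), x ∉ (N k).comap (N (k + 1)).subtype := by
      by_contra! h'
      exact h k (le_antisymm (hmono k.le_succ) fun x hx => h' ⟨x, hx⟩)
    obtain ⟨⟨x, hx⟩, hxn, hxy⟩ := riesz_lemma_of_norm_lt hc (lt_add_one ‖c‖) hcl hne
    exact ⟨x, hx, hxn, fun y hy => hxy ⟨y, hmono k.le_succ hy⟩ hy⟩
  choose f hfN hfn hfd using key
  have hsep : ∀ m n, m < n → ‖μ‖ ≤ ‖T (f n) - T (f m)‖ := by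
    intro m n hmn
    have hTS : ∀ x, T x = μ • x - S x := fun x => by simp [hS]
    -- Up to the factor `μ`, the difference of the images is `f n` minus this vector of the smaller
    -- kernel `N n`.
    have hu : μ⁻¹ • (S (f n) + T (f m)) ∈ N n := by
      refine (N n).smul_mem _ ((N n).add_mem (hdown _ _ (hfN n)) ?_)
      rw [hTS]
      exact (N n).sub_mem ((N n).smul_mem _ (hmono hmn (hfN m)))
        (hmono (Nat.le_of_lt hmn) (hdown _ _ (hfN m)))
    have h1 := hfd n _ hu
    have h2 : T (f n) - T (f m) = μ • (f n - μ⁻¹ • (S (f n) + T (f m))) := by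
      rw [smul_sub, smul_inv_smul₀ hμ, hTS (f n)]
      abel
    rw [h2, norm_smul]
    exact le_mul_of_one_le_right (norm_nonneg _) h1
  obtain ⟨K, hK, hK'⟩ := hT.image_closedBall_subset_compact (‖c‖ + 1)
  obtain ⟨y, -, ψ, hψ, hψy⟩ := hK.tendsto_subseq (x := fun n => T (f n))
    (fun n => hK' ⟨f n, by simpa using hfn n, rfl⟩)
  obtain ⟨M, hM⟩ := Metric.cauchySeq_iff'.mp hψy.cauchySeq ‖μ‖ (norm_pos_iff.mpr hμ)
  have h3 := hM (M + 1) (Nat.le_succ M)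
  rw [dist_eq_norm] at h3
  exact (hsep _ _ (hψ (Nat.lt_succ_self M))).not_gt h3

/-- This form makes the Fredholm alternative available for the power itself. -/
theorem IsCompactOperator.exists_pow_eq {T : X →L[ℂ] X} (hT : IsCompactOperator T) (μ : ℂ)
    (l : ℕ) : ∃ K : X →L[ℂ] X, IsCompactOperator K ∧
      (μ • (1 : X →L[ℂ] X) - T) ^ l = μ ^ l • (1 : X →L[ℂ] X) - K := by
  induction l with
  | zero => exact ⟨0, isCompactOperator_zero, by simp⟩
  | succ l ih =>
    obtain ⟨K, hK, h⟩ := ih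
    refine ⟨μ ^ l • T + K * (μ • 1 - T), ?_, ?_⟩
    · exact (hT.smul (μ ^ l)).add (hK.comp_clm _)
    · rw [pow_succ, h, sub_mul, smul_mul_assoc, one_mul, smul_sub, smul_smul, ← pow_succ]
      abel

/-- On the kernel `c⁻¹ • K` is the identity, which is therefore compact there. -/
theorem finiteDimensional_ker_of_isCompactOperator {K : X →L[ℂ] X} (hK : IsCompactOperator K)
    {c : ℂ} (hc : c ≠ 0) :
    FiniteDimensional ℂ (LinearMap.ker ((c • (1 : X →L[ℂ] X) - K : X →L[ℂ] X) : X →ₗ[ℂ] X)) := by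
  set N := LinearMap.ker ((c • (1 : X →L[ℂ] X) - K : X →L[ℂ] X) : X →ₗ[ℂ] X) with hN
  have hmem : ∀ x : N, c⁻¹ • K x = x := fun x => by
    have hx : (c • (1 : X →L[ℂ] X) - K) (x : X) = 0 := x.2
    have h : c • (x : X) = K x := sub_eq_zero.mp (by simpa using hx)
    exact h ▸ inv_smul_smul₀ hc _
  have hcl : IsClosed (N : Set X) := (c • (1 : X →L[ℂ] X) - K).isClosed_ker
  have h1 : IsCompactOperator (fun x : N => c⁻¹ • K x) := (hK.smul c⁻¹).comp_clm N.subtypeL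
  have h2 := h1.codRestrict (V := N) (fun x => by rw [hmem]; exact x.2) hcl
  refine FiniteDimensional.of_isCompactOperator_id (𝕜 := ℂ) ?_
  have h3 : Set.codRestrict (fun x : N => c⁻¹ • K x) N (fun x => by rw [hmem]; exact x.2) = id :=
    funext fun x => Subtype.ext (hmem x)
  exact h3 ▸ h2

variable [CompleteSpace X]

/-- The spectral projection of a compact operator at a nonzero point, obtained from the Fredholm
alternative. -/
theorem IsCompactOperator.exists_spectral_splitting {T : X →L[ℂ] X} (hT : IsCompactOperator T)
    {μ : ℂ} (hμ : μ ≠ 0) {l : ℕ}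
    (hl : LinearMap.ker (((μ • (1 : X →L[ℂ] X) - T) ^ l : X →L[ℂ] X) : X →ₗ[ℂ] X) =
      LinearMap.ker (((μ • (1 : X →L[ℂ] X) - T) ^ (l + 1) : X →L[ℂ] X) : X →ₗ[ℂ] X)) :
    ∃ Q : X →L[ℂ] X, Q * Q = Q ∧ T * Q = Q * T ∧ (μ • (1 : X →L[ℂ] X) - T) ^ l * Q = 0 ∧
      μ ∈ resolventSet ℂ (T * (1 - Q)) := by
  set S : X →L[ℂ] X := μ • (1 : X →L[ℂ] X) - T with hS
  set A : X →L[ℂ] X := S ^ l with hA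
  obtain ⟨K, hK, hAK⟩ := hT.exists_pow_eq μ l
  rw [← hS, ← hA] at hAK
  have hμl : μ ^ l ≠ 0 := pow_ne_zero _ hμ
  set N := LinearMap.ker (A : X →ₗ[ℂ] X) with hN
  have hmem : ∀ x, x ∈ N ↔ A x = 0 := fun x => Iff.rfl
  have : FiniteDimensional ℂ N := by
    have := finiteDimensional_ker_of_isCompactOperator hK hμl
    rwa [← hAK] at this
  have hstab : ∀ k x, (S ^ (l + k)) x = 0 → A x = 0 := by
    intro k
    induction k with
    | zero => exact fun x hx => hx
    | succ k ih =>
      intro x hx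
      refine ih x ?_
      have h1 : (S ^ k) x ∈ LinearMap.ker ((S ^ (l + 1) : X →L[ℂ] X) : X →ₗ[ℂ] X) := by
        rw [LinearMap.mem_ker]
        change (S ^ (l + 1)) ((S ^ k) x) = 0
        rw [← mul_apply_eq_comp, ← pow_add]
        convert hx using 3
        ring
      rw [← hl, LinearMap.mem_ker] at h1
      rw [pow_add, mul_apply_eq_comp]
      exact h1
  -- Kernel and range of `A` meet only in zero.
  have hAA : ∀ x, A (A x) = 0 → A x = 0 := fun x hx => hstab l x (by
    rwa [pow_add, mul_apply_eq_comp])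
  obtain ⟨p, hp⟩ := Submodule.ClosedComplemented.of_finiteDimensional N
  set P : X →L[ℂ] X := N.subtypeL ∘L p with hP
  have hPN : ∀ x, A (P x) = 0 := fun x => (p x).2
  have hPid : ∀ x, A x = 0 → P x = x := fun x hx => congrArg Subtype.val (hp ⟨x, hx⟩)
  have hPc : IsCompactOperator P :=
    (isCompactOperator_of_locallyCompactSpace_dom p).clm_comp N.subtypeL
  -- Correcting `A` by a finite-rank projection onto its kernel makes it injective, and it remains a
  -- nonzero scalar minus a compact operator. Its inverse `V` yields the spectral projection `P *
  -- V`, onto the kernel of `A` and vanishing on its range.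
  have hB : A + P = algebraMap ℂ (X →L[ℂ] X) (μ ^ l) - (K - P) := by
    rw [hAK, Algebra.algebraMap_eq_smul_one]
    abel
  have hres := (hK.sub hPc).hasEigenvalue_or_mem_resolventSet (T := K - P) hμl
  have hunit : IsUnit (A + P) := by
    rw [hB]
    refine hres.resolve_left fun hev => ?_
    obtain ⟨x, hx⟩ := hev.exists_hasEigenvector
    have h1 : (K - P) x = μ ^ l • x := hx.apply_eq_smul
    have h2 : A x + P x = 0 := by
      change (A + P) x = 0
      rw [hB, sub_apply, h1, Algebra.algebraMap_eq_smul_one]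
      simp
    have h3 : A x = 0 := hAA x (by
      rw [eq_neg_of_add_eq_zero_left h2, map_neg, hPN, neg_zero])
    rw [h3, zero_add, hPid x h3] at h2
    exact hx.2 h2
  obtain ⟨b, hb⟩ := hunit
  set V : X →L[ℂ] X := ↑b⁻¹ with hV
  have hBV : (A + P) * V = 1 := by rw [← hb, hV, Units.mul_inv]
  have hVB : V * (A + P) = 1 := by rw [← hb, hV, Units.inv_mul]
  have hdec : ∀ x, A (V x) + P (V x) = x := fun x => congrArg (fun F => F x) hBV
  have hinj : ∀ x y, A x + P x = y → V y = x := fun x y h => by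
    rw [← h]
    exact congrArg (fun F => F x) hVB
  have hQid : ∀ x, A x = 0 → P (V x) = x := fun x hx => by
    rw [hinj x x (by rw [hx, zero_add, hPid x hx]), hPid x hx]
  have hQA : ∀ x, P (V (A x)) = 0 := fun x => by
    rw [hinj (x - P x) (A x) (by
      rw [map_sub, map_sub, hPN, hPid (P x) (hPN x)]; abel), map_sub, hPid (P x) (hPN x), sub_self]
  have hTA : ∀ x, T (A x) = A (T x) := fun x => by
    have hc : Commute T A := ((Commute.one_right T).smul_right μ |>.sub_right rfl).pow_right l
    exact congrArg (fun F => F x) hc.eq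
  have hQQ : (P * V) * (P * V) = P * V := by
    ext x
    exact hQid _ (hPN _)
  have hTQ : T * (P * V) = P * V * T := by
    ext x
    change T (P (V x)) = P (V (T x))
    conv_rhs => rw [← hdec x]
    rw [map_add, map_add, map_add, hTA, hQA, zero_add, hQid (T (P (V x)))]
    rw [← hTA, hPN, map_zero]
  refine ⟨P * V, hQQ, hTQ, ?_, ?_⟩
  · ext x
    exact hPN _
  -- An eigenvector of `T * (1 - P * V)` at `μ` is killed by `P * V`, so it is an eigenvector of `T`
  -- and lies in the kernel of `A`, where `P * V` is the identity.
  · have hT' : IsCompactOperator ⇑(T * (1 - P * V)) := hT.comp_clm (1 - P * V)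
    refine (hT'.hasEigenvalue_or_mem_resolventSet hμ).resolve_left fun hev => ?_
    obtain ⟨x, hx⟩ := hev.exists_hasEigenvector
    have h1 : (T * (1 - P * V)) x = μ • x := hx.apply_eq_smul
    have h2 : (P * V) x = 0 := by
      have h3 : (P * V) * (T * (1 - P * V)) = 0 := by
        rw [← mul_assoc, ← hTQ, mul_assoc, mul_sub, hQQ, mul_one, sub_self, mul_zero]
      have h4 : (P * V) (μ • x) = 0 := by
        rw [← h1]
        exact congrArg (fun F => F x) h3
      rw [map_smul] at h4
      exact (smul_eq_zero.mp h4).resolve_left hμ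
    have h5 : T x = μ • x := by
      rw [← h1]
      change T x = T (x - (P * V) x)
      rw [h2, sub_zero]
    have h6 : A x = 0 := by
      refine hstab 1 x ?_
      rw [pow_succ, mul_apply_eq_comp]
      have : S x = 0 := by simp [hS, h5]
      rw [this, map_zero]
    have h7 : P (V x) = 0 := h2
    rw [hQid x h6] at h7
    exact hx.2 h7

end Riesz

/-! ### Resolvents in Banach algebras -/

section Resolvent

variable {A : Type*} [NormedRing A] [NormedAlgebra ℂ A]

theorem resolvent_mul_cancel {a : A} {z : ℂ} (hz : z ∈ resolventSet ℂ a) :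
    resolvent a z * (algebraMap ℂ A z - a) = 1 :=
  Ring.inverse_mul_cancel _ (spectrum.mem_resolventSet_iff.mp hz)

theorem mul_resolvent_cancel {a : A} {z : ℂ} (hz : z ∈ resolventSet ℂ a) :
    (algebraMap ℂ A z - a) * resolvent a z = 1 :=
  Ring.mul_inverse_cancel _ (spectrum.mem_resolventSet_iff.mp hz)

theorem commute_resolvent {a b : A} (h : Commute a b) {z : ℂ} (hz : z ∈ resolventSet ℂ a) :
    Commute (resolvent a z) b := by
  have h1 : Commute (algebraMap ℂ A z - a) b := (Algebra.commute_algebraMap_left z b).sub_left h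
  have h2 := resolvent_mul_cancel hz
  have h3 := mul_resolvent_cancel hz
  calc resolvent a z * b
      = resolvent a z * (b * (algebraMap ℂ A z - a)) * resolvent a z := by
        rw [mul_assoc, mul_assoc b, h3, mul_one]
    _ = b * resolvent a z := by rw [← h1.eq, ← mul_assoc, h2, one_mul]

theorem mem_resolventSet_of_mul_eq_one {a b : A} {z : ℂ} (h1 : (algebraMap ℂ A z - a) * b = 1)
    (h2 : b * (algebraMap ℂ A z - a) = 1) : z ∈ resolventSet ℂ a ∧ resolvent a z = b := by
  have hz : z ∈ resolventSet ℂ a := spectrum.mem_resolventSet_iff.mpr ⟨⟨_, b, h1, h2⟩, rfl⟩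
  refine ⟨hz, ?_⟩
  calc resolvent a z = resolvent a z * ((algebraMap ℂ A z - a) * b) := by rw [h1, mul_one]
    _ = b := by rw [← mul_assoc, resolvent_mul_cancel hz, one_mul]

/-- The resolvent in terms of a spectral projection `q` that belongs to a pole of order at most
`l`. -/
theorem resolvent_eq_of_splitting {a q : A} {μ z : ℂ} {l : ℕ} (hq : q * q = q)
    (haq : a * q = q * a) (hl : (algebraMap ℂ A μ - a) ^ l * q = 0) (hzμ : z ≠ μ)
    (hz : z ∈ resolventSet ℂ (a * (1 - q))) :
    z ∈ resolventSet ℂ a ∧ resolvent a z =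
      (z - μ)⁻¹ • (∑ j ∈ Finset.range l, ((z - μ)⁻¹ • (a - algebraMap ℂ A μ)) ^ j) * q +
        resolvent (a * (1 - q)) z * (1 - q) := by
  have hd : z - μ ≠ 0 := sub_ne_zero.mpr hzμ
  -- Since `z - a = (z - μ)(1 - x)` and `x ^ l * q = 0`, a finite geometric sum inverts `z - a` on
  -- the range of `q`. On the range of `1 - q` the resolvent of `a * (1 - q)` does it.
  set x : A := (z - μ)⁻¹ • (a - algebraMap ℂ A μ) with hx
  have hza : algebraMap ℂ A z - a = (z - μ) • (1 - x) := by
    rw [smul_sub, hx, smul_inv_smul₀ hd, sub_smul, Algebra.algebraMap_eq_smul_one,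
      Algebra.algebraMap_eq_smul_one]
    abel
  have hxl : x ^ l * q = 0 := by
    rw [hx, smul_pow, smul_mul_assoc, ← neg_sub (algebraMap ℂ A μ) a, neg_pow, mul_assoc, hl, mul_zero,
      smul_zero]
  have hcq : Commute (algebraMap ℂ A z - a) q :=
    (Algebra.commute_algebraMap_left z q).sub_left haq
  have hxq : Commute x q :=
    ((show Commute a q from haq).sub_left (Algebra.commute_algebraMap_left μ q)).smul_left _
  have hsq : Commute (∑ j ∈ Finset.range l, x ^ j) q :=
    Commute.sum_left _ _ _ fun j _ => hxq.pow_left j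
  have hqt : Commute (a * (1 - q)) q := by
    have h : Commute a q := haq
    exact h.mul_left ((Commute.one_left q).sub_left rfl)
  have hrq := commute_resolvent hqt hz
  have hq0 : q * (1 - q) = 0 := by rw [mul_sub, hq, mul_one, sub_self]
  have hq0' : (1 - q) * q = 0 := by rw [sub_mul, hq, one_mul, sub_self]
  have hsplit : algebraMap ℂ A z - a = (algebraMap ℂ A z - a * (1 - q)) - a * q := by
    rw [mul_sub, mul_one]
    abel
  refine mem_resolventSet_of_mul_eq_one ?_ ?_
  · have h1 : (algebraMap ℂ A z - a) * ((z - μ)⁻¹ • (∑ j ∈ Finset.range l, x ^ j) * q) = q := by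
      rw [hza, smul_mul_assoc, smul_mul_assoc, mul_smul_comm, smul_smul, mul_inv_cancel₀ hd,
        one_smul, ← mul_assoc, mul_neg_geom_sum, sub_mul, one_mul, hxl, sub_zero]
    have h2 : (algebraMap ℂ A z - a) * (resolvent (a * (1 - q)) z * (1 - q)) = 1 - q := by
      rw [hsplit, sub_mul, ← mul_assoc, mul_resolvent_cancel hz, one_mul, mul_assoc a,
        ← mul_assoc q, ← hrq.eq, mul_assoc _ q, hq0, mul_zero, mul_zero, sub_zero]
    rw [mul_add, h1, h2]
    abel
  · have h1 : ((z - μ)⁻¹ • (∑ j ∈ Finset.range l, x ^ j) * q) * (algebraMap ℂ A z - a) = q := by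
      rw [mul_assoc, ← hcq.eq, hza, smul_mul_assoc, smul_mul_assoc, mul_smul_comm, smul_smul,
        inv_mul_cancel₀ hd, one_smul, ← mul_assoc, geom_sum_mul_neg, sub_mul, one_mul, hxl,
        sub_zero]
    have h2 : (resolvent (a * (1 - q)) z * (1 - q)) * (algebraMap ℂ A z - a) = 1 - q := by
      have hc' : Commute (1 - q) (algebraMap ℂ A z - a) :=
        ((Commute.one_left _).sub_left hcq.symm)
      have h3 : (algebraMap ℂ A z - a) * (1 - q) = (algebraMap ℂ A z - a * (1 - q)) * (1 - q) := by
        rw [hsplit, sub_mul, mul_assoc a, hq0, mul_zero, sub_zero]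
      rw [mul_assoc, hc'.eq, h3, ← mul_assoc, resolvent_mul_cancel hz, one_mul]
    rw [add_mul, h1, h2]
    abel

theorem resolvent_sub_resolvent {a b : A} {z : ℂ} (ha : z ∈ resolventSet ℂ a)
    (hb : z ∈ resolventSet ℂ b) :
    resolvent a z - resolvent b z = resolvent b z * (a - b) * resolvent a z := by
  have h1 : a - b = (algebraMap ℂ A z - b) - (algebraMap ℂ A z - a) := by abel
  rw [h1, mul_sub, resolvent_mul_cancel hb, sub_mul, one_mul, mul_assoc, mul_resolvent_cancel ha,
    mul_one]

variable [CompleteSpace A]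

theorem continuousOn_resolvent (a : A) : ContinuousOn (resolvent a) (resolventSet ℂ a) :=
  fun _ hz => (spectrum.hasDerivAt_resolvent_const_left hz).continuousAt.continuousWithinAt

/-- In the split resolvent the `q`-part is a polynomial of degree at most `l` in `(z - μ)⁻¹`, and
the complementary part is continuous at `μ`. -/
theorem exists_norm_resolvent_mul_le {a q : A} {μ : ℂ} {l : ℕ} (hq : q * q = q)
    (haq : a * q = q * a) (hl : (algebraMap ℂ A μ - a) ^ l * q = 0)
    (hμ : μ ∈ resolventSet ℂ (a * (1 - q))) :
    ∃ C δ : ℝ, 0 < δ ∧ ∀ z, z ≠ μ → ‖z - μ‖ < δ →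
      z ∈ resolventSet ℂ a ∧ ‖resolvent a z‖ * ‖z - μ‖ ^ l ≤ C := by
  set t := a * (1 - q) with ht
  have hopen := (spectrum.isOpen_resolventSet (𝕜 := ℂ) t).mem_nhds hμ
  have hcont := ((continuousOn_resolvent t).continuousAt hopen).norm
  obtain ⟨δ, hδ, hball⟩ := Metric.eventually_nhds_iff.mp
    ((eventually_mem_set.mpr hopen).and (hcont.eventually_lt continuousAt_const
      (lt_add_one ‖resolvent t μ‖)))
  -- A radius at most `1` lets the factor `‖z - μ‖ ^ l` absorb all the lower pole orders.
  refine ⟨(∑ j ∈ Finset.range l, ‖(a - algebraMap ℂ A μ) ^ j‖) * ‖q‖ +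
    (‖resolvent t μ‖ + 1) * ‖1 - q‖, min δ 1, by positivity, fun z hzμ hz => ?_⟩
  obtain ⟨h1, h2⟩ := hball (show dist z μ < δ by
    rw [dist_eq_norm]; exact hz.trans_le (min_le_left _ _))
  obtain ⟨hza, hres⟩ := resolvent_eq_of_splitting hq haq hl hzμ h1
  refine ⟨hza, ?_⟩
  have hd : 0 < ‖z - μ‖ := norm_pos_iff.mpr (sub_ne_zero.mpr hzμ)
  have hd1 : ‖z - μ‖ ≤ 1 := hz.le.trans (min_le_right _ _)
  have hdl : ‖z - μ‖ ^ l ≤ 1 := pow_le_one₀ hd.le hd1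
  rw [hres, Finset.smul_sum, Finset.sum_mul]
  have hterm : ∀ j ∈ Finset.range l,
      ‖(z - μ)⁻¹ • ((z - μ)⁻¹ • (a - algebraMap ℂ A μ)) ^ j * q‖ * ‖z - μ‖ ^ l ≤
        ‖(a - algebraMap ℂ A μ) ^ j‖ * ‖q‖ := fun j hj => by
    have hjl : j + 1 ≤ l := Finset.mem_range.mp hj
    rw [smul_pow, smul_smul, ← pow_succ', smul_mul_assoc, norm_smul, norm_pow, norm_inv]
    calc (‖z - μ‖⁻¹) ^ (j + 1) * ‖(a - algebraMap ℂ A μ) ^ j * q‖ * ‖z - μ‖ ^ l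
        ≤ (‖z - μ‖⁻¹) ^ (j + 1) * ‖(a - algebraMap ℂ A μ) ^ j * q‖ * ‖z - μ‖ ^ (j + 1) := by
          gcongr ?_ * ?_
          exact pow_le_pow_of_le_one hd.le hd1 hjl
      _ = ‖(a - algebraMap ℂ A μ) ^ j * q‖ := by
          rw [mul_right_comm, ← mul_pow, inv_mul_cancel₀ hd.ne', one_pow, one_mul]
      _ ≤ _ := norm_mul_le _ _
  calc _ ≤ ((∑ j ∈ Finset.range l,
          ‖(z - μ)⁻¹ • ((z - μ)⁻¹ • (a - algebraMap ℂ A μ)) ^ j * q‖) +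
          ‖resolvent t z‖ * ‖1 - q‖) * ‖z - μ‖ ^ l := by
        gcongr
        exact (norm_add_le _ _).trans (add_le_add (norm_sum_le _ _) (norm_mul_le _ _))
    _ ≤ _ := by
        rw [add_mul, Finset.sum_mul, Finset.sum_mul]
        refine add_le_add (Finset.sum_le_sum hterm) ?_
        calc ‖resolvent t z‖ * ‖1 - q‖ * ‖z - μ‖ ^ l ≤ ‖resolvent t z‖ * ‖1 - q‖ * 1 := by gcongr
          _ ≤ _ := by
            rw [mul_one]
            gcongr

/-! ### Neumann series and perturbation of the resolvent. -/

theorem mem_resolventSet_of_norm_mul_lt_one {a b : A} {z : ℂ} (hz : z ∈ resolventSet ℂ a)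
    (h : ‖resolvent a z‖ * ‖b - a‖ < 1) : z ∈ resolventSet ℂ b := by
  have h1 : algebraMap ℂ A z - b =
      (algebraMap ℂ A z - a) * (1 - resolvent a z * (b - a)) := by
    rw [mul_sub, ← mul_assoc, mul_resolvent_cancel hz]
    simp
  rw [spectrum.mem_resolventSet_iff, h1]
  exact (spectrum.mem_resolventSet_iff.mp hz).mul
    (isUnit_one_sub_of_norm_lt_one ((norm_mul_le _ _).trans_lt h))

/-- By the resolvent identity the resolvent of `b` exceeds that of `a` by at most half its own norm,
which is absorbed on the left. -/
theorem norm_resolvent_le_two_mul {a b : A} {z : ℂ} (hz : z ∈ resolventSet ℂ a)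
    (h : ‖resolvent a z‖ * ‖b - a‖ ≤ 1 / 2) : ‖resolvent b z‖ ≤ 2 * ‖resolvent a z‖ := by
  have hb : z ∈ resolventSet ℂ b := mem_resolventSet_of_norm_mul_lt_one hz (by linarith)
  have h1 := resolvent_sub_resolvent hz hb
  have h2 : ‖resolvent b z * (a - b) * resolvent a z‖ ≤ ‖resolvent b z‖ * (1 / 2) := by
    calc _ ≤ ‖resolvent b z‖ * ‖a - b‖ * ‖resolvent a z‖ := norm_mul₃_le
      _ = ‖resolvent b z‖ * (‖resolvent a z‖ * ‖b - a‖) := by rw [norm_sub_rev a b]; ring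
      _ ≤ _ := by gcongr
  have h3 : ‖resolvent b z‖ ≤ ‖resolvent a z‖ + ‖resolvent b z * (a - b) * resolvent a z‖ := by
    rw [← h1]
    calc ‖resolvent b z‖ = ‖resolvent a z - (resolvent a z - resolvent b z)‖ := by congr 1; abel
      _ ≤ _ := norm_sub_le _ _
  linarith

/-- On a compact subset of the resolvent set, the resolvents of nearby elements exist and are
uniformly bounded. -/
theorem exists_eventually_norm_resolvent_le {a : A} {an : ℕ → A}
    (h : Tendsto an atTop (𝓝 a)) {K : Set ℂ} (hK : IsCompact K) (hKa : K ⊆ resolventSet ℂ a) :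
    ∃ C : ℝ, 0 < C ∧ (∀ z ∈ K, ‖resolvent a z‖ ≤ C) ∧
      ∀ᶠ n in atTop, ∀ z ∈ K, z ∈ resolventSet ℂ (an n) ∧ ‖resolvent (an n) z‖ ≤ C := by
  obtain ⟨C, hC⟩ := hK.exists_bound_of_continuousOn ((continuousOn_resolvent a).mono hKa)
  set D := max C 1 with hD
  have hD1 : 1 ≤ D := le_max_right _ _
  have hCD : ∀ z ∈ K, ‖resolvent a z‖ ≤ D := fun z hz => (hC z hz).trans (le_max_left _ _)
  refine ⟨2 * D, by positivity, fun z hz => by linarith [hCD z hz], ?_⟩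
  have h1 : Tendsto (fun n => ‖an n - a‖) atTop (𝓝 0) := tendsto_iff_norm_sub_tendsto_zero.mp h
  filter_upwards [h1.eventually_lt_const (show (0 : ℝ) < (2 * D)⁻¹ by positivity)] with n hn z hz
  have h2 : ‖resolvent a z‖ * ‖an n - a‖ ≤ 1 / 2 := by
    calc ‖resolvent a z‖ * ‖an n - a‖ ≤ D * (2 * D)⁻¹ := by
          gcongr
          exact hCD z hz
      _ = 1 / 2 := by field_simp
  exact ⟨mem_resolventSet_of_norm_mul_lt_one (hKa hz) (by linarith),
    (norm_resolvent_le_two_mul (hKa hz) h2).trans (by linarith [hCD z hz])⟩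

/-- An isolated spectral point is a limit of spectral points of the approximations. -/
theorem frequently_disjoint_spectrum_imp_mem_resolventSet [Nontrivial A] {a : A} {an : ℕ → A}
    (h : Tendsto an atTop (𝓝 a)) {μ : ℂ} {ε : ℝ} (hε : 0 < ε)
    (hsphere : Metric.sphere μ ε ⊆ resolventSet ℂ a)
    (hn : ∃ᶠ n in atTop, Metric.closedBall μ ε ⊆ resolventSet ℂ (an n)) :
    μ ∈ resolventSet ℂ a := by
  obtain ⟨C, hC0, -, hC⟩ :=
    exists_eventually_norm_resolvent_le h (isCompact_sphere μ ε) hsphere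
  have h1 : Tendsto (fun n => ‖an n - a‖) atTop (𝓝 0) := tendsto_iff_norm_sub_tendsto_zero.mp h
  obtain ⟨n, hball, hCn, hlt⟩ := (hn.and_eventually
    (hC.and (h1.eventually_lt_const (show (0 : ℝ) < C⁻¹ by positivity)))).exists
  -- Without spectrum of `an n` in the disc, the maximum principle carries the uniform bound from
  -- the circle to `μ`. Then `a` is a perturbation of `an n` small enough for the Neumann series at
  -- `μ`.
  have hdiff : DiffContOnCl ℂ (resolvent (an n)) (Metric.ball μ ε) := by
    refine DifferentiableOn.diffContOnCl fun z hz => ?_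
    rw [closure_ball μ hε.ne'] at hz
    exact (spectrum.hasDerivAt_resolvent_const_left
      (hball hz)).differentiableAt.differentiableWithinAt
  have hle : ‖resolvent (an n) μ‖ ≤ C :=
    Complex.norm_le_of_forall_mem_frontier_norm_le Metric.isBounded_ball hdiff
      (fun z hz => (hCn z (by rwa [frontier_ball μ hε.ne'] at hz)).2)
      (subset_closure (Metric.mem_ball_self hε))
  refine mem_resolventSet_of_norm_mul_lt_one (hball (Metric.mem_closedBall_self hε.le)) ?_
  rw [norm_sub_rev]
  calc ‖resolvent (an n) μ‖ * ‖an n - a‖ ≤ C * ‖an n - a‖ := by gcongr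
    _ < C * C⁻¹ := by gcongr
    _ = 1 := mul_inv_cancel₀ hC0.ne'

end Resolvent

/-! ### Convergence of spectral data under exponentially good approximation -/

section Convergence

variable {X : Type*} [NormedAddCommGroup X] [NormedSpace ℂ X]

/-- Translates between the algebra of bounded operators, where Riesz theory is done, and the linear
endomorphisms in which ascent is defined. -/
theorem ker_coe_pow_eq (T : X →L[ℂ] X) (μ : ℂ) (l : ℕ) :
    LinearMap.ker (((μ • (1 : X →L[ℂ] X) - T) ^ l : X →L[ℂ] X) : X →ₗ[ℂ] X) =
      LinearMap.ker ((algebraMap ℂ (Module.End ℂ X) μ - (T : X →ₗ[ℂ] X)) ^ l) := by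
  congr 1
  induction l with
  | zero => rfl
  | succ l ih =>
    rw [pow_succ, pow_succ, ← ih]
    rfl

theorem isCompactOperator_of_finiteDimensional_range (T : X →L[ℂ] X)
    [FiniteDimensional ℂ (LinearMap.range (T : X →ₗ[ℂ] X))] : IsCompactOperator T := by
  let T' : X →L[ℂ] LinearMap.range (T : X →ₗ[ℂ] X) := T.codRestrict _ fun x => ⟨x, rfl⟩
  exact (isCompactOperator_of_locallyCompactSpace_dom T').clm_comp
    (LinearMap.range (T : X →ₗ[ℂ] X)).subtypeL

/-- A finite-rank operator is not onto an infinite-dimensional space. This settles the approximation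
of the spectral point `0`. -/
theorem zero_mem_spectrum_of_finiteDimensional_range (hX : ¬ FiniteDimensional ℂ X)
    (T : X →L[ℂ] X) [FiniteDimensional ℂ (LinearMap.range (T : X →ₗ[ℂ] X))] :
    (0 : ℂ) ∈ spectrum ℂ T := by
  rw [spectrum.zero_mem_iff]
  rintro ⟨v, hv⟩
  refine hX ?_
  have htop : LinearMap.range (T : X →ₗ[ℂ] X) = ⊤ := by
    rw [eq_top_iff]
    intro x _
    refine ⟨(↑v⁻¹ : X →L[ℂ] X) x, ?_⟩
    have h1 : T * (↑v⁻¹ : X →L[ℂ] X) = 1 := by rw [← hv, Units.mul_inv]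
    exact congrArg (fun F => F x) h1
  have h2 : FiniteDimensional ℂ (⊤ : Submodule ℂ X) := htop ▸ inferInstance
  exact Module.finite_def.mpr (Module.Finite.iff_fg.mp h2)

/-- The Neumann series in `T - ν` terminates on `x`; the verification telescopes. Integer powers of
`z - ν` allow termwise integration over a circle. -/
theorem resolvent_apply_of_pow_apply_eq_zero {T : X →L[ℂ] X} {ν z : ℂ}
    (hz : z ∈ resolventSet ℂ T) (hzν : z ≠ ν) {k : ℕ} {x : X}
    (hx : ((T - ν • (1 : X →L[ℂ] X)) ^ k) x = 0) :
    resolvent T z x =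
      ∑ j ∈ Finset.range k, (z - ν) ^ (-(j : ℤ) - 1) • ((T - ν • (1 : X →L[ℂ] X)) ^ j) x := by
  have hd : z - ν ≠ 0 := sub_ne_zero.mpr hzν
  set M := T - ν • (1 : X →L[ℂ] X) with hM
  have hTM : ∀ y, (algebraMap ℂ (X →L[ℂ] X) z - T) y = (z - ν) • y - M y := fun y => by
    rw [Algebra.algebraMap_eq_smul_one, hM]
    simp only [sub_apply, smul_apply, one_apply_eq_self]
    module
  have key : (algebraMap ℂ (X →L[ℂ] X) z - T)
      (∑ j ∈ Finset.range k, (z - ν) ^ (-(j : ℤ) - 1) • (M ^ j) x) = x := by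
    rw [map_sum]
    have hterm : ∀ j ∈ Finset.range k, (algebraMap ℂ (X →L[ℂ] X) z - T)
        ((z - ν) ^ (-(j : ℤ) - 1) • (M ^ j) x) =
        (z - ν) ^ (-(j : ℤ)) • (M ^ j) x -
          (z - ν) ^ (-((j + 1 : ℕ) : ℤ)) • (M ^ (j + 1)) x := fun j _ => by
      rw [hTM, smul_smul, map_smul, ← mul_apply_eq_comp, ← pow_succ', ← zpow_one_add₀ hd]
      congr 3 <;> push_cast <;> ring
    rw [Finset.sum_congr rfl hterm,
      Finset.sum_range_sub' (fun j : ℕ => (z - ν) ^ (-(j : ℤ)) • (M ^ j) x), hx]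
    simp
  have h1 := congrArg (fun F => F (∑ j ∈ Finset.range k, (z - ν) ^ (-(j : ℤ) - 1) • (M ^ j) x))
    (resolvent_mul_cancel hz)
  change resolvent T z ((algebraMap ℂ (X →L[ℂ] X) z - T) _) = _ at h1
  rw [key] at h1
  exact h1

theorem IsolatesSpectralPoint.sphere_subset {T : X →L[ℂ] X} {μ : ℂ} {ε : ℝ}
    (h : IsolatesSpectralPoint T μ ε) {ε' : ℝ} (h0 : 0 < ε') (hle : ε' ≤ ε) :
    Metric.sphere μ ε' ⊆ resolventSet ℂ T := fun z hz => by
  by_contra hzT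
  have h1 : z ∈ Metric.closedBall μ ε ∩ spectrum ℂ T :=
    ⟨Metric.closedBall_subset_closedBall hle (Metric.sphere_subset_closedBall hz), hzT⟩
  rw [h.2, Set.mem_singleton_iff] at h1
  rw [h1, Metric.mem_sphere, dist_self] at hz
  exact h0.ne hz

variable [CompleteSpace X]

theorem circleIntegral_apply {F : ℂ → X →L[ℂ] X} {c : ℂ} {ε : ℝ} (hF : CircleIntegrable F c ε)
    (x : X) : (∮ z in C(c, ε), F z) x = ∮ z in C(c, ε), F z x := by
  have h := (ContinuousLinearMap.apply ℂ X x).intervalIntegral_comp_comm hF.out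
  exact h.symm

theorem circleIntegrable_resolvent {T : X →L[ℂ] X} {μ : ℂ} {ε : ℝ} (hε : 0 < ε)
    (hT : Metric.sphere μ ε ⊆ resolventSet ℂ T) : CircleIntegrable (resolvent T) μ ε :=
  ((continuousOn_resolvent T).mono hT).circleIntegrable hε.le

/-- A generalised eigenvector for an eigenvalue inside the circle is fixed by the Riesz
integral. -/
theorem rieszProj_apply_of_mem_maxGenEigenspace {T : X →L[ℂ] X} {μ ν : ℂ} {ε : ℝ} (hε : 0 < ε)
    (hT : Metric.sphere μ ε ⊆ resolventSet ℂ T) (hν : ν ∈ Metric.ball μ ε) {x : X}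
    (hx : x ∈ Module.End.maxGenEigenspace (T : X →ₗ[ℂ] X) ν) : rieszProj T μ ε x = x := by
  obtain ⟨k, hk⟩ := Module.End.mem_maxGenEigenspace _ _ _ |>.mp hx
  have hk' : ((T - ν • (1 : X →L[ℂ] X)) ^ k) x = 0 := by
    rw [← hk]
    have h : ∀ j y, ((T - ν • (1 : X →L[ℂ] X)) ^ j) y =
        (((T : X →ₗ[ℂ] X) - ν • (1 : Module.End ℂ X)) ^ j) y := by
      intro j
      induction j with
      | zero => exact fun y => rfl
      | succ j ih =>
          intro y
          rw [pow_succ, pow_succ, mul_apply_eq_comp, ih]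
          rfl
    exact h k x
  have hne : ∀ z ∈ Metric.sphere μ ε, z ≠ ν := fun z hz h => by
    subst h
    rw [Metric.mem_sphere] at hz
    rw [Metric.mem_ball] at hν
    exact hν.ne hz
  have hcont : ∀ j : ℕ, CircleIntegrable
      (fun z => (z - ν) ^ (-(j : ℤ) - 1) • ((T - ν • (1 : X →L[ℂ] X)) ^ j) x) μ ε := fun j => by
    refine ContinuousOn.circleIntegrable hε.le (ContinuousOn.smul ?_ continuousOn_const)
    exact ContinuousOn.zpow₀ (by fun_prop) _ fun z hz => Or.inl (sub_ne_zero.mpr (hne z hz))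
  have hint : (∮ z in C(μ, ε), resolvent T z x) = (2 * Real.pi * Complex.I : ℂ) • x := by
    rw [circleIntegral.integral_congr hε.le fun z hz =>
      resolvent_apply_of_pow_apply_eq_zero (hT hz) (hne z hz) hk',
      circleIntegral.integral_fun_sum fun j _ => hcont j]
    simp_rw [circleIntegral.integral_smul_const]
    cases k with
    | zero =>
      have : x = 0 := hk'
      simp [this]
    | succ k =>
      rw [Finset.sum_range_succ']
      -- Powers of exponent at most `-2` have primitives and integrate to zero; only the simple pole
      -- contributes.
      have h0 : ∀ j ∈ Finset.range k, (∮ z in C(μ, ε), (z - ν) ^ (-((j + 1 : ℕ) : ℤ) - 1)) •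
          ((T - ν • (1 : X →L[ℂ] X)) ^ (j + 1)) x = 0 := fun j _ => by
        rw [circleIntegral.integral_sub_zpow_of_ne (by push_cast; lia), zero_smul]
      rw [Finset.sum_eq_zero h0, zero_add]
      have h1 := circleIntegral.integral_sub_inv_of_mem_ball hν
      simp only [Nat.cast_zero, neg_zero, zero_sub, zpow_neg_one, h1, pow_zero]
      rfl
  rw [rieszProj, smul_apply, circleIntegral_apply (circleIntegrable_resolvent hε hT), hint,
    smul_smul, inv_mul_cancel₀ Complex.two_pi_I_ne_zero, one_smul]

/-- The second resolvent identity under the integral sign; the length `2 π ε` of the circle leaves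
the factor `ε`. -/
theorem norm_rieszProj_sub_le {T T' : X →L[ℂ] X} {μ : ℂ} {ε C : ℝ} (hε : 0 < ε)
    (hT : Metric.sphere μ ε ⊆ resolventSet ℂ T) (hT' : Metric.sphere μ ε ⊆ resolventSet ℂ T')
    (hC : ∀ z ∈ Metric.sphere μ ε, ‖resolvent T z‖ ≤ C)
    (hC' : ∀ z ∈ Metric.sphere μ ε, ‖resolvent T' z‖ ≤ C) :
    ‖rieszProj T μ ε - rieszProj T' μ ε‖ ≤ ε * (C * ‖T' - T‖ * C) := by
  rw [rieszProj, rieszProj, ← smul_sub, ← circleIntegral.integral_sub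
    (circleIntegrable_resolvent hε hT) (circleIntegrable_resolvent hε hT')]
  refine circleIntegral.norm_two_pi_i_inv_smul_integral_le_of_norm_le_const hε.le fun z hz => ?_
  rw [resolvent_sub_resolvent (hT hz) (hT' hz), norm_sub_rev T' T]
  have := (norm_nonneg _).trans (hC z hz)
  refine norm_mul₃_le.trans ?_
  gcongr
  exacts [hC' z hz, hC z hz]

theorem IsCompactOperator.exists_norm_resolvent_mul_le {T : X →L[ℂ] X}
    (hT : IsCompactOperator T) {μ : ℂ} (hμ : μ ≠ 0) {l : ℕ}
    (hl : LinearMap.ker (((μ • (1 : X →L[ℂ] X) - T) ^ l : X →L[ℂ] X) : X →ₗ[ℂ] X) =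
      LinearMap.ker (((μ • (1 : X →L[ℂ] X) - T) ^ (l + 1) : X →L[ℂ] X) : X →ₗ[ℂ] X)) :
    ∃ C δ : ℝ, 0 < δ ∧ ∀ z, z ≠ μ → ‖z - μ‖ < δ →
      z ∈ resolventSet ℂ T ∧ ‖resolvent T z‖ * ‖z - μ‖ ^ l ≤ C := by
  obtain ⟨Q, hQQ, hTQ, hQl, hres⟩ := hT.exists_spectral_splitting hμ hl
  refine _root_.exists_norm_resolvent_mul_le hQQ hTQ ?_ hres
  rwa [Algebra.algebraMap_eq_smul_one]

/-- The pole bound comes with a punctured disc of resolvent points. Its radius is halved because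
isolation is stated for a closed disc. -/
theorem IsCompactOperator.exists_isolatesSpectralPoint {T : X →L[ℂ] X}
    (hT : IsCompactOperator T) {μ : ℂ} (hμ : μ ≠ 0) (hμT : μ ∈ spectrum ℂ T) :
    ∃ ε : ℝ, IsolatesSpectralPoint T μ ε := by
  obtain ⟨l, hl⟩ := hT.exists_ker_pow_eq_ker_pow_succ hμ
  obtain ⟨C, δ, hδ, h⟩ := hT.exists_norm_resolvent_mul_le hμ hl
  refine ⟨δ / 2, half_pos hδ, Set.eq_singleton_iff_unique_mem.mpr
    ⟨⟨Metric.mem_closedBall_self (half_pos hδ).le, hμT⟩, fun z hz => ?_⟩⟩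
  by_contra hne
  have h1 : ‖z - μ‖ ≤ δ / 2 := by
    rw [← dist_eq_norm]
    exact hz.1
  exact hz.2 (h z hne (by linarith)).1

/-- Invertible operators form an open set, so invertibility of `μ - T` would pass to `μs n - Tn n`
for large `n`. -/
theorem mem_spectrum_of_tendsto {T : X →L[ℂ] X} {Tn : ℕ → X →L[ℂ] X}
    (h : Tendsto Tn atTop (𝓝 T)) {μs : ℕ → ℂ} {μ : ℂ}
    (hμs : ∀ n, 1 ≤ n → μs n ∈ spectrum ℂ (Tn n)) (hμ : Tendsto μs atTop (𝓝 μ)) :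
    μ ∈ spectrum ℂ T := by
  intro hres
  have h1 : Tendsto (fun n => algebraMap ℂ (X →L[ℂ] X) (μs n) - Tn n) atTop
      (𝓝 (algebraMap ℂ (X →L[ℂ] X) μ - T)) :=
    (((continuous_algebraMap ℂ (X →L[ℂ] X)).tendsto μ).comp hμ).sub h
  obtain ⟨n, hn, hn1⟩ := ((h1.eventually (Units.isOpen.mem_nhds hres)).and
    (eventually_ge_atTop 1)).exists
  exact hμs n hn1 hn

/-- The Neumann series keeps `μs n` out of the spectrum of `Tn n` unless the resolvent of `T` there
has norm at least `‖Tn n - T‖⁻¹`; the pole of order at most `l` then bounds `‖μs n - μ‖ ^ l`. -/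
theorem isBigO_norm_sub_of_ascent {T : X →L[ℂ] X} {Tn : ℕ → X →L[ℂ] X}
    (hT : IsCompactOperator T) {q C : ℝ} (hq0 : 0 < q)
    (hC : ∀ n, 1 ≤ n → ‖Tn n - T‖ ≤ C * q ^ n) {μ : ℂ} (hμ : μ ≠ 0) {l : ℕ}
    (hl : HasEigenvalueOfAscent T μ l) {μs : ℕ → ℂ}
    (hμs : ∀ n, 1 ≤ n → μs n ∈ spectrum ℂ (Tn n)) (hlim : Tendsto μs atTop (𝓝 μ)) :
    (fun n => ‖μ - μs n‖) =O[atTop] fun n : ℕ => q ^ ((n : ℝ) / (l : ℝ)) := by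
  have hsub : Tendsto (fun n => ‖μs n - μ‖) atTop (𝓝 0) :=
    tendsto_iff_norm_sub_tendsto_zero.mp hlim
  -- For `l = 0` the exponent `n / 0` is `0`, so the rate is the constant `1` and convergence
  -- suffices.
  rcases Nat.eq_zero_or_pos l with rfl | hl0
  · simp_rw [norm_sub_rev μ]
    simpa using hsub.isBigO_one ℝ
  have hker := hl.2.1
  rw [Set.mem_ofPred_eq, ← ker_coe_pow_eq, ← ker_coe_pow_eq] at hker
  obtain ⟨C₁, δ, hδ, hres⟩ := hT.exists_norm_resolvent_mul_le hμ hker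
  have hl' : (l : ℝ) ≠ 0 := by positivity
  refine IsBigO.of_bound ((max C₁ 0 * max C 0) ^ ((l : ℝ)⁻¹)) ?_
  filter_upwards [hsub.eventually_lt_const hδ, eventually_ge_atTop 1] with n hn hn1
  rw [norm_norm, norm_sub_rev, Real.norm_of_nonneg (by positivity)]
  -- The resolvent bound holds only on a punctured disc.
  by_cases hne : μs n = μ
  · rw [hne, sub_self, norm_zero]
    positivity
  obtain ⟨hz, hle⟩ := hres (μs n) hne hn
  have h1 : 1 ≤ ‖resolvent T (μs n)‖ * ‖Tn n - T‖ := by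
    by_contra! hlt
    exact hμs n hn1 (mem_resolventSet_of_norm_mul_lt_one hz hlt)
  have h2 : ‖μs n - μ‖ ^ l ≤ (max C₁ 0 * max C 0) * q ^ n := by
    calc ‖μs n - μ‖ ^ l ≤ ‖μs n - μ‖ ^ l * (‖resolvent T (μs n)‖ * ‖Tn n - T‖) :=
          le_mul_of_one_le_right (by positivity) h1
      _ = (‖resolvent T (μs n)‖ * ‖μs n - μ‖ ^ l) * ‖Tn n - T‖ := by ring
      _ ≤ max C₁ 0 * (max C 0 * q ^ n) := by
          gcongr
          · exact hle.trans (le_max_left _ _)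
          · exact (hC n hn1).trans (by gcongr; exact le_max_left _ _)
      _ = _ := by ring
  calc ‖μs n - μ‖ = (‖μs n - μ‖ ^ l) ^ ((l : ℝ)⁻¹) :=
        (Real.pow_rpow_inv_natCast (norm_nonneg _) hl0.ne').symm
    _ ≤ ((max C₁ 0 * max C 0) * q ^ n) ^ ((l : ℝ)⁻¹) := by gcongr
    _ = _ := by
        rw [Real.mul_rpow (by positivity) (by positivity), ← Real.rpow_natCast q n,
          ← Real.rpow_mul hq0.le, div_eq_mul_inv]

/-- `μs n` is a point of the spectrum of `Tn n` nearest to `μ`. If it stayed away for infinitely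
many `n`, a fixed closed disc about `μ` would be free of those spectra, and `μ` would be a resolvent
point. -/
theorem exists_tendsto_mem_spectrum [Nontrivial X] {T : X →L[ℂ] X} {Tn : ℕ → X →L[ℂ] X}
    (hTn : Tendsto Tn atTop (𝓝 T)) {μ : ℂ} (hμ : μ ∈ spectrum ℂ T) {ε : ℝ}
    (hε : IsolatesSpectralPoint T μ ε) :
    ∃ μs : ℕ → ℂ, (∀ n, μs n ∈ spectrum ℂ (Tn n)) ∧ Tendsto μs atTop (𝓝 μ) := by
  have hex : ∀ n, ∃ ν ∈ spectrum ℂ (Tn n), Metric.infDist μ (spectrum ℂ (Tn n)) = dist μ ν :=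
    fun n => (spectrum.isCompact (Tn n)).exists_infDist_eq_dist (spectrum.nonempty (Tn n)) μ
  choose μs hμs hdist using hex
  refine ⟨μs, hμs, ?_⟩
  rw [Metric.tendsto_nhds]
  intro η hη
  by_contra hcon
  rw [not_eventually] at hcon
  have h0 : 0 < min (η / 2) ε := lt_min (half_pos hη) hε.1
  refine hμ (frequently_disjoint_spectrum_imp_mem_resolventSet hTn h0
    (hε.sphere_subset h0 (min_le_right _ _)) (hcon.mono fun n hn z hz => ?_))
  by_contra hzn
  have h1 : dist μ (μs n) ≤ dist μ z := hdist n ▸ Metric.infDist_le_dist_of_mem hzn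
  have h2 : dist z μ ≤ η / 2 := hz.trans (min_le_left _ _)
  rw [not_lt, dist_comm] at hn
  rw [dist_comm] at h2
  linarith

/-- Once `μs n` is inside the circle, the Riesz integral of `Tn n` fixes `h n`, so the quantity is a
difference of two Riesz integrals applied to a unit vector. -/
theorem isBigO_norm_rieszProj_apply_sub {T : X →L[ℂ] X} {Tn : ℕ → X →L[ℂ] X}
    (hTn : Tendsto Tn atTop (𝓝 T)) {q C : ℝ} (hq0 : 0 < q)
    (hC : ∀ n, 1 ≤ n → ‖Tn n - T‖ ≤ C * q ^ n) {μ : ℂ} {ε : ℝ}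
    (hε : IsolatesSpectralPoint T μ ε) {μs : ℕ → ℂ} (hlim : Tendsto μs atTop (𝓝 μ))
    {h : ℕ → X} (hh : ∀ n, 1 ≤ n →
      h n ∈ Module.End.maxGenEigenspace (Tn n : X →ₗ[ℂ] X) (μs n) ∧ ‖h n‖ = 1) :
    (fun n => ‖rieszProj T μ ε (h n) - h n‖) =O[atTop] fun n : ℕ => q ^ n := by
  have hsphere := hε.sphere_subset hε.1 le_rfl
  obtain ⟨D, hD0, hDT, hDn⟩ :=
    exists_eventually_norm_resolvent_le hTn (isCompact_sphere μ ε) hsphere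
  refine IsBigO.of_bound (ε * (D * C * D)) ?_
  filter_upwards [hDn, eventually_ge_atTop 1,
    hlim.eventually (Metric.ball_mem_nhds μ hε.1)] with n hn hn1 hball
  obtain ⟨hgen, hnorm⟩ := hh n hn1
  have h1 : rieszProj (Tn n) μ ε (h n) = h n :=
    rieszProj_apply_of_mem_maxGenEigenspace hε.1 (fun z hz => (hn z hz).1) hball hgen
  have h2 := norm_rieszProj_sub_le hε.1 hsphere (fun z hz => (hn z hz).1) hDT
    fun z hz => (hn z hz).2
  rw [norm_norm, Real.norm_of_nonneg (by positivity)]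
  calc ‖rieszProj T μ ε (h n) - h n‖
      = ‖(rieszProj T μ ε - rieszProj (Tn n) μ ε) (h n)‖ := by rw [sub_apply, h1]
    _ ≤ ‖rieszProj T μ ε - rieszProj (Tn n) μ ε‖ * ‖h n‖ := ContinuousLinearMap.le_opNorm _ _
    _ ≤ ε * (D * (C * q ^ n) * D) := by
        rw [hnorm, mul_one]
        have := hε.1
        refine h2.trans ?_
        gcongr
        exact hC n hn1
    _ = _ := by ring

/-- Spectral data converge under approximation, at an exponential rate, by operators of finite
rank. -/
theorem spectralDataConverge_of_norm_sub_le (hX : ¬ FiniteDimensional ℂ X) {T : X →L[ℂ] X}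
    {Tn : ℕ → X →L[ℂ] X} {q C : ℝ} (hq0 : 0 < q) (hq1 : q < 1)
    (hfin : ∀ n, FiniteDimensional ℂ (LinearMap.range (Tn n : X →ₗ[ℂ] X)))
    (hC : ∀ n, 1 ≤ n → ‖Tn n - T‖ ≤ C * q ^ n) : SpectralDataConverge T Tn q := by
  have : Nontrivial X := by
    by_contra h
    rw [not_nontrivial_iff_subsingleton] at h
    exact hX inferInstance
  have hTn : Tendsto Tn atTop (𝓝 T) := by
    rw [tendsto_iff_norm_sub_tendsto_zero]
    refine squeeze_zero' (Eventually.of_forall fun _ => norm_nonneg _)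
      ((eventually_ge_atTop 1).mono hC) ?_
    simpa using (tendsto_pow_atTop_nhds_zero_of_lt_one hq0.le hq1).const_mul C
  have hT : IsCompactOperator T := isCompactOperator_of_tendsto hTn
    (Eventually.of_forall fun n => isCompactOperator_of_finiteDimensional_range (Tn n))
  exact
    { limit_mem := fun μs μ h1 h2 => mem_spectrum_of_tendsto hTn h1 h2
      exists_approx := fun μ hμ => by
        by_cases h0 : μ = 0
        -- The constant sequence has no error, so every rate holds, whatever the ascent.
        · refine ⟨fun _ => 0, fun n _ => zero_mem_spectrum_of_finiteDimensional_range hX (Tn n),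
            by rw [h0]; exact tendsto_const_nhds, fun l _ => ?_⟩
          simp only [h0, sub_self, norm_zero]
          exact isBigO_zero _ _
        · obtain ⟨ε, hε⟩ := hT.exists_isolatesSpectralPoint h0 hμ
          obtain ⟨μs, h1, h2⟩ := exists_tendsto_mem_spectrum hTn hμ hε
          exact ⟨μs, fun n _ => h1 n, h2, fun l hl =>
            isBigO_norm_sub_of_ascent hT hq0 hC h0 hl (fun n _ => h1 n) h2⟩
      rate := fun μ l h0 hl μs h1 h2 => isBigO_norm_sub_of_ascent hT hq0 hC h0 hl h1 h2
      isolated := fun μ hμ h0 => hT.exists_isolatesSpectralPoint h0 hμ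
      eigenvectors := fun μ _ _ ε hε μs _ h2 h hh =>
        isBigO_norm_rieszProj_apply_sub hTn hq0 hC hε h2 hh }

end Convergence

/-! ### The residue theorem on annuli -/

section Residues

/-- Riemann's removable singularity theorem. Continuity across `S` is enough, because the form of
Cauchy's theorem applied later tolerates countably many points without differentiability. -/
theorem exists_continuousOn_extension_of_removable {U : Set ℂ} (hU : IsOpen U) {S : Finset ℂ}
    {g : ℂ → ℂ} (hg : DifferentiableOn ℂ g (U \ S))
    (h0 : ∀ s ∈ S, Tendsto (fun ζ => (ζ - s) * g ζ) (𝓝[≠] s) (𝓝 0)) :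
    ∃ G : ℂ → ℂ, ContinuousOn G U ∧ ∀ z, z ∉ S → G z = g z := by
  classical
  refine ⟨fun z => if z ∈ S then limUnder (𝓝[≠] z) g else g z, fun z hz => ?_,
    fun z hz => if_neg hz⟩
  have hopen : ∀ T : Finset ℂ, IsOpen (U \ (T : Set ℂ)) := fun T =>
    hU.sdiff T.finite_toSet.isClosed
  refine ContinuousAt.continuousWithinAt ?_
  by_cases hzS : z ∈ S
  · have hev : ∀ᶠ w in 𝓝[≠] z, w ∈ U \ (S : Set ℂ) := by
      rw [eventually_nhdsWithin_iff]
      filter_upwards [(hopen (S.erase z)).mem_nhds ⟨hz, by simp⟩] with w hw hwz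
      exact ⟨hw.1, fun h => hw.2 (Finset.mem_coe.mpr (Finset.mem_erase.mpr ⟨hwz, h⟩))⟩
    have hlim : Tendsto g (𝓝[≠] z) (𝓝 (limUnder (𝓝[≠] z) g)) := by
      refine Complex.tendsto_limUnder_of_differentiable_on_punctured_nhds_of_isLittleO
        (hev.mono fun w hw => hg.differentiableAt ((hopen S).mem_nhds hw)) ?_
      have hne : ∀ᶠ w in 𝓝[≠] z, (w - z)⁻¹ = 0 → g w - g z = 0 := by
        filter_upwards [self_mem_nhdsWithin] with w hw h
        exact absurd (inv_eq_zero.mp h) (sub_ne_zero.mpr hw)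
      rw [isLittleO_iff_tendsto' hne]
      have h1 : Tendsto (fun w => (w - z) * g z) (𝓝[≠] z) (𝓝 0) := by
        have : Tendsto (fun w => (w - z) * g z) (𝓝 z) (𝓝 ((z - z) * g z)) :=
          Continuous.tendsto (by fun_prop) z
        rw [sub_self, zero_mul] at this
        exact this.mono_left nhdsWithin_le_nhds
      have h2 := (h0 z hzS).sub h1
      rw [sub_zero] at h2
      refine h2.congr fun w => ?_
      rw [div_inv_eq_mul]
      ring
    rw [continuousAt_iff_punctured_nhds, if_pos hzS]
    refine hlim.congr' (hev.mono fun w hw => ?_)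
    exact (if_neg hw.2).symm
  · refine ((hg.differentiableAt ((hopen S).mem_nhds ⟨hz, hzS⟩)).continuousAt).congr ?_
    filter_upwards [(hopen S).mem_nhds ⟨hz, hzS⟩] with w hw
    exact (if_neg hw.2).symm

theorem circleIntegral_inv_sub_eq_zero {a : ℝ} (ha : 0 < a) {s : ℂ} (hs : a < ‖s‖) :
    (∮ z in C(0, a), (z - s)⁻¹) = 0 := by
  have hne : ∀ z ∈ Metric.closedBall (0 : ℂ) a, z - s ≠ 0 := fun z hz h => by
    rw [sub_eq_zero] at h
    rw [h, mem_closedBall_zero_iff] at hz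
    linarith
  refine Complex.circleIntegral_eq_zero_of_differentiable_on_off_countable ha.le
    Set.countable_empty ?_ fun z hz => ?_
  · exact ContinuousOn.inv₀ (by fun_prop) hne
  · exact DifferentiableAt.inv (by fun_prop) (hne z (Metric.ball_subset_closedBall hz.1))

/-- The residue theorem on an annulus, for finitely many simple poles. -/
theorem circleIntegral_sub_eq_sum_residues {a b : ℝ} (ha : 0 < a) (hab : a ≤ b) {U : Set ℂ}
    (hU : IsOpen U) (hsub : ∀ z : ℂ, a ≤ ‖z‖ → ‖z‖ ≤ b → z ∈ U) {S : Finset ℂ}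
    (hS : ∀ s ∈ S, a < ‖s‖ ∧ ‖s‖ < b) {g : ℂ → ℂ} (hg : DifferentiableOn ℂ g (U \ S))
    {c : ℂ → ℂ} (hc : ∀ s ∈ S, Tendsto (fun ζ => (ζ - s) * g ζ) (𝓝[≠] s) (𝓝 (c s))) :
    (∮ z in C(0, b), g z) - (∮ z in C(0, a), g z) = (2 * Real.pi * Complex.I) * ∑ s ∈ S, c s := by
  -- Subtracting the principal parts `c s / (z - s)` leaves removable singularities. The remainder
  -- has equal integrals over both circles, while each principal part contributes `2 π i c s` on the
  -- outer circle and nothing on the inner one.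
  classical
  have hpole : ∀ s, DifferentiableOn ℂ (fun z => c s * (z - s)⁻¹) {s}ᶜ := fun s =>
    (DifferentiableOn.inv (by fun_prop) fun z hz => sub_ne_zero.mpr hz).const_mul _
  have hpoles : DifferentiableOn ℂ (fun z => ∑ s ∈ S, c s * (z - s)⁻¹) (U \ S) :=
    DifferentiableOn.fun_sum fun s hs => (hpole s).mono fun z hz h => hz.2 (h ▸ hs)
  have h0 : ∀ s ∈ S, Tendsto (fun ζ => (ζ - s) * (g ζ - ∑ t ∈ S, c t * (ζ - t)⁻¹)) (𝓝[≠] s)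
      (𝓝 0) := fun s hs => by
    have h1 : ∀ t ∈ S, Tendsto (fun ζ => (ζ - s) * (c t * (ζ - t)⁻¹)) (𝓝[≠] s)
        (𝓝 (if t = s then c t else 0)) := fun t _ => by
      split_ifs with hts
      · subst hts
        refine tendsto_const_nhds.congr' ?_
        filter_upwards [self_mem_nhdsWithin] with ζ hζ
        rw [mul_left_comm, mul_inv_cancel₀ (sub_ne_zero.mpr hζ), mul_one]
      · have h2 : ContinuousAt (fun ζ => (ζ - s) * (c t * (ζ - t)⁻¹)) s :=
          ContinuousAt.mul (by fun_prop) (continuousAt_const.mul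
            (ContinuousAt.inv₀ (by fun_prop) (sub_ne_zero.mpr (Ne.symm hts))))
        have h3 := h2.tendsto
        rw [sub_self, zero_mul] at h3
        exact h3.mono_left nhdsWithin_le_nhds
    have h2 := (hc s hs).sub (tendsto_finsetSum S h1)
    rw [Finset.sum_ite_eq' S s c, if_pos hs, sub_self] at h2
    refine h2.congr fun ζ => ?_
    rw [mul_sub, Finset.mul_sum]
  obtain ⟨G, hGc, hGg⟩ := exists_continuousOn_extension_of_removable hU (hg.sub hpoles) h0
  have hnotin : ∀ ρ, ρ = a ∨ ρ = b → ∀ z ∈ Metric.sphere (0 : ℂ) ρ, z ∉ S := fun ρ hρ z hz hzS => by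
    rw [mem_sphere_zero_iff_norm] at hz
    have := hS z hzS
    rcases hρ with rfl | rfl <;> linarith
  have hmem : ∀ ρ, ρ = a ∨ ρ = b → Metric.sphere (0 : ℂ) ρ ⊆ U \ S := fun ρ hρ z hz => by
    refine ⟨?_, hnotin ρ hρ z hz⟩
    rw [mem_sphere_zero_iff_norm] at hz
    rcases hρ with rfl | rfl
    · exact hsub z hz.ge (hz.trans_le hab)
    · exact hsub z (hab.trans hz.ge) hz.le
  have hpos : ∀ ρ, ρ = a ∨ ρ = b → 0 ≤ ρ := fun ρ hρ => by
    rcases hρ with rfl | rfl <;> linarith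
  have hG : (∮ z in C(0, b), G z) = ∮ z in C(0, a), G z := by
    refine Complex.circleIntegral_eq_of_differentiable_on_annulus_off_countable ha hab
      S.finite_toSet.countable (hGc.mono fun z hz => ?_) fun z hz => ?_
    · exact hsub z (by simpa using hz.2) (by simpa using hz.1)
    · have hzU : z ∈ U \ (S : Set ℂ) := by
        refine ⟨hsub z ?_ ?_, hz.2⟩
        · have := hz.1.2
          rw [mem_closedBall_zero_iff, not_le] at this
          exact this.le
        · exact (mem_ball_zero_iff.mp hz.1.1).le
      have hnhds := (hU.sdiff S.finite_toSet.isClosed).mem_nhds hzU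
      refine ((hg.sub hpoles).differentiableAt hnhds).congr_of_eventuallyEq ?_
      filter_upwards [hnhds] with w hw
      exact hGg w hw.2
  have hsplit : ∀ ρ, ρ = a ∨ ρ = b → (∮ z in C(0, ρ), g z) =
      (∮ z in C(0, ρ), G z) + ∑ s ∈ S, c s * ∮ z in C(0, ρ), (z - s)⁻¹ := fun ρ hρ => by
    have hint : ∀ s ∈ S, CircleIntegrable (fun z => c s * (z - s)⁻¹) 0 ρ := fun s hs =>
      ((hpole s).continuousOn.mono fun z hz h =>
        hnotin ρ hρ z hz (h ▸ hs)).circleIntegrable (hpos ρ hρ)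
    have h1 : (∮ z in C(0, ρ), G z) =
        ∮ z in C(0, ρ), (g z - ∑ s ∈ S, c s * (z - s)⁻¹) :=
      circleIntegral.integral_congr (hpos ρ hρ) fun z hz => hGg z (hnotin ρ hρ z hz)
    rw [h1, circleIntegral.integral_sub
      ((hg.continuousOn.mono (hmem ρ hρ)).circleIntegrable (hpos ρ hρ))
      ((hpoles.continuousOn.mono (hmem ρ hρ)).circleIntegrable (hpos ρ hρ)),
      circleIntegral.integral_fun_sum hint]
    simp_rw [circleIntegral.integral_const_mul]
    ring
  rw [hsplit b (Or.inr rfl), hsplit a (Or.inl rfl), hG, add_sub_add_left_eq_sub, Finset.mul_sum,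
    ← Finset.sum_sub_distrib]
  refine Finset.sum_congr rfl fun s hs => ?_
  rw [circleIntegral_inv_sub_eq_zero ha (hS s hs).1, circleIntegral.integral_sub_inv_of_mem_ball
    (mem_ball_zero_iff.mpr (hS s hs).2)]
  ring

/-! ### Boundary integrals over annuli. -/

theorem isOpen_annulus (ρ : ℝ) : IsOpen (annulus ρ) :=
  (isOpen_lt continuous_const continuous_norm).inter (isOpen_lt continuous_norm continuous_const)

theorem mem_annulus_of_le {ρ R : ℝ} (hρ : 0 < ρ) (hρR : ρ < R) {z : ℂ} (h1 : ρ⁻¹ ≤ ‖z‖)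
    (h2 : ‖z‖ ≤ ρ) : z ∈ annulus R :=
  ⟨(inv_strictAnti₀ hρ hρR).trans_le h1, h2.trans_lt hρR⟩

theorem annulus_subset {r R : ℝ} (hr : 0 < r) (hrR : r ≤ R) : annulus r ⊆ annulus R :=
  fun _ hz => ⟨(inv_anti₀ hr hrR).trans_lt hz.1, hz.2.trans_le hrR⟩

/-- The normalised difference of the integrals over the two boundary circles of `annulus ρ`. -/
def annulusIntegral (ρ : ℝ) (g : ℂ → ℂ) : ℂ :=
  (2 * Real.pi * Complex.I : ℂ)⁻¹ * ((∮ z in C(0, ρ), g z) - ∮ z in C(0, ρ⁻¹), g z)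

theorem annulusIntegral_eq_sum_residues {ρ R : ℝ} (hρ : 1 < ρ) (hρR : ρ < R) {S : Finset ℂ}
    (hS : ∀ s ∈ S, s ∈ annulus ρ) {g : ℂ → ℂ} (hg : DifferentiableOn ℂ g (annulus R \ S))
    {c : ℂ → ℂ} (hc : ∀ s ∈ S, Tendsto (fun ζ => (ζ - s) * g ζ) (𝓝[≠] s) (𝓝 (c s))) :
    annulusIntegral ρ g = ∑ s ∈ S, c s := by
  have h0 : 0 < ρ := by linarith
  rw [annulusIntegral, circleIntegral_sub_eq_sum_residues (inv_pos.mpr h0)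
    ((inv_lt_one_of_one_lt₀ hρ).le.trans hρ.le) (isOpen_annulus R)
    (fun z h1 h2 => mem_annulus_of_le h0 hρR h1 h2) hS hg hc,
    inv_mul_cancel_left₀ Complex.two_pi_I_ne_zero]

/-- The Cauchy integral formula on an annulus. -/
theorem annulusIntegral_mul_inv_sub {ρ R : ℝ} (hρ : 1 < ρ) (hρR : ρ < R) {f : ℂ → ℂ}
    (hf : DifferentiableOn ℂ f (annulus R)) {z : ℂ} (hz : z ∈ annulus ρ) :
    annulusIntegral ρ (fun ζ => f ζ * (ζ - z)⁻¹) = f z := by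
  have hzR : z ∈ annulus R := annulus_subset (by linarith) hρR.le hz
  rw [annulusIntegral_eq_sum_residues (S := {z}) (c := f) hρ hρR (by simpa using hz),
    Finset.sum_singleton]
  · refine (hf.mono Set.sdiff_subset).mul (DifferentiableOn.inv (by fun_prop) fun w hw => ?_)
    exact sub_ne_zero.mpr fun h => hw.2 (by simp [h])
  · intro s hs
    rw [Finset.mem_singleton] at hs
    subst hs
    have h1 := ((hf.differentiableAt
      ((isOpen_annulus R).mem_nhds hzR)).continuousAt.tendsto).mono_left
      (nhdsWithin_le_nhds (s := {s}ᶜ))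
    refine h1.congr' ?_
    filter_upwards [self_mem_nhdsWithin] with ζ hζ
    rw [mul_left_comm, mul_inv_cancel₀ (sub_ne_zero.mpr hζ), mul_one]

theorem norm_annulusIntegral_le {ρ : ℝ} (hρ : 0 < ρ) {g : ℂ → ℂ} {C D : ℝ}
    (hC : ∀ ζ, ‖ζ‖ = ρ → ‖g ζ‖ ≤ C) (hD : ∀ ζ, ‖ζ‖ = ρ⁻¹ → ‖g ζ‖ ≤ D) :
    ‖annulusIntegral ρ g‖ ≤ ρ * C + ρ⁻¹ * D := by
  rw [annulusIntegral, mul_sub]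
  refine (norm_sub_le _ _).trans (add_le_add ?_ ?_)
  · exact circleIntegral.norm_two_pi_i_inv_smul_integral_le_of_norm_le_const hρ.le
      fun z hz => hC z (mem_sphere_zero_iff_norm.mp hz)
  · exact circleIntegral.norm_two_pi_i_inv_smul_integral_le_of_norm_le_const (inv_pos.mpr hρ).le
      fun z hz => hD z (mem_sphere_zero_iff_norm.mp hz)

theorem annulusIntegral_congr {ρ : ℝ} (hρ : 0 < ρ) {g h : ℂ → ℂ}
    (hgh : ∀ ζ, ‖ζ‖ = ρ ∨ ‖ζ‖ = ρ⁻¹ → g ζ = h ζ) :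
    annulusIntegral ρ g = annulusIntegral ρ h := by
  rw [annulusIntegral, annulusIntegral,
    circleIntegral.integral_congr hρ.le fun z hz => hgh z (Or.inl (mem_sphere_zero_iff_norm.mp hz)),
    circleIntegral.integral_congr (inv_pos.mpr hρ).le fun z hz =>
      hgh z (Or.inr (mem_sphere_zero_iff_norm.mp hz))]

theorem annulusIntegral_sub {ρ : ℝ} {g h : ℂ → ℂ}
    (hg : CircleIntegrable g 0 ρ) (hg' : CircleIntegrable g 0 ρ⁻¹)
    (hh : CircleIntegrable h 0 ρ) (hh' : CircleIntegrable h 0 ρ⁻¹) :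
    annulusIntegral ρ (fun z => g z - h z) = annulusIntegral ρ g - annulusIntegral ρ h := by
  rw [annulusIntegral, annulusIntegral, annulusIntegral, circleIntegral.integral_sub hg hh,
    circleIntegral.integral_sub hg' hh']
  ring

theorem annulusIntegral_sum {ρ : ℝ} {ι : Type*} {s : Finset ι} {g : ι → ℂ → ℂ}
    (hg : ∀ i ∈ s, CircleIntegrable (g i) 0 ρ) (hg' : ∀ i ∈ s, CircleIntegrable (g i) 0 ρ⁻¹) :
    annulusIntegral ρ (fun z => ∑ i ∈ s, g i z) = ∑ i ∈ s, annulusIntegral ρ (g i) := by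
  simp only [annulusIntegral]
  rw [circleIntegral.integral_fun_sum hg, circleIntegral.integral_fun_sum hg',
    ← Finset.sum_sub_distrib, Finset.mul_sum]

theorem annulusIntegral_mul_const (ρ : ℝ) (g : ℂ → ℂ) (c : ℂ) :
    annulusIntegral ρ (fun z => g z * c) = annulusIntegral ρ g * c := by
  simp only [annulusIntegral, mul_comm _ c, circleIntegral.integral_const_mul]
  ring

end Residues

/-! ### Equidistant interpolation on the circle -/

section Interpolation

/-- The Laurent polynomial in the span of `z ^ (-n), …, z ^ (n - 1)` that agrees with `f` at the
`2 n` equidistant nodes. -/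
def circleInterp (n : ℕ) (f : ℂ → ℂ) (z : ℂ) : ℂ :=
  ∑ k : Fin (2 * n), f (circleNode n k) * circleLagrange n k z

theorem circleNode_ne_zero (n k : ℕ) : circleNode n k ≠ 0 :=
  norm_pos_iff.mp (by rw [norm_circleNode]; exact one_pos)

/-- For fixed `m` the powers form a geometric progression in `k`, whose ratio is a `2 n`-th root of
unity. -/
theorem circleNode_zpow {n : ℕ} (hn : 1 ≤ n) (k : ℕ) (m : ℤ) :
    circleNode n k ^ m = Complex.exp (m * (Real.pi / (2 * n)) * Complex.I) *
      Complex.exp (2 * Real.pi * Complex.I * (m / (2 * n : ℕ))) ^ k := by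
  have hn' : (n : ℂ) ≠ 0 := by exact_mod_cast (by lia : n ≠ 0)
  rw [circleNode, ← Complex.exp_int_mul, ← Complex.exp_nat_mul, ← Complex.exp_add]
  congr 1
  push_cast
  field_simp
  ring

/-- Identifies `z ^ n + z ^ (-n)` as the nodal function of the interpolation. -/
theorem circleNode_pow_add_pow {n : ℕ} (hn : 1 ≤ n) (k : ℕ) :
    circleNode n k ^ n + (circleNode n k ^ n)⁻¹ = 0 := by
  have hn' : (n : ℂ) ≠ 0 := by exact_mod_cast (by lia : n ≠ 0)
  have h1 : circleNode n k ^ n = Complex.exp ((k * Real.pi + Real.pi / 2 : ℝ) * Complex.I) := by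
    rw [circleNode, ← Complex.exp_nat_mul]
    congr 1
    push_cast
    field_simp
  rw [h1, ← Complex.exp_neg, ← neg_mul, ← Complex.two_cos, ← Complex.ofReal_cos,
    Real.cos_add_pi_div_two, Real.sin_nat_mul_pi]
  simp

/-- Discrete orthogonality: for `0 < |m| < 2 n` the ratio of the geometric progression is not `1`.
-/
theorem sum_circleNode_zpow {n : ℕ} (hn : 1 ≤ n) {m : ℤ} (hm : m ≠ 0) (hm' : |m| < 2 * n) :
    ∑ k : Fin (2 * n), circleNode n k ^ m = 0 := by
  have hn' : ((2 * n : ℕ) : ℂ) ≠ 0 := by exact_mod_cast (by lia : 2 * n ≠ 0)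
  set x := Complex.exp (2 * Real.pi * Complex.I * (m / (2 * n : ℕ))) with hx
  have hx1 : x ≠ 1 := by
    rw [hx, Ne, Complex.exp_eq_one_iff]
    rintro ⟨j, hj⟩
    have h1 : (m : ℂ) / (2 * n : ℕ) = j := by
      have := Complex.two_pi_I_ne_zero
      apply mul_left_cancel₀ this
      rw [hj]
      ring
    rw [div_eq_iff hn'] at h1
    have h2 : m = j * (2 * n) := by exact_mod_cast h1
    have hj0 : j ≠ 0 := by rintro rfl; simp at h2; exact hm h2
    have h3 : 1 ≤ |j| := Int.one_le_abs hj0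
    rw [h2, abs_mul, abs_of_nonneg (by positivity : (0 : ℤ) ≤ 2 * n)] at hm'
    nlinarith
  have hxn : x ^ (2 * n) = 1 := by
    rw [hx, ← Complex.exp_nat_mul, Complex.exp_eq_one_iff]
    refine ⟨m, ?_⟩
    field_simp
  rw [Fin.sum_univ_eq_sum_range (fun k => circleNode n k ^ m) (2 * n)]
  simp_rw [circleNode_zpow hn]
  rw [← Finset.mul_sum, geom_sum_eq hx1, hxn, sub_self, zero_div, mul_zero]

/-- The span of `z ^ (-n), …, z ^ (n - 1)`. -/
def laurentSpan (n : ℕ) : Submodule ℂ (ℂ → ℂ) :=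
  Submodule.span ℂ ((fun (l : ℤ) (z : ℂ) => z ^ l) '' Set.Ico (-(n : ℤ)) n)

theorem zpow_mem_laurentSpan {n : ℕ} {l : ℤ} (h1 : -(n : ℤ) ≤ l) (h2 : l < n) :
    (fun z : ℂ => z ^ l) ∈ laurentSpan n :=
  Submodule.subset_span ⟨l, ⟨h1, h2⟩, rfl⟩

/-- Two exponents in the window of length `2 n` differ by less than `2 n`, so orthogonality leaves
only the term with exponent `l`. -/
theorem circleInterp_zpow {n : ℕ} (hn : 1 ≤ n) {l : ℤ} (hl : l ∈ Set.Ico (-(n : ℤ)) n) (z : ℂ) :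
    circleInterp n (fun w => w ^ l) z = z ^ l := by
  have hn' : (2 * n : ℂ) ≠ 0 := by exact_mod_cast (by lia : 2 * n ≠ 0)
  have hterm : ∀ k : Fin (2 * n), circleNode n k ^ l * circleLagrange n k z =
      ∑ j ∈ Finset.Ico (-(n : ℤ)) n, (2 * n : ℂ)⁻¹ * z ^ j * circleNode n k ^ (l - j) := fun k => by
    rw [circleLagrange, Finset.mul_sum, Finset.mul_sum]
    refine Finset.sum_congr rfl fun j _ => ?_
    rw [div_zpow, zpow_sub₀ (circleNode_ne_zero n k)]
    ring
  rw [circleInterp, Finset.sum_congr rfl fun k _ => hterm k, Finset.sum_comm]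
  simp_rw [← Finset.mul_sum]
  rw [Finset.sum_eq_single l]
  · simp only [sub_self, zpow_zero, Finset.sum_const, Finset.card_univ, Fintype.card_fin,
      nsmul_eq_mul, mul_one]
    push_cast
    rw [mul_right_comm, mul_comm _ (2 * n : ℂ), mul_inv_cancel₀ hn', one_mul]
  · intro j hj hjl
    rw [Finset.mem_Ico] at hj
    rw [sum_circleNode_zpow hn (sub_ne_zero.mpr hjl.symm) (by
      rw [abs_lt]
      have := hl.1
      have := hl.2
      constructor <;> lia), mul_zero]
  · intro h
    exact absurd (Finset.mem_Ico.mpr hl) h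

/-- Equidistant interpolation reproduces the Laurent polynomials of the appropriate degree. -/
theorem circleInterp_of_mem_laurentSpan {n : ℕ} (hn : 1 ≤ n) {f : ℂ → ℂ} (hf : f ∈ laurentSpan n)
    (z : ℂ) : circleInterp n f z = f z := by
  induction hf using Submodule.span_induction with
  | mem f hf =>
    obtain ⟨l, hl, rfl⟩ := hf
    exact circleInterp_zpow hn hl z
  | zero => simp [circleInterp]
  | add f g _ _ hf hg =>
    rw [Pi.add_apply, ← hf, ← hg, circleInterp, circleInterp, circleInterp,
      ← Finset.sum_add_distrib]
    exact Finset.sum_congr rfl fun k _ => add_mul _ _ _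
  | smul c f _ hf =>
    rw [Pi.smul_apply, ← hf, circleInterp, circleInterp, Finset.smul_sum]
    exact Finset.sum_congr rfl fun k _ => mul_assoc _ _ _

theorem circleInterp_congr {n : ℕ} {f g : ℂ → ℂ}
    (h : ∀ k < 2 * n, f (circleNode n k) = g (circleNode n k)) (z : ℂ) :
    circleInterp n f z = circleInterp n g z :=
  Finset.sum_congr rfl fun k _ => by rw [h k k.2]

/-- Interpolation of the Cauchy kernel. -/
theorem circleInterp_inv_sub {n : ℕ} (hn : 1 ≤ n) {ζ z : ℂ} (hζ0 : ζ ≠ 0)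
    (hζ1 : ‖ζ‖ ≠ 1) (hζ : ζ ^ n + (ζ ^ n)⁻¹ ≠ 0) (hz : z ≠ 0) (hzζ : z ≠ ζ) :
    circleInterp n (fun w => (ζ - w)⁻¹) z =
      (ζ - z)⁻¹ - (z ^ n + (z ^ n)⁻¹) * ((ζ ^ n + (ζ ^ n)⁻¹)⁻¹ * (ζ - z)⁻¹) := by
  set a := ζ ^ n + (ζ ^ n)⁻¹ with ha
  -- With `ω(w) = w ^ n + w ^ (-n)`, this is `(ω(ζ) - ω(w)) / (ω(ζ) (ζ - w))`. The division is
  -- exact: `ζ ^ n - w ^ n` gives the exponents `0, …, n - 1`, and `ζ ^ (-n) - w ^ (-n)` gives `-n,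
  -- …, -1`. At the nodes `ω` vanishes and `Q` is the Cauchy kernel.
  let Q : ℂ → ℂ := ∑ i ∈ Finset.range n, (a⁻¹ * ζ ^ (n - 1 - i)) • (fun w : ℂ => w ^ (i : ℤ)) -
    ∑ i ∈ Finset.range n, (a⁻¹ * (ζ ^ n)⁻¹ * ζ ^ (n - 1 - i)) •
      (fun w : ℂ => w ^ ((i : ℤ) - n))
  have hQ : Q ∈ laurentSpan n := by
    refine Submodule.sub_mem _ ?_ ?_ <;>
    · refine Submodule.sum_mem _ fun i hi => Submodule.smul_mem _ _ (zpow_mem_laurentSpan ?_ ?_)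
      all_goals
        rw [Finset.mem_range] at hi
        lia
  have hQval : ∀ w, w ≠ 0 → w ≠ ζ →
      Q w = (ζ - w)⁻¹ - (w ^ n + (w ^ n)⁻¹) * (a⁻¹ * (ζ - w)⁻¹) := fun w hw hwζ => by
    have hd : ζ - w ≠ 0 := sub_ne_zero.mpr hwζ.symm
    have hgeom : (∑ i ∈ Finset.range n, w ^ i * ζ ^ (n - 1 - i)) = (ζ ^ n - w ^ n) * (ζ - w)⁻¹ := by
      rw [eq_mul_inv_iff_mul_eq₀ hd]
      have := geom_sum₂_mul w ζ n
      linear_combination -this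
    have h1 : Q w = a⁻¹ * (∑ i ∈ Finset.range n, w ^ i * ζ ^ (n - 1 - i)) -
        a⁻¹ * (ζ ^ n)⁻¹ * (w ^ n)⁻¹ * (∑ i ∈ Finset.range n, w ^ i * ζ ^ (n - 1 - i)) := by
      simp only [Q, Pi.sub_apply, Finset.sum_apply, Pi.smul_apply, smul_eq_mul, Finset.mul_sum]
      congr 1 <;> refine Finset.sum_congr rfl fun i _ => ?_
      · rw [zpow_natCast]
        ring
      · rw [zpow_sub₀ hw, zpow_natCast, zpow_natCast]
        ring
    have hζn : ζ ^ n ≠ 0 := pow_ne_zero _ hζ0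
    have hwn : w ^ n ≠ 0 := pow_ne_zero _ hw
    have h2 : (ζ - w)⁻¹ = a⁻¹ * a * (ζ - w)⁻¹ := by rw [inv_mul_cancel₀ hζ, one_mul]
    rw [h1, hgeom]
    conv_rhs => rw [h2]
    rw [ha]
    field_simp
    ring
  rw [← hQval z hz hzζ, ← circleInterp_of_mem_laurentSpan hn hQ z]
  refine circleInterp_congr (fun k _ => ?_) z
  rw [hQval _ (circleNode_ne_zero n k) fun h => hζ1 (h ▸ norm_circleNode n k),
    circleNode_pow_add_pow hn, zero_mul, sub_zero]

/-! ### Error estimate for interpolation on annuli. -/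

theorem norm_pow_add_inv_le {r : ℝ} (hr : 0 < r) {z : ℂ} (hz : z ∈ annulus r) (n : ℕ) :
    ‖z ^ n + (z ^ n)⁻¹‖ ≤ 2 * r ^ n := by
  have h0 : 0 < ‖z‖ := (inv_pos.mpr hr).trans hz.1
  have h1 : ‖z‖⁻¹ ≤ r := inv_le_of_inv_le₀ hr hz.1.le
  calc _ ≤ ‖z‖ ^ n + (‖z‖⁻¹) ^ n := by
        refine (norm_add_le _ _).trans_eq ?_
        rw [norm_inv, norm_pow, inv_pow]
    _ ≤ r ^ n + r ^ n := by
        gcongr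
        exact hz.2.le
    _ = _ := by ring

/-- The factor `1 - r⁻¹` depends neither on `n` nor on `ρ`, so the estimate survives the limit `ρ →
R`. -/
theorem le_norm_pow_add_inv {r ρ : ℝ} (hr : 1 < r) (hrρ : r < ρ) {ζ : ℂ}
    (hζ : ‖ζ‖ = ρ ∨ ‖ζ‖ = ρ⁻¹) {n : ℕ} (hn : 1 ≤ n) :
    ρ ^ n * (1 - r⁻¹) ≤ ‖ζ ^ n + (ζ ^ n)⁻¹‖ := by
  have h0 : 0 < ρ := by linarith
  have h1 : ρ ^ n - (ρ ^ n)⁻¹ ≤ ‖ζ ^ n + (ζ ^ n)⁻¹‖ := by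
    rcases hζ with h | h
    · have := norm_sub_le_norm_add (ζ ^ n) (ζ ^ n)⁻¹
      rwa [norm_inv, norm_pow, h] at this
    · have := norm_sub_le_norm_add (ζ ^ n)⁻¹ (ζ ^ n)
      rw [norm_inv, norm_pow, h, inv_pow, inv_inv] at this
      rwa [add_comm (ζ ^ n)]
  refine le_trans ?_ h1
  have h2 : (1 : ℝ) ≤ ρ ^ n := one_le_pow₀ (by linarith)
  have h3 : r ≤ ρ ^ n := hrρ.le.trans (le_self_pow₀ (by linarith) (by lia))
  have h4 : (ρ ^ n)⁻¹ ≤ r⁻¹ := inv_anti₀ (by linarith) h3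
  have h5 : r⁻¹ ≤ ρ ^ n * r⁻¹ := le_mul_of_one_le_left (by positivity) h2
  linarith

/-- Hermite's error formula: write `f` by Cauchy's formula on the boundary of `annulus ρ` and
interpolate the Cauchy kernel under the integral sign. -/
theorem circleInterp_sub_eq {ρ R : ℝ} (hρ : 1 < ρ) (hρR : ρ < R) {f : ℂ → ℂ}
    (hf : DifferentiableOn ℂ f (annulus R)) {n : ℕ} (hn : 1 ≤ n)
    (hω : ∀ ζ : ℂ, ‖ζ‖ = ρ ∨ ‖ζ‖ = ρ⁻¹ → ζ ^ n + (ζ ^ n)⁻¹ ≠ 0) {z : ℂ} (hz : z ∈ annulus ρ) :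
    f z - circleInterp n f z = annulusIntegral ρ (fun ζ =>
      f ζ * ((z ^ n + (z ^ n)⁻¹) * ((ζ ^ n + (ζ ^ n)⁻¹)⁻¹ * (ζ - z)⁻¹))) := by
  have h0 : 0 < ρ := by linarith
  have hi : ρ⁻¹ < 1 := inv_lt_one_of_one_lt₀ hρ
  have hmem : ∀ ζ : ℂ, ‖ζ‖ = ρ ∨ ‖ζ‖ = ρ⁻¹ → ζ ∈ annulus R := fun ζ h =>
    mem_annulus_of_le h0 hρR (by rcases h with h | h <;> linarith)
      (by rcases h with h | h <;> linarith)
  have hint : ∀ w ∈ annulus ρ, ∀ c : ℂ, ∀ σ, σ = ρ ∨ σ = ρ⁻¹ →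
      CircleIntegrable (fun ζ => f ζ * (ζ - w)⁻¹ * c) 0 σ := fun w hw c σ hσ => by
    refine ContinuousOn.circleIntegrable (by rcases hσ with rfl | rfl <;> positivity) ?_
    refine ((hf.continuousOn.mono fun ζ hζ => hmem ζ ?_).mul
      (ContinuousOn.inv₀ (by fun_prop) fun ζ hζ h => ?_)).mul continuousOn_const
    · rw [mem_sphere_zero_iff_norm] at hζ
      rwa [hζ]
    · rw [mem_sphere_zero_iff_norm, sub_eq_zero.mp h] at hζ
      have h1 := hw.1
      have h2 := hw.2
      rcases hσ with rfl | rfl <;> linarith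
  have hnode : ∀ k, circleNode n k ∈ annulus ρ := fun k =>
    mem_annulus_of_norm_eq_one hρ (norm_circleNode n k)
  have h1 : circleInterp n f z = annulusIntegral ρ
      (fun ζ => ∑ k : Fin (2 * n), f ζ * (ζ - circleNode n k)⁻¹ * circleLagrange n k z) := by
    rw [annulusIntegral_sum
      (g := fun (k : Fin (2 * n)) ζ => f ζ * (ζ - circleNode n k)⁻¹ * circleLagrange n k z)
      (fun k _ => hint _ (hnode (k : ℕ)) _ _ (Or.inl rfl))
      (fun k _ => hint _ (hnode (k : ℕ)) _ _ (Or.inr rfl)), circleInterp]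
    refine Finset.sum_congr rfl fun k _ => ?_
    rw [annulusIntegral_mul_const, annulusIntegral_mul_inv_sub hρ hρR hf (hnode k)]
  have hint1 : ∀ σ, σ = ρ ∨ σ = ρ⁻¹ → CircleIntegrable (fun ζ => f ζ * (ζ - z)⁻¹) 0 σ :=
    fun σ hσ => by simpa using hint z hz 1 σ hσ
  have hints : ∀ σ, σ = ρ ∨ σ = ρ⁻¹ → CircleIntegrable (fun ζ => ∑ k : Fin (2 * n),
      f ζ * (ζ - circleNode n k)⁻¹ * circleLagrange n k z) 0 σ := fun σ hσ =>
    CircleIntegrable.fun_sum _ fun k _ => hint _ (hnode (k : ℕ)) _ _ hσ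
  rw [h1, ← annulusIntegral_mul_inv_sub hρ hρR hf hz, ← annulusIntegral_sub (hint1 _ (Or.inl rfl))
    (hint1 _ (Or.inr rfl)) (hints _ (Or.inl rfl)) (hints _ (Or.inr rfl))]
  refine annulusIntegral_congr h0 fun ζ hζ => ?_
  have hζ0 : ζ ≠ 0 := ne_zero_of_mem_annulus (by linarith) (hmem ζ hζ)
  have hζ1 : ‖ζ‖ ≠ 1 := by rcases hζ with h | h <;> rw [h] <;> linarith
  have hzζ : z ≠ ζ := by
    rintro rfl
    have h1 := hz.1
    have h2 := hz.2
    rcases hζ with h | h <;> linarith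
  have h2 := circleInterp_inv_sub hn hζ0 hζ1 (hω ζ hζ) (ne_zero_of_mem_annulus hρ hz) hzζ
  rw [circleInterp] at h2
  simp_rw [mul_assoc (f ζ)]
  rw [← Finset.mul_sum, h2]
  ring

/-- The auxiliary radius `ρ < R` is needed because `f` is given only on the open annulus. -/
theorem norm_circleInterp_sub_le_of_lt {r ρ R M : ℝ} (hr : 1 < r) (hrρ : r < ρ) (hρR : ρ < R)
    {f : ℂ → ℂ} (hf : DifferentiableOn ℂ f (annulus R)) (hM : ∀ z ∈ annulus R, ‖f z‖ ≤ M)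
    {n : ℕ} (hn : 1 ≤ n) {z : ℂ} (hz : z ∈ annulus r) :
    ‖circleInterp n f z - f z‖ ≤ 2 * (ρ + r) / ((1 - r⁻¹) * (ρ - r)) * M * (r / ρ) ^ n := by
  have hρ : 1 < ρ := hr.trans hrρ
  have h0 : 0 < ρ := by linarith
  have hr0 : 0 < r := by linarith
  have hd : 0 < ρ - r := by linarith
  have hi : ρ⁻¹ < r⁻¹ := inv_strictAnti₀ hr0 hrρ
  have hi1 : r⁻¹ < 1 := inv_lt_one_of_one_lt₀ hr
  have hpos : 0 < ρ ^ n * (1 - r⁻¹) := mul_pos (by positivity) (by linarith)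
  have hω : ∀ ζ : ℂ, ‖ζ‖ = ρ ∨ ‖ζ‖ = ρ⁻¹ → ζ ^ n + (ζ ^ n)⁻¹ ≠ 0 := fun ζ hζ =>
    norm_pos_iff.mp (hpos.trans_le (le_norm_pow_add_inv hr hrρ hζ hn))
  have hmem : ∀ ζ : ℂ, ‖ζ‖ = ρ ∨ ‖ζ‖ = ρ⁻¹ → ζ ∈ annulus R := fun ζ h =>
    mem_annulus_of_le h0 hρR (by rcases h with h | h <;> linarith)
      (by rcases h with h | h <;> linarith)
  have hM0 : 0 ≤ M := (norm_nonneg _).trans (hM z (annulus_subset hr0 (hrρ.trans hρR).le hz))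
  have hbound : ∀ ζ : ℂ, ‖ζ‖ = ρ ∨ ‖ζ‖ = ρ⁻¹ → ∀ d : ℝ, 0 < d → d ≤ ‖ζ - z‖ →
      ‖f ζ * ((z ^ n + (z ^ n)⁻¹) * ((ζ ^ n + (ζ ^ n)⁻¹)⁻¹ * (ζ - z)⁻¹))‖ ≤
        M * ((2 * r ^ n) * ((ρ ^ n * (1 - r⁻¹))⁻¹ * d⁻¹)) := fun ζ hζ d hd0 hdζ => by
    rw [norm_mul, norm_mul, norm_mul, norm_inv, norm_inv]
    gcongr
    exacts [hM ζ (hmem ζ hζ), norm_pow_add_inv_le hr0 hz n, le_norm_pow_add_inv hr hrρ hζ hn]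
  rw [norm_sub_rev, circleInterp_sub_eq hρ hρR hf hn hω (annulus_subset hr0 hrρ.le hz)]
  refine (norm_annulusIntegral_le h0
    (fun ζ hζ => hbound ζ (Or.inl hζ) (ρ - r) hd ?_)
    (fun ζ hζ => hbound ζ (Or.inr hζ) (r⁻¹ - ρ⁻¹) (by linarith) ?_)).trans_eq ?_
  · have := norm_sub_norm_le ζ z
    have := hz.2
    linarith
  · have := norm_sub_norm_le z ζ
    rw [norm_sub_rev] at this
    have := hz.1
    linarith
  -- Length over distance is `ρ / (ρ - r)` for the outer circle and `r / (ρ - r)` for the inner one;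
  -- the sum is `(ρ + r) / (ρ - r)`.
  · have h1 : (r⁻¹ - ρ⁻¹)⁻¹ = r * ρ / (ρ - r) := by
      rw [inv_sub_inv hr0.ne' h0.ne', inv_div]
    have h2 : 1 - r⁻¹ ≠ 0 := by linarith
    rw [h1, div_pow]
    generalize 1 - r⁻¹ = t at h2
    field_simp

/-- Equidistant interpolation of bounded holomorphic functions on `annulus R` converges at the rate
`(r / R) ^ n` on `annulus r`. -/
theorem norm_circleInterp_sub_le {r R M : ℝ} (hr : 1 < r) (hrR : r < R)
    {f : ℂ → ℂ} (hf : DifferentiableOn ℂ f (annulus R)) (hM : ∀ z ∈ annulus R, ‖f z‖ ≤ M)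
    {n : ℕ} (hn : 1 ≤ n) {z : ℂ} (hz : z ∈ annulus r) :
    ‖circleInterp n f z - f z‖ ≤ 2 * (R + r) / ((1 - r⁻¹) * (R - r)) * M * (r / R) ^ n := by
  have hi1 : r⁻¹ < 1 := inv_lt_one_of_one_lt₀ hr
  -- For fixed `n` the left side does not involve `ρ`, so `ρ` may increase to `R` in the bound.
  have hcont : ContinuousAt (fun ρ : ℝ => 2 * (ρ + r) / ((1 - r⁻¹) * (ρ - r)) * M * (r / ρ) ^ n)
      R := by
    have h1 : (1 - r⁻¹) * (R - r) ≠ 0 := mul_ne_zero (by linarith) (by linarith)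
    have h2 : R ≠ 0 := by linarith
    fun_prop (disch := assumption)
  have hlim := hcont.tendsto.mono_left (nhdsWithin_le_nhds (s := Set.Iio R))
  refine ge_of_tendsto hlim ?_
  filter_upwards [Ioo_mem_nhdsLT hrR] with ρ hρ
  exact norm_circleInterp_sub_le_of_lt hr hρ.1 hρ.2 hf hM hn hz

end Interpolation

/-! ### The space of bounded holomorphic functions -/

section HardySpace

variable {U : Set ℂ}

theorem hinfVal_apply (f : Hinf U) {z : ℂ} (hz : z ∈ U) :
    hinfVal f z = (f : BoundedContinuousFunction U ℂ) ⟨z, hz⟩ :=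
  zeroExt_apply _ (⟨z, hz⟩ : U)

theorem differentiableOn_hinfVal (f : Hinf U) : DifferentiableOn ℂ (hinfVal f) U := f.2

theorem norm_hinfVal_le (f : Hinf U) {z : ℂ} (hz : z ∈ U) : ‖hinfVal f z‖ ≤ ‖f‖ := by
  rw [hinfVal_apply f hz]
  exact BoundedContinuousFunction.norm_coe_le_norm _ _

theorem Hinf.norm_le_of_forall {f : Hinf U} {C : ℝ} (hC : 0 ≤ C)
    (h : ∀ z ∈ U, ‖hinfVal f z‖ ≤ C) : ‖f‖ ≤ C := by
  refine (BoundedContinuousFunction.norm_le hC).mpr fun z => ?_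
  have h1 := h z z.2
  rw [hinfVal_apply f z.2] at h1
  exact h1

theorem Hinf.ext_of_forall {f g : Hinf U} (h : ∀ z ∈ U, hinfVal f z = hinfVal g z) : f = g := by
  refine Subtype.ext (BoundedContinuousFunction.ext fun z => ?_)
  rw [← hinfVal_apply f z.2, ← hinfVal_apply g z.2]
  exact h z z.2

theorem hinfVal_mk {g : ℂ → ℂ} (hg : DifferentiableOn ℂ g U)
    (hb : ∃ C : ℝ, ∀ z ∈ U, ‖g z‖ ≤ C) {z : ℂ} (hz : z ∈ U) : hinfVal (Hinf.mk g hg hb) z = g z :=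
  hinfVal_apply _ hz

theorem hinfVal_add (f g : Hinf U) {z : ℂ} (hz : z ∈ U) :
    hinfVal (f + g) z = hinfVal f z + hinfVal g z := by
  simp only [hinfVal_apply _ hz]
  rfl

theorem hinfVal_sub (f g : Hinf U) {z : ℂ} (hz : z ∈ U) :
    hinfVal (f - g) z = hinfVal f z - hinfVal g z := by
  simp only [hinfVal_apply _ hz]
  rfl

theorem hinfVal_smul (c : ℂ) (f : Hinf U) {z : ℂ} (hz : z ∈ U) :
    hinfVal (c • f) z = c * hinfVal f z := by
  simp only [hinfVal_apply _ hz]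
  rfl

theorem evalCLM_apply (f : Hinf U) {z : ℂ} (hz : z ∈ U) : Hinf.evalCLM z hz f = hinfVal f z :=
  (hinfVal_apply f hz).symm

theorem hinfVal_sum_smulRight {ι : Type*} [Fintype ι] {x : ι → ℂ} (hx : ∀ k, x k ∈ U)
    (v : ι → Hinf U) (f : Hinf U) {z : ℂ} (hz : z ∈ U) :
    hinfVal ((∑ k, (Hinf.evalCLM (x k) (hx k)).smulRight (v k) : Hinf U →L[ℂ] Hinf U) f) z =
      ∑ k, hinfVal f (x k) * hinfVal (v k) z := by
  rw [← evalCLM_apply _ hz, sum_apply, map_sum]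
  refine Finset.sum_congr rfl fun k _ => ?_
  rw [ContinuousLinearMap.smulRight_apply, map_smul, evalCLM_apply, evalCLM_apply, smul_eq_mul]

theorem isClosed_hinf (hU : IsOpen U) :
    IsClosed (Hinf U : Set (BoundedContinuousFunction U ℂ)) := by
  refine IsSeqClosed.isClosed fun f g hf hg => ?_
  have hunif : TendstoUniformlyOn (fun n => zeroExt (f n)) (zeroExt g) atTop U := by
    rw [Metric.tendstoUniformlyOn_iff]
    intro ε hε
    filter_upwards [Metric.tendsto_nhds.mp hg ε hε] with n hn z hz
    rw [zeroExt_apply g ⟨z, hz⟩, zeroExt_apply (f n) ⟨z, hz⟩, dist_comm]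
    exact (BoundedContinuousFunction.dist_coe_le_dist _).trans_lt hn
  exact hunif.tendstoLocallyUniformlyOn.differentiableOn (Eventually.of_forall hf) hU

theorem completeSpace_hinf (hU : IsOpen U) : CompleteSpace (Hinf U) :=
  (isClosed_hinf hU).isComplete.completeSpace_coe

/-- Polynomials embed in the space, as a nonempty open set is infinite. -/
theorem not_finiteDimensional_hinf (hU : IsOpen U) (hne : U.Nonempty)
    (hb : Bornology.IsBounded U) : ¬ FiniteDimensional ℂ (Hinf U) := by
  intro hfin
  let Λ : Polynomial ℂ →ₗ[ℂ] Hinf U :=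
    { toFun := fun p => Hinf.mk (fun z => p.eval z) p.differentiable.differentiableOn
        (exists_bound_of_continuous hb p.continuous)
      map_add' := fun p q => Hinf.ext_of_forall fun z hz => by
        rw [hinfVal_add _ _ hz, hinfVal_mk _ _ hz, hinfVal_mk _ _ hz, hinfVal_mk _ _ hz,
          Polynomial.eval_add]
      map_smul' := fun c p => Hinf.ext_of_forall fun z hz => by
        rw [RingHom.id_apply, hinfVal_smul _ _ hz, hinfVal_mk _ _ hz, hinfVal_mk _ _ hz,
          Polynomial.eval_smul, smul_eq_mul] }
  have hinj : Function.Injective Λ := by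
    rw [← LinearMap.ker_eq_bot, LinearMap.ker_eq_bot']
    intro p hp
    have hinf : U.Infinite := by
      obtain ⟨z, hz⟩ := hne
      exact infinite_of_mem_nhds z (hU.mem_nhds hz)
    refine Polynomial.eq_zero_of_infinite_isRoot p (hinf.mono fun z hz => ?_)
    have h1 : hinfVal (Λ p) z = p.eval z := hinfVal_mk _ _ hz
    rw [hp, hinfVal_apply _ hz] at h1
    exact h1.symm
  exact Polynomial.not_finite (R := ℂ) (Module.Finite.of_injective Λ hinj)

theorem finiteDimensional_range_sum_smulRight_comp {X ι : Type*} [NormedAddCommGroup X]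
    [NormedSpace ℂ X] [Fintype ι] (φ : ι → X →L[ℂ] ℂ) (v : ι → X) (L : X →L[ℂ] X) :
    FiniteDimensional ℂ (LinearMap.range
      (((∑ k, (φ k).smulRight (v k) : X →L[ℂ] X).comp L : X →L[ℂ] X) : X →ₗ[ℂ] X)) := by
  have hfin : FiniteDimensional ℂ (Submodule.span ℂ (Set.range v)) :=
    FiniteDimensional.span_of_finite ℂ (Set.finite_range v)
  refine Submodule.finiteDimensional_of_le (S₂ := Submodule.span ℂ (Set.range v)) ?_
  rintro _ ⟨x, rfl⟩
  change (∑ k, (φ k).smulRight (v k) : X →L[ℂ] X) (L x) ∈ _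
  rw [sum_apply]
  exact Submodule.sum_mem _ fun k _ => Submodule.smul_mem _ _ (Submodule.subset_span ⟨k, rfl⟩)

/-- A bounded linear family of holomorphic functions on `U` is a bounded operator on `Hinf U`. -/
theorem exists_clm_hinf {F : Hinf U → ℂ → ℂ} (hF : ∀ f, DifferentiableOn ℂ (F f) U) {C : ℝ}
    (hC : ∀ f, ∀ z ∈ U, ‖F f z‖ ≤ C * ‖f‖)
    (hadd : ∀ f g, ∀ z ∈ U, F (f + g) z = F f z + F g z)
    (hsmul : ∀ (c : ℂ) (f), ∀ z ∈ U, F (c • f) z = c * F f z) :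
    ∃ L : Hinf U →L[ℂ] Hinf U, ∀ f, ∀ z ∈ U, hinfVal (L f) z = F f z := by
  let Λ : Hinf U →ₗ[ℂ] Hinf U :=
    { toFun := fun f => Hinf.mk (F f) (hF f) ⟨C * ‖f‖, hC f⟩
      map_add' := fun f g => Hinf.ext_of_forall fun z hz => by
        rw [hinfVal_add _ _ hz, hinfVal_mk _ _ hz, hinfVal_mk _ _ hz, hinfVal_mk _ _ hz,
          hadd f g z hz]
      map_smul' := fun c f => Hinf.ext_of_forall fun z hz => by
        rw [RingHom.id_apply, hinfVal_smul _ _ hz, hinfVal_mk _ _ hz, hinfVal_mk _ _ hz,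
          hsmul c f z hz] }
  have hΛ : ∀ f, ∀ z ∈ U, hinfVal (Λ f) z = F f z := fun f z hz =>
    hinfVal_mk (hF f) ⟨C * ‖f‖, hC f⟩ hz
  refine ⟨Λ.mkContinuous (max C 0) fun f => ?_, hΛ⟩
  refine Hinf.norm_le_of_forall (by positivity) fun z hz => ?_
  rw [hΛ f z hz]
  exact (hC f z hz).trans (by gcongr; exact le_max_left _ _)

theorem spectralDataConverge_hinf (hU : IsOpen U) (hne : U.Nonempty) (hb : Bornology.IsBounded U)
    {L : Hinf U →L[ℂ] Hinf U} {Ln : ℕ → Hinf U →L[ℂ] Hinf U} {q C : ℝ} (hq0 : 0 < q) (hq1 : q < 1)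
    (hfin : ∀ n, FiniteDimensional ℂ (LinearMap.range (Ln n : Hinf U →ₗ[ℂ] Hinf U)))
    (hC : ∀ n, 1 ≤ n → ∀ f, ∀ z ∈ U,
      ‖hinfVal (Ln n f) z - hinfVal (L f) z‖ ≤ C * ‖f‖ * q ^ n) :
    SpectralDataConverge L Ln q := by
  have := completeSpace_hinf hU
  refine spectralDataConverge_of_norm_sub_le (C := max C 0) (not_finiteDimensional_hinf hU hne hb)
    hq0 hq1 hfin fun n hn => ?_
  refine ContinuousLinearMap.opNorm_le_bound _ (by positivity) fun f => ?_
  refine Hinf.norm_le_of_forall (by positivity) fun z hz => ?_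
  rw [sub_apply, hinfVal_sub _ _ hz]
  refine (hC n hn f z hz).trans ?_
  calc C * ‖f‖ * q ^ n = C * (‖f‖ * q ^ n) := by ring
    _ ≤ max C 0 * (‖f‖ * q ^ n) := by gcongr; exact le_max_left _ _
    _ = _ := by ring

theorem hinfVal_circleProj {ρ : ℝ} (hρ : 1 < ρ) (n : ℕ) (f : Hinf (annulus ρ)) {z : ℂ}
    (hz : z ∈ annulus ρ) : hinfVal (circleProj hρ n f) z = circleInterp n (hinfVal f) z := by
  rw [circleProj, hinfVal_sum_smulRight _ _ _ hz]
  exact Finset.sum_congr rfl fun k _ => by rw [hinfVal_mk _ _ hz]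

end HardySpace

/-! ### Elliptic domains -/

section Ellipse

variable {γp γm : ℂ}

/-- Since `joukowski w ∓ 1 = (w ∓ 1) ^ 2 / (2 w)`, this is the parallelogram law. It says that
circles become ellipses with foci `±1`. -/
theorem norm_joukowski_sub_one_add {w : ℂ} (hw : w ≠ 0) :
    ‖joukowski w - 1‖ + ‖joukowski w + 1‖ = ‖w‖ + ‖w‖⁻¹ := by
  have h1 : joukowski w - 1 = (w - 1) ^ 2 / (2 * w) := by
    rw [joukowski]
    field_simp
    ring
  have h2 : joukowski w + 1 = (w + 1) ^ 2 / (2 * w) := by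
    rw [joukowski]
    field_simp
    ring
  have h3 := parallelogram_law_with_norm ℝ w 1
  rw [norm_one] at h3
  have h4 : ‖w‖ ≠ 0 := norm_ne_zero_iff.mpr hw
  rw [h1, h2, norm_div, norm_div, norm_pow, norm_pow, norm_mul, Complex.norm_ofNat]
  field_simp
  linarith

theorem exists_joukowski_eq (x : ℂ) : ∃ w : ℂ, w ≠ 0 ∧ joukowski w = x := by
  obtain ⟨s, hs⟩ := IsAlgClosed.exists_pow_nat_eq (x ^ 2 - 1) (n := 2) two_pos
  have h1 : (x + s) * (x - s) = 1 := by linear_combination -hs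
  refine ⟨x + s, left_ne_zero_of_mul_eq_one h1, ?_⟩
  rw [joukowski, inv_eq_of_mul_eq_one_right h1]
  ring

/-- With `t = ‖w‖`, the difference of the two sides is `(ρ - t)(ρ t - 1) / (ρ t)`; both factors
cannot be negative when `ρ > 1`. -/
theorem mem_annulus_iff_add_inv_lt {ρ : ℝ} (hρ : 1 < ρ) {w : ℂ} (hw : w ≠ 0) :
    w ∈ annulus ρ ↔ ‖w‖ + ‖w‖⁻¹ < ρ + ρ⁻¹ := by
  have h0 : 0 < ‖w‖ := norm_pos_iff.mpr hw
  have hρ0 : 0 < ρ := by linarith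
  have key : ρ + ρ⁻¹ - (‖w‖ + ‖w‖⁻¹) = (ρ - ‖w‖) * (ρ * ‖w‖ - 1) / (ρ * ‖w‖) := by
    field_simp
    ring
  rw [← sub_pos, key, div_pos_iff_of_pos_right (by positivity), annulus, Set.mem_ofPred_eq,
    inv_lt_iff_one_lt_mul₀' hρ0]
  constructor
  · rintro ⟨h1, h2⟩
    exact mul_pos (by linarith) (by linarith)
  · intro h
    rcases pos_and_pos_or_neg_and_neg_of_mul_pos h with ⟨h1, h2⟩ | ⟨h1, h2⟩
    · exact ⟨by linarith, by linarith⟩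
    · nlinarith

/-- The focal description of the domain, from which its openness is immediate. -/
theorem mem_ellipse_iff (hγ : γp ≠ γm) {ρ : ℝ} (hρ : 1 < ρ) {z : ℂ} :
    z ∈ ellipse γp γm ρ ↔ ‖z - γp‖ + ‖z - γm‖ < ‖(γp - γm) / 2‖ * (ρ + ρ⁻¹) := by
  have hc : (γp - γm) / 2 ≠ 0 := div_ne_zero (sub_ne_zero.mpr hγ) two_ne_zero
  have hpos : 0 < ‖(γp - γm) / 2‖ := norm_pos_iff.mpr hc
  have hval : ∀ w : ℂ, w ≠ 0 → ‖affineFoci γp γm (joukowski w) - γp‖ +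
      ‖affineFoci γp γm (joukowski w) - γm‖ = ‖(γp - γm) / 2‖ * (‖w‖ + ‖w‖⁻¹) := fun w hw => by
    rw [← norm_joukowski_sub_one_add hw, mul_add, ← norm_mul, ← norm_mul, affineFoci]
    congr 2 <;> ring
  constructor
  · rintro ⟨_, ⟨w, hw, rfl⟩, rfl⟩
    have hw0 := ne_zero_of_mem_annulus hρ hw
    rw [hval w hw0]
    exact (mul_lt_mul_iff_right₀ hpos).mpr ((mem_annulus_iff_add_inv_lt hρ hw0).mp hw)
  · intro h
    obtain ⟨w, hw, hwx⟩ := exists_joukowski_eq ((z - (γp + γm) / 2) / ((γp - γm) / 2))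
    have hz : affineFoci γp γm (joukowski w) = z := by
      rw [hwx, affineFoci, mul_div_cancel₀ _ hc]
      ring
    refine ⟨_, ⟨w, ?_, rfl⟩, hz⟩
    rw [← hz, hval w hw, mul_lt_mul_iff_right₀ hpos] at h
    exact (mem_annulus_iff_add_inv_lt hρ hw).mpr h

theorem isOpen_ellipse (hγ : γp ≠ γm) {ρ : ℝ} (hρ : 1 < ρ) : IsOpen (ellipse γp γm ρ) := by
  have h : ellipse γp γm ρ = {z | ‖z - γp‖ + ‖z - γm‖ < ‖(γp - γm) / 2‖ * (ρ + ρ⁻¹)} :=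
    Set.ext fun z => mem_ellipse_iff hγ hρ
  rw [h]
  exact isOpen_lt (by fun_prop) continuous_const

theorem ellipse_subset {r R : ℝ} (hr : 0 < r) (hrR : r ≤ R) :
    ellipse γp γm r ⊆ ellipse γp γm R :=
  Set.image_mono (Set.image_mono (annulus_subset hr hrR))

theorem differentiableOn_comp_joukowski {ρ : ℝ} (hρ : 1 < ρ) {g : ℂ → ℂ}
    (hg : DifferentiableOn ℂ g (ellipse γp γm ρ)) :
    DifferentiableOn ℂ (fun w => g (affineFoci γp γm (joukowski w))) (annulus ρ) := by
  refine hg.comp (t := ellipse γp γm ρ) (f := fun w => affineFoci γp γm (joukowski w)) ?_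
    fun w hw => ⟨_, ⟨w, hw, rfl⟩, rfl⟩
  have h1 : DifferentiableOn ℂ joukowski (annulus ρ) :=
    (differentiableOn_id.add (differentiableOn_id.inv fun w hw =>
      ne_zero_of_mem_annulus hρ hw)).div_const 2
  exact (h1.const_mul _).add_const _

/-! ### Chebyshev interpolation -/

theorem joukowski_circleNode (n k : ℕ) :
    affineFoci γp γm (joukowski (circleNode n k)) = chebyshevNode γp γm n k := by
  rw [chebyshevNode, joukowski, circleNode, ← Complex.exp_neg, Complex.ofReal_cos, Complex.cos,
    neg_mul]
  congr 5 <;> push_cast <;> ring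

/-- Conjugate circle nodes have the same Joukowski image, so the `2 n` conditions on the circle are
the `n` Chebyshev conditions taken twice. -/
theorem chebyshevNode_reflect {n k : ℕ} (hk : k < 2 * n) :
    chebyshevNode γp γm n (2 * n - 1 - k) = chebyshevNode γp γm n k := by
  have hn : (n : ℝ) ≠ 0 := by
    have : n ≠ 0 := by lia
    exact_mod_cast this
  have h : (2 * ((2 * n - 1 - k : ℕ) : ℝ) + 1) * Real.pi / (2 * n) =
      2 * Real.pi - (2 * k + 1) * Real.pi / (2 * n) := by
    have h1 : ((2 * n - 1 - k : ℕ) : ℝ) = 2 * n - 1 - k := by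
      rw [Nat.sub_sub, Nat.cast_sub (by lia)]
      push_cast
      ring
    rw [h1]
    field_simp
    ring
  rw [chebyshevNode, chebyshevNode, h, Real.cos_two_pi_sub]

theorem injOn_chebyshevNode (hγ : γp ≠ γm) (n : ℕ) :
    Set.InjOn (fun j : Fin n => chebyshevNode γp γm n j) (Finset.univ : Finset (Fin n)) := by
  intro i _ j _ hij
  have hn : (0 : ℝ) < n := by exact_mod_cast i.pos
  have hc : (γp - γm) / 2 ≠ 0 := div_ne_zero (sub_ne_zero.mpr hγ) two_ne_zero
  have h1 := mul_left_cancel₀ hc (add_right_cancel hij)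
  have h2 := Complex.ofReal_injective h1
  have hmem : ∀ k : Fin n, (2 * (k : ℕ) + 1) * Real.pi / (2 * n) ∈ Set.Icc 0 Real.pi := fun k => by
    refine ⟨by positivity, ?_⟩
    rw [div_le_iff₀ (by positivity), mul_comm Real.pi]
    have h3 : ((k : ℕ) : ℝ) + 1 ≤ n := by exact_mod_cast k.2
    have := Real.pi_pos
    gcongr
    linarith
  have h3 := Real.injOn_cos (hmem i) (hmem j) h2
  have h4 := Real.pi_pos
  rw [div_left_inj' (by positivity), mul_left_inj' h4.ne'] at h3
  have h5 : ((i : ℕ) : ℝ) = (j : ℕ) := by linarith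
  exact Fin.ext (by exact_mod_cast h5)

/-- Each factor widens the range of exponents by one on both sides. Applied to powers of the affine
image of `joukowski w`. -/
theorem exists_laurent_eq_pow (a b c : ℂ) (i : ℕ) :
    ∃ Q ∈ Submodule.span ℂ ((fun (l : ℤ) (z : ℂ) => z ^ l) '' Set.Icc (-(i : ℤ)) i),
      ∀ w : ℂ, w ≠ 0 → Q w = (a * w + b + c * w⁻¹) ^ i := by
  induction i with
  | zero =>
    refine ⟨fun z => z ^ (0 : ℤ), Submodule.subset_span ⟨0, by simp, rfl⟩, fun w _ => by simp⟩
  | succ i ih =>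
    obtain ⟨Q, hQ, hQw⟩ := ih
    suffices h : ∃ Q' ∈ Submodule.span ℂ ((fun (l : ℤ) (z : ℂ) => z ^ l) ''
        Set.Icc (-((i + 1 : ℕ) : ℤ)) (i + 1 : ℕ)),
        ∀ w : ℂ, w ≠ 0 → Q' w = Q w * (a * w + b + c * w⁻¹) by
      obtain ⟨Q', hQ', hQ'w⟩ := h
      exact ⟨Q', hQ', fun w hw => by rw [hQ'w w hw, hQw w hw, pow_succ]⟩
    -- The remaining claim is linear in `Q`, so it can be proved by induction on the span; the
    -- identity for `Q` is not.
    clear hQw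
    induction hQ using Submodule.span_induction with
    | mem f hf =>
      obtain ⟨l, hl, rfl⟩ := hf
      have hl1 := hl.1
      have hl2 := hl.2
      have hmem : ∀ m : ℤ, -((i + 1 : ℕ) : ℤ) ≤ m → m ≤ (i + 1 : ℕ) → (fun z : ℂ => z ^ m) ∈
          Submodule.span ℂ ((fun (l : ℤ) (z : ℂ) => z ^ l) ''
            Set.Icc (-((i + 1 : ℕ) : ℤ)) (i + 1 : ℕ)) := fun m h1 h2 =>
        Submodule.subset_span ⟨m, ⟨h1, h2⟩, rfl⟩
      refine ⟨a • (fun z : ℂ => z ^ (l + 1)) + b • (fun z : ℂ => z ^ l) +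
        c • (fun z : ℂ => z ^ (l - 1)), Submodule.add_mem _ (Submodule.add_mem _ ?_ ?_) ?_, ?_⟩
      · exact Submodule.smul_mem _ _ (hmem _ (by push_cast; lia) (by push_cast; lia))
      · exact Submodule.smul_mem _ _ (hmem _ (by push_cast; lia) (by push_cast; lia))
      · exact Submodule.smul_mem _ _ (hmem _ (by push_cast; lia) (by push_cast; lia))
      · intro w hw
        simp only [Pi.add_apply, Pi.smul_apply, smul_eq_mul]
        rw [zpow_add_one₀ hw, zpow_sub_one₀ hw]
        ring
    | zero => exact ⟨0, Submodule.zero_mem _, fun w _ => by simp⟩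
    | add f g _ _ hf hg =>
      obtain ⟨F, hF, hFw⟩ := hf
      obtain ⟨G, hG, hGw⟩ := hg
      refine ⟨F + G, Submodule.add_mem _ hF hG, fun w hw => ?_⟩
      rw [Pi.add_apply, Pi.add_apply, hFw w hw, hGw w hw]
      ring
    | smul d f _ hf =>
      obtain ⟨F, hF, hFw⟩ := hf
      refine ⟨d • F, Submodule.smul_mem _ _ hF, fun w hw => ?_⟩
      rw [Pi.smul_apply, Pi.smul_apply, hFw w hw, smul_eq_mul, smul_eq_mul, mul_assoc]

/-- A polynomial of degree less than `n` becomes, under the Joukowski transform, a Laurent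
polynomial in the span of `z ^ (-n), …, z ^ (n - 1)`. -/
theorem exists_mem_laurentSpan_eq_eval {p : Polynomial ℂ} {n : ℕ} (hn : 1 ≤ n)
    (hp : p.degree < n) :
    ∃ Q ∈ laurentSpan n, ∀ w : ℂ, w ≠ 0 → Q w = p.eval (affineFoci γp γm (joukowski w)) := by
  choose Q hQ hQw using exists_laurent_eq_pow ((γp - γm) / 4) ((γp + γm) / 2) ((γp - γm) / 4)
  refine ⟨∑ i ∈ Finset.range n, p.coeff i • Q i, Submodule.sum_mem _ fun i hi =>
    Submodule.smul_mem _ _ ?_, fun w hw => ?_⟩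
  · refine Submodule.span_mono (Set.image_mono fun l hl => ?_) (hQ i)
    rw [Finset.mem_range] at hi
    have h1 := hl.1
    have h2 := hl.2
    constructor <;> lia
  · have h1 : p.natDegree < n := by
      rcases eq_or_ne p 0 with rfl | hp0
      · rw [Polynomial.natDegree_zero]
        exact hn
      · exact (Polynomial.natDegree_lt_iff_degree_lt hp0).mpr hp
    rw [Polynomial.eval_eq_sum_range' h1, Finset.sum_apply]
    refine Finset.sum_congr rfl fun i _ => ?_
    rw [Pi.smul_apply, hQw i w hw, smul_eq_mul, affineFoci, joukowski]
    congr 2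
    ring

/-- The interpolating polynomial, pulled back by the Joukowski map, is a Laurent polynomial of the
right span that agrees with the pulled-back `f` at all `2 n` circle nodes; circle interpolation
reproduces it. -/
theorem hinfVal_chebyshevProj (hγ : γp ≠ γm) {ρ : ℝ} (hρ : 1 < ρ) {n : ℕ} (hn : 1 ≤ n)
    (f : Hinf (ellipse γp γm ρ)) {w : ℂ} (hw : w ∈ annulus ρ) :
    hinfVal (chebyshevProj γp γm hρ n f) (affineFoci γp γm (joukowski w)) =
      circleInterp n (fun w => hinfVal f (affineFoci γp γm (joukowski w))) w := by
  have hz : affineFoci γp γm (joukowski w) ∈ ellipse γp γm ρ := ⟨_, ⟨w, hw, rfl⟩, rfl⟩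
  set p : Polynomial ℂ := Lagrange.interpolate Finset.univ
    (fun j : Fin n => chebyshevNode γp γm n j) (fun k => hinfVal f (chebyshevNode γp γm n k))
    with hp
  have hinj := injOn_chebyshevNode hγ n
  have hdeg : p.degree < n := by
    have h := Lagrange.degree_interpolate_lt (fun k : Fin n =>
      hinfVal f (chebyshevNode γp γm n k)) hinj
    rwa [← hp, Finset.card_univ, Fintype.card_fin] at h
  have hval : hinfVal (chebyshevProj γp γm hρ n f) (affineFoci γp γm (joukowski w)) =
      p.eval (affineFoci γp γm (joukowski w)) := by
    rw [chebyshevProj, hinfVal_sum_smulRight _ _ _ hz, hp, Lagrange.interpolate_apply,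
      Polynomial.eval_finsetSum]
    refine Finset.sum_congr rfl fun k _ => ?_
    rw [hinfVal_mk _ _ hz, Polynomial.eval_mul, Polynomial.eval_C, chebyshevLagrange]
  have hnode : ∀ k < n, p.eval (chebyshevNode γp γm n k) = hinfVal f (chebyshevNode γp γm n k) :=
    fun k hk => Lagrange.eval_interpolate_at_node (i := (⟨k, hk⟩ : Fin n)) _ hinj
      (Finset.mem_univ _)
  obtain ⟨Q, hQ, hQw⟩ := exists_mem_laurentSpan_eq_eval (γp := γp) (γm := γm) hn hdeg
  rw [hval, ← hQw w (ne_zero_of_mem_annulus hρ hw), ← circleInterp_of_mem_laurentSpan hn hQ w]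
  refine circleInterp_congr (fun k hk => ?_) w
  rw [hQw _ (circleNode_ne_zero n k), joukowski_circleNode]
  by_cases hkn : k < n
  · exact hnode k hkn
  · rw [← chebyshevNode_reflect hk]
    exact hnode _ (by lia)

/-- Chebyshev interpolation of bounded holomorphic functions on the elliptic domain with
parameter `R` converges at the rate `(r / R) ^ n` on the one with parameter `r`. -/
theorem norm_chebyshevProj_sub_le (hγ : γp ≠ γm) {r R M : ℝ} (hr : 1 < r) (hrR : r < R)
    {g : ℂ → ℂ} (hg : DifferentiableOn ℂ g (ellipse γp γm R))
    (hM : ∀ z ∈ ellipse γp γm R, ‖g z‖ ≤ M) {f : Hinf (ellipse γp γm r)}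
    (hf : ∀ z ∈ ellipse γp γm r, hinfVal f z = g z) {n : ℕ} (hn : 1 ≤ n) {z : ℂ}
    (hz : z ∈ ellipse γp γm r) :
    ‖hinfVal (chebyshevProj γp γm hr n f) z - hinfVal f z‖ ≤
      2 * (R + r) / ((1 - r⁻¹) * (R - r)) * M * (r / R) ^ n := by
  obtain ⟨_, ⟨w, hw, rfl⟩, rfl⟩ := hz
  have h1 : ∀ v ∈ annulus r, hinfVal f (affineFoci γp γm (joukowski v)) =
      g (affineFoci γp γm (joukowski v)) := fun v hv => hf _ ⟨_, ⟨v, hv, rfl⟩, rfl⟩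
  rw [hinfVal_chebyshevProj hγ hr hn f hw, h1 w hw,
    circleInterp_congr (g := fun v => g (affineFoci γp γm (joukowski v)))
      fun k _ => h1 _ (mem_annulus_of_norm_eq_one hr (norm_circleNode n k))]
  exact norm_circleInterp_sub_le hr hrR (differentiableOn_comp_joukowski (hr.trans hrR) hg)
    (fun v hv => hM _ ⟨_, ⟨v, hv, rfl⟩, rfl⟩) hn hw

end Ellipse

/-! ### Transfer operators of map-weight systems -/

section MapWeight

/-- Cauchy's formula with `|ζ - z| ≥ ρ / 2`. A mean of `‖u‖` is used instead of a supremum because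
means can be summed over a family under a pointwise bound on the sum. -/
theorem norm_le_integral_norm_circleMap {U : Set ℂ} {u : ℂ → ℂ} (hu : DifferentiableOn ℂ u U)
    {c : ℂ} {ρ : ℝ} (hρ : 0 < ρ) (hsub : Metric.closedBall c ρ ⊆ U) {z : ℂ}
    (hz : z ∈ Metric.ball c (ρ / 2)) :
    ‖u z‖ ≤ Real.pi⁻¹ * ∫ θ in (0 : ℝ)..(2 * Real.pi), ‖u (circleMap c ρ θ)‖ := by
  have hzρ : z ∈ Metric.ball c ρ := Metric.ball_subset_ball (by linarith) hz
  have hmem : ∀ θ, circleMap c ρ θ ∈ Metric.closedBall c ρ := fun θ =>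
    circleMap_mem_closedBall c hρ.le θ
  have hcont : Continuous fun θ => ‖u (circleMap c ρ θ)‖ :=
    (hu.continuousOn.comp_continuous (continuous_circleMap c ρ) fun θ => hsub (hmem θ)).norm
  have h1 := (hu.mono hsub).circleIntegral_sub_inv_smul hzρ
  have h2 : ‖∮ ζ in C(c, ρ), (ζ - z)⁻¹ • u ζ‖ ≤
      ∫ θ in (0 : ℝ)..(2 * Real.pi), 2 * ‖u (circleMap c ρ θ)‖ := by
    refine intervalIntegral.norm_integral_le_of_norm_le Real.two_pi_pos.le
      (Eventually.of_forall fun θ _ => ?_) (by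
        exact (hcont.const_mul 2).intervalIntegrable _ _)
    have h3 : ρ / 2 ≤ ‖circleMap c ρ θ - z‖ := by
      have h4 : ‖circleMap c ρ θ - c‖ = ρ := by simp [abs_of_pos hρ]
      have h5 := norm_sub_le_norm_sub_add_norm_sub (circleMap c ρ θ) z c
      rw [Metric.mem_ball, dist_eq_norm] at hz
      linarith
    rw [norm_smul, norm_smul, norm_inv, deriv_circleMap, norm_mul, Complex.norm_I, mul_one,
      norm_circleMap_zero, abs_of_pos hρ, ← mul_assoc]
    gcongr
    calc ρ * ‖circleMap c ρ θ - z‖⁻¹ ≤ ρ * (ρ / 2)⁻¹ := by gcongr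
      _ = 2 := by field_simp
  rw [h1, norm_smul, intervalIntegral.integral_const_mul] at h2
  have h6 : ‖(2 * Real.pi * Complex.I : ℂ)‖ = 2 * Real.pi := by
    simp [abs_of_pos Real.pi_pos]
  rw [h6, mul_assoc] at h2
  rw [← div_eq_inv_mul, le_div_iff₀' Real.pi_pos]
  linarith

/-- If a series of holomorphic functions converges absolutely at every point, with bounded sums of
the absolute values, then its sum is holomorphic. -/
theorem differentiableOn_tsum_of_tsum_norm_le {ι : Type*} {U : Set ℂ} (hU : IsOpen U)
    {u : ι → ℂ → ℂ} (hu : ∀ i, DifferentiableOn ℂ (u i) U) {S : ℝ}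
    (hS : ∀ z ∈ U, Summable (fun i => ‖u i z‖) ∧ ∑' i, ‖u i z‖ ≤ S) :
    DifferentiableOn ℂ (fun z => ∑' i, u i z) U := by
  intro c hc
  obtain ⟨ρ, hρ, hsub⟩ := Metric.nhds_basis_closedBall.mem_iff.mp (hU.mem_nhds hc)
  have hmem : ∀ θ, circleMap c ρ θ ∈ U := fun θ => hsub (circleMap_mem_closedBall c hρ.le θ)
  have hcont : ∀ i, Continuous fun θ => ‖u i (circleMap c ρ θ)‖ := fun i =>
    ((hu i).continuousOn.comp_continuous (continuous_circleMap c ρ) hmem).norm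
  -- Majorants for the Weierstrass test on the half disc. Their finite sums are at most `π⁻¹ * (2 π
  -- S) = 2 S`.
  set m : ι → ℝ := fun i => Real.pi⁻¹ * ∫ θ in (0 : ℝ)..(2 * Real.pi), ‖u i (circleMap c ρ θ)‖
    with hm
  have hm0 : ∀ i, 0 ≤ m i := fun i => mul_nonneg (inv_nonneg.mpr Real.pi_pos.le)
    (intervalIntegral.integral_nonneg Real.two_pi_pos.le fun _ _ => norm_nonneg _)
  have hmS : ∀ F : Finset ι, ∑ i ∈ F, m i ≤ 2 * S := fun F => by
    have h1 : ∫ θ in (0 : ℝ)..(2 * Real.pi), ∑ i ∈ F, ‖u i (circleMap c ρ θ)‖ ≤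
        ∫ _ in (0 : ℝ)..(2 * Real.pi), S := by
      refine intervalIntegral.integral_mono_on Real.two_pi_pos.le
        ((continuous_finsetSum F fun i _ => hcont i).intervalIntegrable _ _)
        (continuous_const.intervalIntegrable _ _) fun θ _ => ?_
      obtain ⟨h2, h3⟩ := hS _ (hmem θ)
      exact (h2.sum_le_tsum F fun i _ => norm_nonneg _).trans h3
    rw [intervalIntegral.integral_finsetSum fun i _ => (hcont i).intervalIntegrable _ _,
      intervalIntegral.integral_const, sub_zero, smul_eq_mul] at h1
    rw [hm, ← Finset.mul_sum, ← div_eq_inv_mul, div_le_iff₀ Real.pi_pos]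
    linarith
  have hsum : Summable m := summable_of_sum_le hm0 hmS
  have hball : Metric.ball c (ρ / 2) ⊆ U :=
    (Metric.ball_subset_closedBall.trans (Metric.closedBall_subset_closedBall (by linarith))).trans
      hsub
  exact ((Complex.differentiableOn_tsum_of_summable_norm hsum (fun i => (hu i).mono hball)
    Metric.isOpen_ball fun i z hz =>
      norm_le_integral_norm_circleMap (hu i) hρ hsub hz).differentiableAt
    (Metric.ball_mem_nhds c (half_pos hρ))).differentiableWithinAt

variable {γp γm : ℂ} {r R : ℝ} {ι : Type*} {Φ W : ι → ℂ → ℂ}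

theorem IsMapWeightSystem.summable_norm_mul (h : IsMapWeightSystem γp γm r R Φ W)
    (f : Hinf (ellipse γp γm r)) {z : ℂ} (hz : z ∈ ellipse γp γm R) :
    Summable fun i => ‖W i z * hinfVal f (Φ i z)‖ := by
  obtain ⟨S, hS⟩ := h.bounded_weight
  refine Summable.of_nonneg_of_le (fun _ => norm_nonneg _) (fun i => ?_)
    ((hS z hz).1.mul_right ‖f‖)
  rw [norm_mul]
  gcongr
  exact norm_hinfVal_le f (h.contracting i hz)

/-- The transfer operator takes values in the bounded holomorphic functions on the larger elliptic
domain. -/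
theorem IsMapWeightSystem.exists_tsum_bound (hγ : γp ≠ γm) (hR : 1 < R)
    (h : IsMapWeightSystem γp γm r R Φ W) :
    ∃ S : ℝ, ∀ f : Hinf (ellipse γp γm r),
      DifferentiableOn ℂ (fun z => ∑' i, W i z * hinfVal f (Φ i z)) (ellipse γp γm R) ∧
      ∀ z ∈ ellipse γp γm R, ‖∑' i, W i z * hinfVal f (Φ i z)‖ ≤ S * ‖f‖ := by
  obtain ⟨S, hS⟩ := h.bounded_weight
  refine ⟨S, fun f => ?_⟩
  have hbound : ∀ z ∈ ellipse γp γm R, ∑' i, ‖W i z * hinfVal f (Φ i z)‖ ≤ S * ‖f‖ :=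
    fun z hz => by
      calc ∑' i, ‖W i z * hinfVal f (Φ i z)‖ ≤ ∑' i, ‖W i z‖ * ‖f‖ := by
            refine (h.summable_norm_mul f hz).tsum_le_tsum (fun i => ?_)
              ((hS z hz).1.mul_right ‖f‖)
            rw [norm_mul]
            gcongr
            exact norm_hinfVal_le f (h.contracting i hz)
        _ = (∑' i, ‖W i z‖) * ‖f‖ := tsum_mul_right
        _ ≤ S * ‖f‖ := by
            gcongr
            exact (hS z hz).2
  refine ⟨differentiableOn_tsum_of_tsum_norm_le (isOpen_ellipse hγ hR) (fun i =>
    (h.holo_weight i).mul ((differentiableOn_hinfVal f).comp (h.holo_map i) (h.contracting i)))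
    fun z hz => ⟨h.summable_norm_mul f hz, hbound z hz⟩, fun z hz => ?_⟩
  exact (norm_tsum_le_tsum_norm (h.summable_norm_mul f hz)).trans (hbound z hz)

theorem IsMapWeightTransfer.unique {L L' : Hinf (ellipse γp γm r) →L[ℂ] Hinf (ellipse γp γm r)}
    (hL : IsMapWeightTransfer γp γm r Φ W L) (hL' : IsMapWeightTransfer γp γm r Φ W L') :
    L = L' :=
  ContinuousLinearMap.ext fun f => Hinf.ext_of_forall fun z hz => (hL f z hz).unique (hL' f z hz)

theorem IsMapWeightSystem.exists_transfer (hγ : γp ≠ γm) (hr : 1 < r) (hrR : r < R)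
    (h : IsMapWeightSystem γp γm r R Φ W) :
    ∃ L : Hinf (ellipse γp γm r) →L[ℂ] Hinf (ellipse γp γm r),
      IsMapWeightTransfer γp γm r Φ W L := by
  obtain ⟨S, hS⟩ := h.exists_tsum_bound hγ (hr.trans hrR)
  have hsub : ellipse γp γm r ⊆ ellipse γp γm R := ellipse_subset (by linarith) hrR.le
  obtain ⟨L, hL⟩ := exists_clm_hinf (F := fun f z => ∑' i, W i z * hinfVal f (Φ i z))
    (fun f => (hS f).1.mono hsub) (fun f z hz => (hS f).2 z (hsub hz))
    (fun f g z hz => by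
      rw [← (h.summable_norm_mul f (hsub hz)).of_norm.tsum_add
        (h.summable_norm_mul g (hsub hz)).of_norm]
      refine tsum_congr fun i => ?_
      rw [hinfVal_add _ _ (h.contracting i (hsub hz)), mul_add])
    (fun c f z hz => by
      rw [← tsum_mul_left]
      refine tsum_congr fun i => ?_
      rw [hinfVal_smul _ _ (h.contracting i (hsub hz)), mul_left_comm])
  refine ⟨L, fun f z hz => ?_⟩
  rw [hL f z hz]
  exact (h.summable_norm_mul f (hsub hz)).of_norm.hasSum

/-- The series defining `L f` converges on the larger ellipse with bound `S * ‖f‖`, so the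
interpolation estimate applies to `L f`. -/
theorem IsMapWeightTransfer.spectralDataConverge (hγ : γp ≠ γm) (hr : 1 < r) (hrR : r < R)
    (h : IsMapWeightSystem γp γm r R Φ W)
    {L : Hinf (ellipse γp γm r) →L[ℂ] Hinf (ellipse γp γm r)}
    (hL : IsMapWeightTransfer γp γm r Φ W L) :
    SpectralDataConverge L (fun n => (chebyshevProj γp γm hr n).comp L) (r / R) := by
  obtain ⟨S, hS⟩ := h.exists_tsum_bound hγ (hr.trans hrR)
  refine spectralDataConverge_hinf (isOpen_ellipse hγ hr)
    ⟨_, chebyshevNode_mem γp γm hr 1 0⟩ (isBounded_ellipse γp γm hr)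
    (div_pos (by linarith) (by linarith)) ((div_lt_one (by linarith)).mpr hrR)
    (C := 2 * (R + r) / ((1 - r⁻¹) * (R - r)) * S)
    (fun n => finiteDimensional_range_sum_smulRight_comp _ _ L) fun n hn f z hz => ?_
  have h1 := norm_chebyshevProj_sub_le hγ hr hrR (hS f).1 (hS f).2 (f := L f)
    (fun w hw => (hL f w hw).tsum_eq.symm) hn hz
  rwa [← mul_assoc] at h1

end MapWeight

/-! ### Expanding circle maps -/

section CircleMap

theorem isPreconnected_unitCircle : IsPreconnected (Metric.sphere (0 : ℂ) 1) :=
  isPreconnected_sphere (by rw [Complex.rank_real_complex]; norm_num) 0 1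

/-- The annulus is the image of a vertical strip under the exponential. -/
theorem isPreconnected_annulus {ρ : ℝ} (hρ : 1 < ρ) : IsPreconnected (annulus ρ) := by
  have h1 : annulus ρ = Complex.exp '' (Complex.reLm ⁻¹' Set.Ioo (Real.log ρ⁻¹) (Real.log ρ)) := by
    have h0 : 0 < ρ := by linarith
    ext z
    constructor
    · intro hz
      have hz0 := ne_zero_of_mem_annulus hρ hz
      refine ⟨Complex.log z, ?_, Complex.exp_log hz0⟩
      change Real.log ρ⁻¹ < (Complex.log z).re ∧ (Complex.log z).re < Real.log ρ
      rw [Complex.log_re]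
      exact ⟨Real.log_lt_log (inv_pos.mpr h0) hz.1, Real.log_lt_log (norm_pos_iff.mpr hz0) hz.2⟩
    · rintro ⟨v, hv, rfl⟩
      have hv' : Real.log ρ⁻¹ < v.re ∧ v.re < Real.log ρ := hv
      rw [annulus, Set.mem_ofPred_eq, Complex.norm_exp]
      exact ⟨(Real.log_lt_iff_lt_exp (inv_pos.mpr h0)).mp hv'.1,
        (Real.lt_log_iff_exp_lt h0).mp hv'.2⟩
  rw [h1]
  exact (((convex_Ioo _ _).linear_preimage Complex.reLm).isPreconnected).image _
    Complex.continuous_exp.continuousOn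

theorem norm_le_one_of_norm_le_one_on_circles {a b : ℝ} {V : Set ℂ} {f : ℂ → ℂ}
    (hf : DifferentiableOn ℂ f V) (hV : ∀ z : ℂ, a ≤ ‖z‖ → ‖z‖ ≤ b → z ∈ V)
    (h : ∀ z : ℂ, ‖z‖ = a ∨ ‖z‖ = b → z ∈ V → ‖f z‖ ≤ 1) {z : ℂ} (ha : a < ‖z‖) (hb : ‖z‖ < b) :
    ‖f z‖ ≤ 1 := by
  set A : Set ℂ := {z | a < ‖z‖ ∧ ‖z‖ < b} with hA
  have hopen : IsOpen A :=
    (isOpen_lt continuous_const continuous_norm).inter (isOpen_lt continuous_norm continuous_const)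
  have hcl : closure A ⊆ {z | a ≤ ‖z‖ ∧ ‖z‖ ≤ b} :=
    closure_minimal (fun z hz => ⟨hz.1.le, hz.2.le⟩)
      ((isClosed_le continuous_const continuous_norm).inter
        (isClosed_le continuous_norm continuous_const))
  have hclV : closure A ⊆ V := fun z hz => hV z (hcl hz).1 (hcl hz).2
  refine Complex.norm_le_of_forall_mem_frontier_norm_le (U := A)
    (isBounded_iff_forall_norm_le.mpr ⟨b, fun z hz => hz.2.le⟩)
    ((hf.mono hclV).diffContOnCl) (fun w hw => ?_) (subset_closure ⟨ha, hb⟩)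
  rw [hopen.frontier_eq] at hw
  refine h w ?_ (hclV hw.1)
  obtain ⟨h1, h2⟩ := hcl hw.1
  rcases h1.eq_or_lt with h3 | h3
  · exact Or.inl h3.symm
  · exact Or.inr (h2.eq_of_not_lt fun h4 => hw.2 ⟨h3, h4⟩)

variable {r R : ℝ} {τ : ℂ → ℂ}

theorem IsExpandingCircleMap.differentiableAt (h : IsExpandingCircleMap r R τ) {z : ℂ}
    (hz : z ∈ annulus R) : DifferentiableAt ℂ τ z :=
  h.holo.differentiableAt ((isOpen_annulus R).mem_nhds hz)

theorem IsExpandingCircleMap.deriv_ne_zero (h : IsExpandingCircleMap r R τ) {z : ℂ}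
    (hz : ‖z‖ = 1) : deriv τ z ≠ 0 := by
  obtain ⟨c, hc, h1⟩ := h.expanding
  exact norm_pos_iff.mp (by linarith [h1 z hz])

theorem mem_annulus_of_norm_eq {r R : ℝ} (hr : 1 < r) (hrR : r < R) {z : ℂ}
    (hz : ‖z‖ = r ∨ ‖z‖ = r⁻¹) : z ∈ annulus R := by
  have h1 : r⁻¹ < 1 := inv_lt_one_of_one_lt₀ hr
  exact mem_annulus_of_le (by linarith) hrR (by rcases hz with h | h <;> linarith)
    (by rcases hz with h | h <;> linarith)

/-- The image of a boundary circle is connected and misses the closed annulus, in particular the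
unit circle, so it lies wholly outside or wholly inside. -/
theorem IsExpandingCircleMap.norm_on_boundary (h : IsExpandingCircleMap r R τ) (hr : 1 < r)
    (hrR : r < R) {σ : ℝ} (hσ : σ = r ∨ σ = r⁻¹) :
    (∀ z : ℂ, ‖z‖ = σ → R ≤ ‖τ z‖) ∨ (∀ z : ℂ, ‖z‖ = σ → ‖τ z‖ ≤ R⁻¹) := by
  have hR : 1 < R := hr.trans hrR
  have hR1 : R⁻¹ < 1 := inv_lt_one_of_one_lt₀ hR
  have hout : ∀ z : ℂ, ‖z‖ = σ → R ≤ ‖τ z‖ ∨ ‖τ z‖ ≤ R⁻¹ := fun z hz => by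
    by_contra! hcon
    refine h.boundary z ?_ (subset_closure ⟨hcon.2, hcon.1⟩)
    rwa [hz]
  have hpre : IsPreconnected (τ '' Metric.sphere 0 σ) := by
    refine (isPreconnected_sphere (by rw [Complex.rank_real_complex]; norm_num) 0 σ).image _
      (h.holo.continuousOn.mono fun z hz => mem_annulus_of_norm_eq hr hrR ?_)
    rw [mem_sphere_zero_iff_norm] at hz
    rwa [hz]
  have hsub := hpre.subset_or_subset (u := {w : ℂ | 1 < ‖w‖}) (v := {w : ℂ | ‖w‖ < 1})
    (isOpen_lt continuous_const continuous_norm) (isOpen_lt continuous_norm continuous_const)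
    (Set.disjoint_left.mpr fun w (h1 : 1 < ‖w‖) (h2 : ‖w‖ < 1) => by linarith) (by
      rintro _ ⟨z, hz, rfl⟩
      rcases hout z (mem_sphere_zero_iff_norm.mp hz) with h1 | h1
      · exact Or.inl (hR.trans_le h1)
      · exact Or.inr (h1.trans_lt hR1))
  refine hsub.imp (fun h1 z hz => ?_) fun h1 z hz => ?_
  · have h2 : 1 < ‖τ z‖ := h1 ⟨z, mem_sphere_zero_iff_norm.mpr hz, rfl⟩
    exact (hout z hz).resolve_right (by linarith)
  · have h2 : ‖τ z‖ < 1 := h1 ⟨z, mem_sphere_zero_iff_norm.mpr hz, rfl⟩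
    exact (hout z hz).resolve_left (by linarith)

/-- The preimages of the unit circle under an expanding circle map lie on the unit circle. -/
theorem IsExpandingCircleMap.norm_eq_one (h : IsExpandingCircleMap r R τ) (hr : 1 < r)
    (hrR : r < R) {z : ℂ} (hz : z ∈ annulus r) (hτz : ‖τ z‖ = 1) : ‖z‖ = 1 := by
  have hr0 : 0 < r := by linarith
  have hR0 : 0 < R := by linarith
  have hR : 1 < R := hr.trans hrR
  have hr1 : r⁻¹ < 1 := inv_lt_one_of_one_lt₀ hr
  have hne0 : ∀ z ∈ annulus R, z ≠ 0 := fun z hz => ne_zero_of_mem_annulus hR hz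
  have hrR1 : r * R⁻¹ ≤ 1 := by
    rw [← div_eq_mul_inv, div_le_one hR0]
    exact hrR.le
  have hid : DifferentiableOn ℂ (fun z : ℂ => z) (annulus R) := differentiableOn_id
  have hone : ∀ z : ℂ, ‖z‖ = 1 → ‖τ z‖ = 1 := h.maps_circle
  -- Off the unit circle, the maximum principle on the annulus between `𝕋` and a boundary circle is
  -- applied to one of `(z * τ z)⁻¹`, `τ z / z`, `z / τ z`, `z * τ z`, according to the side and to
  -- where `τ` sends that boundary circle. The bound `1` contradicts `‖τ z‖ = 1`.
  rcases lt_trichotomy ‖z‖ 1 with hlt | heq | hgt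
  · exfalso
    have hV : ∀ z : ℂ, r⁻¹ ≤ ‖z‖ → ‖z‖ ≤ 1 → z ∈ annulus R := fun z h1 h2 =>
      mem_annulus_of_le hr0 hrR h1 (by linarith)
    rcases h.norm_on_boundary hr hrR (Or.inr rfl) with hb | hb
    · have h1 := norm_le_one_of_norm_le_one_on_circles ((hid.mul h.holo).inv fun z hz =>
        mul_ne_zero (hne0 z hz) (h.ne_zero z hz)) hV (fun z hz _ => by
          change ‖(z * τ z)⁻¹‖ ≤ 1
          rw [norm_inv, norm_mul]
          rcases hz with hz | hz
          · refine inv_le_one_of_one_le₀ ?_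
            rw [hz, inv_mul_eq_div, one_le_div hr0]
            exact hrR.le.trans (hb z hz)
          · rw [hz, hone z hz]
            norm_num) hz.1 hlt
      change ‖(z * τ z)⁻¹‖ ≤ 1 at h1
      rw [norm_inv, norm_mul, hτz, mul_one] at h1
      exact (one_lt_inv₀ ((inv_pos.mpr hr0).trans hz.1) |>.mpr hlt).not_ge h1
    · have h1 := norm_le_one_of_norm_le_one_on_circles (h.holo.div hid hne0) hV
        (fun z hz _ => by
          change ‖τ z / z‖ ≤ 1
          rw [norm_div]
          rcases hz with hz | hz
          · rw [hz, div_inv_eq_mul]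
            calc ‖τ z‖ * r ≤ R⁻¹ * r := by
                  gcongr
                  exact hb z hz
              _ ≤ 1 := by linarith
          · rw [hz, hone z hz]
            norm_num) hz.1 hlt
      change ‖τ z / z‖ ≤ 1 at h1
      rw [norm_div, hτz, one_div] at h1
      exact (one_lt_inv₀ ((inv_pos.mpr hr0).trans hz.1) |>.mpr hlt).not_ge h1
  · exact heq
  · exfalso
    have hV : ∀ z : ℂ, 1 ≤ ‖z‖ → ‖z‖ ≤ r → z ∈ annulus R := fun z h1 h2 =>
      mem_annulus_of_le hr0 hrR (by linarith) h2
    rcases h.norm_on_boundary hr hrR (Or.inl rfl) with hb | hb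
    · have h1 := norm_le_one_of_norm_le_one_on_circles (hid.div h.holo h.ne_zero) hV
        (fun z hz _ => by
          change ‖z / τ z‖ ≤ 1
          rw [norm_div]
          rcases hz with hz | hz
          · rw [hz, hone z hz]
            norm_num
          · have h2 := hb z hz
            rw [hz, div_le_one (hR0.trans_le h2)]
            linarith) hgt hz.2
      change ‖z / τ z‖ ≤ 1 at h1
      rw [norm_div, hτz, div_one] at h1
      linarith
    · have h1 := norm_le_one_of_norm_le_one_on_circles (hid.mul h.holo) hV
        (fun z hz _ => by
          change ‖z * τ z‖ ≤ 1
          rw [norm_mul]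
          rcases hz with hz | hz
          · rw [hz, hone z hz]
            norm_num
          · rw [hz]
            calc r * ‖τ z‖ ≤ r * R⁻¹ := by
                  gcongr
                  exact hb z hz
              _ ≤ 1 := hrR1) hgt hz.2
      change ‖z * τ z‖ ≤ 1 at h1
      rw [norm_mul, hτz, mul_one] at h1
      linarith

/-- The logarithmic derivative of a circle map is real on the unit circle. -/
theorem IsExpandingCircleMap.im_logDeriv_eq_zero (h : IsExpandingCircleMap r R τ) (hR : 1 < R)
    {z : ℂ} (hz : ‖z‖ = 1) : (z * deriv τ z / τ z).im = 0 := by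
  obtain ⟨θ, rfl⟩ : ∃ θ : ℝ, circleMap 0 1 θ = z := by
    have h1 : z ∈ Set.range (circleMap 0 1) := by
      rw [range_circleMap, mem_sphere_zero_iff_norm, hz, abs_one]
    exact h1
  set z := circleMap 0 1 θ with hzdef
  have hcomp : HasDerivAt (fun t => τ (circleMap 0 1 t)) (deriv τ z * (circleMap 0 1 θ * Complex.I))
      θ := (h.differentiableAt (mem_annulus_of_norm_eq_one hR hz)).hasDerivAt.comp θ
        (hasDerivAt_circleMap 0 1 θ)
  -- Along the circle `‖τ‖ ^ 2` is constant, so its derivative vanishes; that derivative is minus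
  -- twice the imaginary part in question.
  have h2 := hcomp.norm_sq
  have hconst : (fun t => ‖τ (circleMap 0 1 t)‖ ^ 2) = fun _ => 1 := by
    funext t
    rw [h.maps_circle _ (by simp), one_pow]
  have h3 : HasDerivAt (fun t => ‖τ (circleMap 0 1 t)‖ ^ 2) 0 θ := by
    rw [hconst]
    exact hasDerivAt_const θ 1
  have h4 := h2.unique h3
  rw [Complex.inner, ← hzdef] at h4
  have hτ1 := h.maps_circle z hz
  have hinv : (τ z)⁻¹ = (starRingEnd ℂ) (τ z) := by
    rw [Complex.inv_def, Complex.normSq_eq_norm_sq, hτ1]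
    simp
  have h5 : (deriv τ z * (z * Complex.I) * (starRingEnd ℂ) (τ z)) =
      (z * deriv τ z / τ z) * Complex.I := by
    rw [div_eq_mul_inv, hinv]
    ring
  rw [h5, Complex.mul_I_re] at h4
  linarith

/-- On the unit circle, `|τ'|` is, up to a constant sign, the logarithmic derivative of `τ`. -/
theorem IsExpandingCircleMap.exists_sign (h : IsExpandingCircleMap r R τ) (hR : 1 < R) :
    ∃ σ : ℂ, σ * σ = 1 ∧ ∀ z : ℂ, ‖z‖ = 1 → (‖deriv τ z‖ : ℂ) = σ * (z * deriv τ z / τ z) := by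
  set k : ℂ → ℂ := fun z => z * deriv τ z / τ z with hk
  have hmem : ∀ z ∈ Metric.sphere (0 : ℂ) 1, z ∈ annulus R := fun z hz =>
    mem_annulus_of_norm_eq_one hR (mem_sphere_zero_iff_norm.mp hz)
  have hcont : ContinuousOn (fun z => (k z).re) (Metric.sphere 0 1) := by
    refine Complex.continuous_re.comp_continuousOn
      (((continuousOn_id.mul (h.holo.deriv (isOpen_annulus R)).continuousOn).div
        h.holo.continuousOn h.ne_zero).mono hmem)
  have hnorm : ∀ z : ℂ, ‖z‖ = 1 → ‖k z‖ = ‖deriv τ z‖ := fun z hz => by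
    rw [hk, norm_div, norm_mul, hz, h.maps_circle z hz, one_mul, div_one]
  have hre : ∀ z : ℂ, ‖z‖ = 1 → k z = ((k z).re : ℂ) := fun z hz =>
    Complex.ext (by simp) (by simpa using h.im_logDeriv_eq_zero hR hz)
  have hne : ∀ z : ℂ, ‖z‖ = 1 → (k z).re ≠ 0 := fun z hz h0 => by
    have h1 := hnorm z hz
    rw [hre z hz, h0, Complex.ofReal_zero, norm_zero] at h1
    exact h.deriv_ne_zero hz (norm_eq_zero.mp h1.symm)
  have habs : ∀ z : ℂ, ‖z‖ = 1 → ‖deriv τ z‖ = |(k z).re| := fun z hz => by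
    rw [← hnorm z hz, hre z hz, Complex.norm_real, Complex.ofReal_re, Real.norm_eq_abs]
  -- The logarithmic derivative is real and nowhere zero on the connected circle, hence of constant
  -- sign.
  have hsub := (isPreconnected_unitCircle.image _ hcont).subset_or_subset (u := Set.Ioi 0)
    (v := Set.Iio 0) isOpen_Ioi isOpen_Iio
    (Set.disjoint_left.mpr fun x (h1 : 0 < x) (h2 : x < 0) => by linarith) (by
      rintro _ ⟨z, hz, rfl⟩
      exact (hne z (mem_sphere_zero_iff_norm.mp hz)).lt_or_gt.symm)
  rcases hsub with h1 | h1
  · refine ⟨1, by norm_num, fun z hz => ?_⟩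
    have h2 : 0 < (k z).re := h1 ⟨z, mem_sphere_zero_iff_norm.mpr hz, rfl⟩
    rw [one_mul, habs z hz, abs_of_pos h2]
    exact (hre z hz).symm
  · refine ⟨-1, by norm_num, fun z hz => ?_⟩
    have h2 : (k z).re < 0 := h1 ⟨z, mem_sphere_zero_iff_norm.mpr hz, rfl⟩
    rw [habs z hz, abs_of_neg h2, Complex.ofReal_neg, ← hre z hz, hk]
    ring

/-- Infinitely many preimages would accumulate on the circle, where the nonzero derivative makes
solutions isolated. -/
theorem IsExpandingCircleMap.finite_preimage (h : IsExpandingCircleMap r R τ) (hR : 1 < R)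
    (z : ℂ) : {ζ : ℂ | ‖ζ‖ = 1 ∧ τ ζ = z}.Finite := by
  by_contra hinf
  obtain ⟨x, hx, hacc⟩ := Set.Infinite.exists_accPt_of_subset_isCompact hinf
    (isCompact_sphere (0 : ℂ) 1) fun ζ hζ => mem_sphere_zero_iff_norm.mpr hζ.1
  rw [mem_sphere_zero_iff_norm] at hx
  rw [accPt_iff_frequently_nhdsNE] at hacc
  have hd := (h.differentiableAt (mem_annulus_of_norm_eq_one hR hx)).hasDerivAt
  exact hacc ((hd.eventually_ne (c := z) (h.deriv_ne_zero hx)).mono fun ζ hζ hmem => hζ hmem.2)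

/-- There are circles inside `annulus r`, arbitrarily close to its boundary, on which `τ` stays
away from `annulus R`. -/
theorem IsExpandingCircleMap.exists_radius (h : IsExpandingCircleMap r R τ) (hr : 1 < r)
    (hrR : r < R) : ∃ ρ δ : ℝ, 1 < ρ ∧ ρ < r ∧ 0 < δ ∧
      ∀ ζ : ℂ, ‖ζ‖ = ρ ∨ ‖ζ‖ = ρ⁻¹ → ∀ z ∈ annulus R, δ ≤ ‖τ ζ - z‖ := by
  have hr0 : 0 < r := by linarith
  -- By compactness of the circle, the boundary condition persists on all circles of nearby radius.
  -- This allows `ρ < r`, needed because functions in the space are holomorphic only on the open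
  -- annulus.
  have hev : ∀ s : ℝ, s = r ∨ s = r⁻¹ →
      ∀ᶠ x : ℝ in 𝓝 s, ∀ y ∈ Metric.sphere (0 : ℂ) 1, τ ((x : ℂ) * y) ∉ closure (annulus R) :=
        fun s hs => by
    refine (isCompact_sphere (0 : ℂ) 1).eventually_forall_of_forall_eventually fun y hy => ?_
    have hsy : ‖(s : ℂ) * y‖ = s := by
      rw [norm_mul, mem_sphere_zero_iff_norm.mp hy, mul_one, Complex.norm_real,
        Real.norm_of_nonneg (by rcases hs with rfl | rfl <;> positivity)]
    have h1 : ‖(s : ℂ) * y‖ = r ∨ ‖(s : ℂ) * y‖ = r⁻¹ := by rwa [hsy]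
    have h2 : ContinuousAt (fun p : ℝ × ℂ => τ (p.1 * p.2)) (s, y) :=
      ContinuousAt.comp (f := fun p : ℝ × ℂ => (p.1 : ℂ) * p.2) (g := τ)
        (h.differentiableAt (mem_annulus_of_norm_eq hr hrR h1)).continuousAt (by fun_prop)
    exact h2.eventually (isClosed_closure.isOpen_compl.mem_nhds (h.boundary _ h1))
  have hinv : Tendsto (fun x : ℝ => x⁻¹) (𝓝 r) (𝓝 r⁻¹) := (continuousAt_inv₀ hr0.ne').tendsto
  obtain ⟨ρ, ⟨h1, h2⟩, h3⟩ := (((hev r (Or.inl rfl)).and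
    (hinv.eventually (hev r⁻¹ (Or.inr rfl)))).filter_mono
      (nhdsWithin_le_nhds (s := Set.Iio r)) |>.and (Ioo_mem_nhdsLT hr)).exists
  have hρ0 : 0 < ρ := by linarith [h3.1]
  have hout : ∀ ζ : ℂ, ‖ζ‖ = ρ ∨ ‖ζ‖ = ρ⁻¹ → τ ζ ∉ closure (annulus R) := fun ζ hζ => by
    have hkey : ∀ s : ℝ, 0 < s → ‖ζ‖ = s → ζ = s * (ζ / s) ∧ ζ / s ∈ Metric.sphere (0 : ℂ) 1 :=
      fun s hs hζs => by
        have hs' : (s : ℂ) ≠ 0 := by exact_mod_cast hs.ne'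
        refine ⟨by field_simp, ?_⟩
        rw [mem_sphere_zero_iff_norm, norm_div, hζs, Complex.norm_real, Real.norm_of_nonneg hs.le,
          div_self hs.ne']
    rcases hζ with hζ | hζ
    · obtain ⟨h4, h5⟩ := hkey ρ hρ0 hζ
      rw [h4]
      exact h1 _ h5
    · obtain ⟨h4, h5⟩ := hkey ρ⁻¹ (inv_pos.mpr hρ0) hζ
      rw [h4]
      exact h2 _ h5
  have hK : IsCompact (τ '' (Metric.sphere 0 ρ ∪ Metric.sphere 0 ρ⁻¹)) := by
    refine ((isCompact_sphere _ _).union (isCompact_sphere _ _)).image_of_continuousOn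
      (h.holo.continuousOn.mono fun ζ hζ => mem_annulus_of_norm_eq h3.1 (h3.2.trans hrR) ?_)
    rcases hζ with hζ | hζ
    · exact Or.inl (mem_sphere_zero_iff_norm.mp hζ)
    · exact Or.inr (mem_sphere_zero_iff_norm.mp hζ)
  have hdisj : Disjoint (τ '' (Metric.sphere 0 ρ ∪ Metric.sphere 0 ρ⁻¹)) (closure (annulus R)) := by
    rw [Set.disjoint_left]
    rintro _ ⟨ζ, hζ, rfl⟩
    refine hout ζ ?_
    rcases hζ with hζ | hζ
    · exact Or.inl (mem_sphere_zero_iff_norm.mp hζ)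
    · exact Or.inr (mem_sphere_zero_iff_norm.mp hζ)
  -- A compact set and a closed set that are disjoint have positive distance.
  obtain ⟨δ, hδ, hlt⟩ := Metric.exists_pos_forall_lt_edist hK isClosed_closure hdisj
  refine ⟨ρ, δ, h3.1, h3.2, hδ, fun ζ hζ z hz => ?_⟩
  have h4 := hlt (τ ζ) ⟨ζ, by simpa using hζ, rfl⟩ z (subset_closure hz)
  rw [edist_nndist, ENNReal.coe_lt_coe, ← NNReal.coe_lt_coe, coe_nndist, dist_eq_norm] at h4
  exact h4.le

end CircleMap

/-! ### Transfer operators of expanding circle maps -/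

section CircleTransfer

/-- Holomorphic functions on an annulus that agree on the unit circle are equal. -/
theorem eqOn_annulus_of_eqOn_unitCircle {r : ℝ} (hr : 1 < r) {f g : ℂ → ℂ}
    (hf : DifferentiableOn ℂ f (annulus r)) (hg : DifferentiableOn ℂ g (annulus r))
    (hfg : ∀ z : ℂ, ‖z‖ = 1 → f z = g z) : Set.EqOn f g (annulus r) := by
  have hacc : AccPt (1 : ℂ) (𝓟 (Metric.sphere (0 : ℂ) 1)) :=
    isPreconnected_unitCircle.preperfect_of_nontrivial
      ⟨1, by simp, -1, by simp, by norm_num⟩ 1 (by simp)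
  refine (hf.analyticOnNhd (isOpen_annulus r)).eqOn_of_preconnected_of_frequently_eq
    (hg.analyticOnNhd (isOpen_annulus r)) (isPreconnected_annulus hr)
    (mem_annulus_of_norm_eq_one hr norm_one) ?_
  exact (accPt_iff_frequently_nhdsNE.mp hacc).mono fun z hz =>
    hfg z (mem_sphere_zero_iff_norm.mp hz)

/-- Differentiation under the integral sign; the uniform distance `δ` dominates the derivative of
the kernel. -/
theorem differentiableOn_integral_mul_inv_sub {U : Set ℂ} (hU : IsOpen U) {G T : ℝ → ℂ}
    (hG : Continuous G) (hT : Continuous T) {δ : ℝ} (hδ : 0 < δ)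
    (hd : ∀ θ, ∀ z ∈ U, δ ≤ ‖T θ - z‖) (a b : ℝ) :
    DifferentiableOn ℂ (fun z => ∫ θ in a..b, G θ * (T θ - z)⁻¹) U := by
  have hne : ∀ z ∈ U, ∀ θ, T θ - z ≠ 0 := fun z hz θ => norm_pos_iff.mp (hδ.trans_le (hd θ z hz))
  have hcont : ∀ z ∈ U, Continuous fun θ => G θ * (T θ - z)⁻¹ := fun z hz =>
    hG.mul ((hT.sub continuous_const).inv₀ (hne z hz))
  have hcont' : ∀ z ∈ U, Continuous fun θ => G θ * ((T θ - z) ^ 2)⁻¹ := fun z hz =>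
    hG.mul (((hT.sub continuous_const).pow 2).inv₀ fun θ => pow_ne_zero 2 (hne z hz θ))
  intro z₀ hz₀
  refine (intervalIntegral.hasDerivAt_integral_of_dominated_loc_of_deriv_le
    (F := fun z θ => G θ * (T θ - z)⁻¹) (F' := fun z θ => G θ * ((T θ - z) ^ 2)⁻¹)
    (bound := fun θ => ‖G θ‖ * (δ ^ 2)⁻¹) (hU.mem_nhds hz₀) ?_
    ((hcont z₀ hz₀).intervalIntegrable _ _)
    (hcont' z₀ hz₀).aestronglyMeasurable ?_
    ((hG.norm.mul continuous_const).intervalIntegrable _ _)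
    ?_).2.differentiableAt.differentiableWithinAt
  · filter_upwards [hU.mem_nhds hz₀] with z hz
    exact (hcont z hz).aestronglyMeasurable
  · refine Eventually.of_forall fun θ _ z hz => ?_
    rw [norm_mul, norm_inv, norm_pow]
    gcongr
    exact hd θ z hz
  · refine Eventually.of_forall fun θ _ z hz => ?_
    have h1 := (((hasDerivAt_id z).const_sub (T θ)).inv (hne z hz θ)).const_mul (G θ)
    refine h1.congr_deriv ?_
    rw [neg_neg, one_div]
    rfl

theorem differentiableOn_circleIntegral_mul_inv_sub {U : Set ℂ} (hU : IsOpen U) {g τ : ℂ → ℂ}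
    {a : ℝ} (ha : 0 ≤ a) (hg : ContinuousOn g (Metric.sphere 0 a))
    (hτ : ContinuousOn τ (Metric.sphere 0 a)) {δ : ℝ} (hδ : 0 < δ)
    (hd : ∀ ζ, ‖ζ‖ = a → ∀ z ∈ U, δ ≤ ‖τ ζ - z‖) :
    DifferentiableOn ℂ (fun z => ∮ ζ in C(0, a), g ζ * (τ ζ - z)⁻¹) U := by
  have hmem := fun θ => circleMap_mem_sphere (0 : ℂ) ha θ
  have h1 := differentiableOn_integral_mul_inv_sub hU
    (((continuous_circleMap 0 a).mul continuous_const).mul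
      (hg.comp_continuous (continuous_circleMap 0 a) hmem) :
        Continuous fun θ => circleMap 0 a θ * Complex.I * g (circleMap 0 a θ))
    (hτ.comp_continuous (continuous_circleMap 0 a) hmem) hδ
    (fun θ z hz => hd _ (mem_sphere_zero_iff_norm.mp (hmem θ)) z hz) 0 (2 * Real.pi)
  refine h1.congr fun z _ => ?_
  simp only [circleIntegral, deriv_circleMap, smul_eq_mul, ← mul_assoc]
  rfl

theorem annulusIntegral_add {ρ : ℝ} {g h : ℂ → ℂ}
    (hg : CircleIntegrable g 0 ρ) (hg' : CircleIntegrable g 0 ρ⁻¹)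
    (hh : CircleIntegrable h 0 ρ) (hh' : CircleIntegrable h 0 ρ⁻¹) :
    annulusIntegral ρ (fun z => g z + h z) = annulusIntegral ρ g + annulusIntegral ρ h := by
  rw [annulusIntegral, annulusIntegral, annulusIntegral, circleIntegral.integral_add hg hh,
    circleIntegral.integral_add hg' hh']
  ring

/-- The integral kernel operator that represents the transfer operator of `τ` with weight `w`. -/
def kernelTransfer (τ w : ℂ → ℂ) (σ : ℂ) (ρ : ℝ) (f : ℂ → ℂ) (z : ℂ) : ℂ :=
  σ * z * annulusIntegral ρ (fun ζ => w ζ * f ζ * ζ⁻¹ * (τ ζ - z)⁻¹)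

variable {r R : ℝ} {τ w : ℂ → ℂ}

theorem IsCircleTransfer.unique (hr : 1 < r) {L L' : Hinf (annulus r) →L[ℂ] Hinf (annulus r)}
    (hL : IsCircleTransfer r τ w L) (hL' : IsCircleTransfer r τ w L') : L = L' := by
  refine ContinuousLinearMap.ext fun f => Hinf.ext_of_forall fun z hz =>
    eqOn_annulus_of_eqOn_unitCircle hr (differentiableOn_hinfVal _) (differentiableOn_hinfVal _)
      (fun z hz => ?_) hz
  rw [hL f z hz, hL' f z hz]

/-- The poles of the kernel in `annulus r` are the preimages of `z`, all on the unit circle by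
`norm_eq_one` and simple. The residue at `ζ` is `w ζ * f ζ / (ζ * τ' ζ)`, and as `τ ζ = z` the
prefactor `σ * z` turns `1 / (ζ * τ' ζ)` into `1 / |τ' ζ|`. -/
theorem IsExpandingCircleMap.kernelTransfer_eq (h : IsExpandingCircleMap r R τ) (hr : 1 < r)
    (hrR : r < R) (hw : DifferentiableOn ℂ w (annulus R)) {σ : ℂ} (hσ : σ * σ = 1)
    (hσ' : ∀ z : ℂ, ‖z‖ = 1 → (‖deriv τ z‖ : ℂ) = σ * (z * deriv τ z / τ z)) {ρ : ℝ} (hρ : 1 < ρ)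
    (hρr : ρ < r) {f : ℂ → ℂ} (hf : DifferentiableOn ℂ f (annulus r)) {z : ℂ} (hz : ‖z‖ = 1) :
    kernelTransfer τ w σ ρ f z =
      ∑ᶠ ζ ∈ {ζ : ℂ | ‖ζ‖ = 1 ∧ τ ζ = z}, w ζ / (‖deriv τ ζ‖ : ℂ) * f ζ := by
  have hsub := annulus_subset (by linarith) hrR.le
  have hfin := h.finite_preimage (hr.trans hrR) z
  have hS : ∀ s ∈ hfin.toFinset, ‖s‖ = 1 ∧ τ s = z := fun s hs => hfin.mem_toFinset.mp hs
  have hz0 : z ≠ 0 := norm_pos_iff.mp (by linarith)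
  have hnum : DifferentiableOn ℂ (fun ζ => w ζ * f ζ * ζ⁻¹) (annulus r) :=
    ((hw.mono hsub).mul hf).mul (differentiableOn_id.inv fun ζ hζ => ne_zero_of_mem_annulus hr hζ)
  rw [finsum_mem_eq_finite_toFinset_sum _ hfin, kernelTransfer,
    annulusIntegral_eq_sum_residues (S := hfin.toFinset)
      (c := fun s => w s * f s * s⁻¹ * (deriv τ s)⁻¹) hρ hρr
      (fun s hs => mem_annulus_of_norm_eq_one hρ (hS s hs).1), Finset.mul_sum]
  · refine Finset.sum_congr rfl fun s hs => ?_
    obtain ⟨h1, h2⟩ := hS s hs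
    have h3 : s ≠ 0 := norm_pos_iff.mp (by linarith)
    have h4 := h.deriv_ne_zero h1
    have h5 : σ ≠ 0 := left_ne_zero_of_mul_eq_one hσ
    rw [hσ' s h1, h2]
    field_simp
    rw [pow_two, hσ, one_mul]
  · refine (hnum.mono Set.sdiff_subset).mul
      (DifferentiableOn.inv ((h.holo.mono (Set.sdiff_subset.trans hsub)).sub_const z) ?_)
    intro ζ hζ h0
    have h1 : τ ζ = z := sub_eq_zero.mp h0
    exact hζ.2 (hfin.mem_toFinset.mpr ⟨h.norm_eq_one hr hrR hζ.1 (h1 ▸ hz), h1⟩)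
  · intro s hs
    obtain ⟨h1, h2⟩ := hS s hs
    have h3 := (hasDerivAt_iff_tendsto_slope.mp
      (h.differentiableAt (mem_annulus_of_norm_eq_one (hr.trans hrR) h1)).hasDerivAt).inv₀
        (h.deriv_ne_zero h1)
    have h4 := (hnum.differentiableAt ((isOpen_annulus r).mem_nhds
      (mem_annulus_of_norm_eq_one hr h1))).continuousAt.tendsto.mono_left
        (nhdsWithin_le_nhds (s := {s}ᶜ))
    refine (h4.mul h3).congr fun ζ => ?_
    rw [slope_def_field, inv_div, h2, div_eq_mul_inv]
    ring

/-- The transfer operator of an expanding circle map is given by an integral kernel, and it maps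
the bounded holomorphic functions on `annulus r` to those on `annulus R`. -/
theorem IsExpandingCircleMap.exists_kernel (h : IsExpandingCircleMap r R τ) (hr : 1 < r)
    (hrR : r < R) (hw : DifferentiableOn ℂ w (annulus R))
    (hb : ∃ C : ℝ, ∀ z ∈ annulus R, ‖w z‖ ≤ C) :
    ∃ (F : Hinf (annulus r) → ℂ → ℂ) (C : ℝ), (∀ f, DifferentiableOn ℂ (F f) (annulus R)) ∧
      (∀ f, ∀ z ∈ annulus R, ‖F f z‖ ≤ C * ‖f‖) ∧
      (∀ f g, ∀ z ∈ annulus R, F (f + g) z = F f z + F g z) ∧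
      (∀ (c : ℂ) (f), ∀ z ∈ annulus R, F (c • f) z = c * F f z) ∧
      ∀ f, ∀ z : ℂ, ‖z‖ = 1 →
        F f z = ∑ᶠ ζ ∈ {ζ : ℂ | ‖ζ‖ = 1 ∧ τ ζ = z}, w ζ / (‖deriv τ ζ‖ : ℂ) * hinfVal f ζ := by
  obtain ⟨σ, hσ, hσ'⟩ := h.exists_sign (hr.trans hrR)
  obtain ⟨ρ, δ, hρ, hρr, hδ, hd⟩ := h.exists_radius hr hrR
  obtain ⟨B, hB⟩ := hb
  have hρ0 : 0 < ρ := by linarith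
  have hσ1 : ‖σ‖ = 1 := by
    have h1 := congrArg norm hσ
    rw [norm_mul, norm_one] at h1
    nlinarith [norm_nonneg σ]
  have hmem : ∀ ζ : ℂ, ‖ζ‖ = ρ ∨ ‖ζ‖ = ρ⁻¹ → ζ ∈ annulus r := fun ζ hζ =>
    mem_annulus_of_norm_eq hρ hρr hζ
  have hsub : annulus r ⊆ annulus R := annulus_subset (by linarith) hrR.le
  have hcirc : ∀ a : ℝ, a = ρ ∨ a = ρ⁻¹ → 0 ≤ a ∧ Metric.sphere (0 : ℂ) a ⊆ annulus r :=
    fun a ha => ⟨by rcases ha with rfl | rfl <;> positivity, fun ζ hζ => hmem ζ (by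
      rwa [mem_sphere_zero_iff_norm.mp hζ])⟩
  have hnum : ∀ f : Hinf (annulus r), ContinuousOn (fun ζ => w ζ * hinfVal f ζ * ζ⁻¹)
      (annulus r) := fun f =>
    ((hw.continuousOn.mono hsub).mul (differentiableOn_hinfVal f).continuousOn).mul
      (continuousOn_id.inv₀ fun ζ hζ => ne_zero_of_mem_annulus hr hζ)
  have hint : ∀ f : Hinf (annulus r), ∀ z ∈ annulus R, ∀ a : ℝ, a = ρ ∨ a = ρ⁻¹ →
      CircleIntegrable (fun ζ => w ζ * hinfVal f ζ * ζ⁻¹ * (τ ζ - z)⁻¹) 0 a := fun f z hz a ha => by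
    obtain ⟨ha0, hasub⟩ := hcirc a ha
    refine ContinuousOn.circleIntegrable ha0 (((hnum f).mono hasub).mul
      (((h.holo.continuousOn.mono (hasub.trans hsub)).sub continuousOn_const).inv₀ fun ζ hζ => ?_))
    exact norm_pos_iff.mp (hδ.trans_le (hd ζ (by rwa [mem_sphere_zero_iff_norm.mp hζ]) z hz))
  refine ⟨fun f => kernelTransfer τ w σ ρ (hinfVal f),
    -- Here `R` bounds `‖z‖`, `B` bounds `w`, the `ρ` next to `B` bounds `‖ζ‖⁻¹` on both circles,
    -- and `δ⁻¹` bounds the kernel; the outer `ρ` and `ρ⁻¹` are the radii.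
    R * (ρ * (B * ρ * δ⁻¹) + ρ⁻¹ * (B * ρ * δ⁻¹)), fun f => ?_, fun f z hz => ?_,
    fun f g z hz => ?_, fun c f z hz => ?_, fun f z hz =>
      h.kernelTransfer_eq hr hrR hw hσ hσ' hρ hρr (differentiableOn_hinfVal f) hz⟩
  · have h1 : ∀ a : ℝ, a = ρ ∨ a = ρ⁻¹ → DifferentiableOn ℂ (fun z => ∮ ζ in C(0, a),
        w ζ * hinfVal f ζ * ζ⁻¹ * (τ ζ - z)⁻¹) (annulus R) := fun a ha =>
      differentiableOn_circleIntegral_mul_inv_sub (isOpen_annulus R) (hcirc a ha).1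
        ((hnum f).mono (hcirc a ha).2) (h.holo.continuousOn.mono ((hcirc a ha).2.trans hsub)) hδ
        fun ζ hζ => hd ζ (by rwa [hζ])
    exact (differentiableOn_id.const_mul σ).mul
      (((h1 ρ (Or.inl rfl)).sub (h1 ρ⁻¹ (Or.inr rfl))).const_mul _)
  · have h1 : ∀ ζ : ℂ, ‖ζ‖ = ρ ∨ ‖ζ‖ = ρ⁻¹ →
        ‖w ζ * hinfVal f ζ * ζ⁻¹ * (τ ζ - z)⁻¹‖ ≤ B * ‖f‖ * ρ * δ⁻¹ := fun ζ hζ => by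
      have h2 := hB ζ (hsub (hmem ζ hζ))
      have h3 := norm_hinfVal_le f (hmem ζ hζ)
      have h4 : ‖ζ‖⁻¹ ≤ ρ := by
        rcases hζ with h5 | h5
        · rw [h5]
          exact (inv_lt_one_of_one_lt₀ hρ).le.trans hρ.le
        · rw [h5, inv_inv]
      have h5 := hd ζ hζ z hz
      have hB0 : 0 ≤ B := (norm_nonneg _).trans h2
      rw [norm_mul, norm_mul, norm_mul, norm_inv, norm_inv]
      gcongr
    change ‖kernelTransfer _ _ _ _ _ _‖ ≤ _
    rw [kernelTransfer, norm_mul, norm_mul, hσ1, one_mul]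
    calc ‖z‖ * ‖annulusIntegral ρ (fun ζ => w ζ * hinfVal f ζ * ζ⁻¹ * (τ ζ - z)⁻¹)‖
        ≤ R * (ρ * (B * ‖f‖ * ρ * δ⁻¹) + ρ⁻¹ * (B * ‖f‖ * ρ * δ⁻¹)) := by
          gcongr
          · linarith
          · exact hz.2.le
          · exact norm_annulusIntegral_le hρ0 (fun ζ hζ => h1 ζ (Or.inl hζ))
              fun ζ hζ => h1 ζ (Or.inr hζ)
      _ = _ := by ring
  · simp only [kernelTransfer]
    rw [← mul_add,
      ← annulusIntegral_add (hint f z hz _ (Or.inl rfl)) (hint f z hz _ (Or.inr rfl))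
        (hint g z hz _ (Or.inl rfl)) (hint g z hz _ (Or.inr rfl))]
    congr 1
    refine annulusIntegral_congr hρ0 fun ζ hζ => ?_
    rw [hinfVal_add _ _ (hmem ζ hζ)]
    ring
  · simp only [kernelTransfer]
    rw [mul_left_comm c, mul_comm c, ← annulusIntegral_mul_const]
    congr 1
    refine annulusIntegral_congr hρ0 fun ζ hζ => ?_
    rw [hinfVal_smul _ _ (hmem ζ hζ)]
    ring

theorem IsExpandingCircleMap.exists_transfer (h : IsExpandingCircleMap r R τ) (hr : 1 < r)
    (hrR : r < R) (hw : DifferentiableOn ℂ w (annulus R))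
    (hb : ∃ C : ℝ, ∀ z ∈ annulus R, ‖w z‖ ≤ C) :
    ∃ L : Hinf (annulus r) →L[ℂ] Hinf (annulus r), IsCircleTransfer r τ w L := by
  obtain ⟨F, C, h1, h2, h3, h4, h5⟩ := h.exists_kernel hr hrR hw hb
  have hsub : annulus r ⊆ annulus R := annulus_subset (by linarith) hrR.le
  obtain ⟨L, hL⟩ := exists_clm_hinf (fun f => (h1 f).mono hsub) (fun f z hz => h2 f z (hsub hz))
    (fun f g z hz => h3 f g z (hsub hz)) fun c f z hz => h4 c f z (hsub hz)
  exact ⟨L, fun f z hz => (hL f z (mem_annulus_of_norm_eq_one hr hz)).trans (h5 f z hz)⟩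

theorem IsCircleTransfer.spectralDataConverge (hr : 1 < r) (hrR : r < R)
    (h : IsExpandingCircleMap r R τ) (hw : DifferentiableOn ℂ w (annulus R))
    (hb : ∃ C : ℝ, ∀ z ∈ annulus R, ‖w z‖ ≤ C)
    {L : Hinf (annulus r) →L[ℂ] Hinf (annulus r)} (hL : IsCircleTransfer r τ w L) :
    SpectralDataConverge L (fun n => (circleProj hr n).comp L) (r / R) := by
  obtain ⟨F, C, h1, h2, -, -, h5⟩ := h.exists_kernel hr hrR hw hb
  have hsub : annulus r ⊆ annulus R := annulus_subset (by linarith) hrR.le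
  -- By the identity theorem `F f` is a bounded holomorphic extension of `L f` to `annulus R`, to
  -- which the interpolation estimate applies.
  have hLF : ∀ f, Set.EqOn (hinfVal (L f)) (F f) (annulus r) := fun f =>
    eqOn_annulus_of_eqOn_unitCircle hr (differentiableOn_hinfVal _) ((h1 f).mono hsub)
      fun z hz => (hL f z hz).trans (h5 f z hz).symm
  refine spectralDataConverge_hinf (isOpen_annulus r)
    ⟨1, mem_annulus_of_norm_eq_one hr norm_one⟩
    (isBounded_iff_forall_norm_le.mpr ⟨r, fun z hz => hz.2.le⟩)
    (div_pos (by linarith) (by linarith)) ((div_lt_one (by linarith)).mpr hrR)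
    (C := 2 * (R + r) / ((1 - r⁻¹) * (R - r)) * C)
    (fun n => finiteDimensional_range_sum_smulRight_comp _ _ L) fun n hn f z hz => ?_
  have h6 := norm_circleInterp_sub_le hr hrR (h1 f) (h2 f) hn hz
  rw [ContinuousLinearMap.comp_apply, hinfVal_circleProj hr n _ hz, hLF f hz,
    circleInterp_congr fun k _ => hLF f (mem_annulus_of_norm_eq_one hr (norm_circleNode n k))]
  rwa [← mul_assoc] at h6

end CircleTransfer

end

theorem corollary3p8 {r R : ℝ} (hr : 1 < r) (hrR : r < R) :
    -- map-weight systems on elliptic domains, Lagrange--Chebyshev interpolation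
    (∀ (γp γm : ℂ), γp ≠ γm → ∀ (ι : Type u) [Countable ι] (Φ W : ι → ℂ → ℂ),
      IsMapWeightSystem γp γm r R Φ W →
      (∃! L : Hinf (ellipse γp γm r) →L[ℂ] Hinf (ellipse γp γm r),
        IsMapWeightTransfer γp γm r Φ W L) ∧
      ∀ L : Hinf (ellipse γp γm r) →L[ℂ] Hinf (ellipse γp γm r),
        IsMapWeightTransfer γp γm r Φ W L →
        SpectralDataConverge L (fun n => (chebyshevProj γp γm hr n).comp L) (r / R)) ∧
    -- expanding circle maps on annuli, equidistant interpolation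
    (∀ (τ w : ℂ → ℂ), IsExpandingCircleMap r R τ →
      DifferentiableOn ℂ w (annulus R) → (∃ C : ℝ, ∀ z ∈ annulus R, ‖w z‖ ≤ C) →
      (∃! L : Hinf (annulus r) →L[ℂ] Hinf (annulus r), IsCircleTransfer r τ w L) ∧
      ∀ L : Hinf (annulus r) →L[ℂ] Hinf (annulus r), IsCircleTransfer r τ w L →
        SpectralDataConverge L (fun n => (circleProj hr n).comp L) (r / R)) := by
  refine ⟨fun γp γm hγ ι _ Φ W h => ⟨?_, fun L hL => hL.spectralDataConverge hγ hr hrR h⟩,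
    fun τ w hτ hw hb => ⟨?_, fun L hL => hL.spectralDataConverge hr hrR hτ hw hb⟩⟩
  · obtain ⟨L, hL⟩ := h.exists_transfer hγ hr hrR
    exact ⟨L, hL, fun L' hL' => hL'.unique hL⟩
  · obtain ⟨L, hL⟩ := hτ.exists_transfer hr hrR hw hb
    exact ⟨L, hL, fun L' hL' => hL'.unique hr hL⟩
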